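/- For $n\in\mathbb N\cup\{\omega\}$, an \emph{$n$-globular set} $X$ consists of sets $X_k$ for $k\in\mathbb N$, $k\le n$, and maps $s,t\colon X_{k+1}\to X_k$ with $ss=st$ and $ts=tt$. For $i\le k$ write $s_i,t_i\colon X_k\to X_i$ for the iterated source and target. Cells $u\in X_k$ and $v\in X_l$ are \emph{$i$-composable} if $t_i(u)=s_i(v)$; two cells of $X_k$ are \emph{parallel} if $k=0$ or they have the same source and the same target. An \emph{$n$-precategory} $C$ is an $n$-globular set with identities $\mathrm{id}\colon C_k\to C_{k+1}$ for $k<n$ and, for $1\le k,l\le n$ and $i=\min(k,l)-1$, composites $u\circ_i v\in C_{\max(k,l)}$ of $i$-composable $u\in C_k$, $v\in C_l$, such that: \begin{itemize} \item $s(\mathrm{id}_u)=u=t(\mathrm{id}_u)$; \item for $\partial\in\{s,t\}$, $\partial(u\circ_i v)$ is $u\circ_i\partial v$ if $k<l$ and $(\partial u)\circ_i v$ if $k>l$; if $k=l$, then $s(u\circ_i v)=s(u)$ and $t(u\circ_i v)=t(v)$; \item for $u\in C_{k-1}$ and $v\in C_l$, $\mathrm{id}_u\circ_i v$ is $v$ if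 $k\le l$ and $\mathrm{id}_{u\circ_i v}$ if $k>l$; for $u\in C_k$ and $v\in C_{l-1}$, $u\circ_i\mathrm{id}_v$ is $u$ if $l\le k$ and $\mathrm{id}_{u\circ_i v}$ if $l>k$; \item $(u\circ_i v)\circ_i w=u\circ_i(v\circ_i w)$ whenever both sides are defined; \item for $i<j$, $u\circ_i(v\circ_j v')=(u\circ_i v)\circ_j(u\circ_i v')$ and $(u\circ_j u')\circ_i v=(u\circ_i v)\circ_j(u'\circ_i v)$ whenever the left-hand side is defined. \end{itemize} (No interchange law is required.) An \emph{$n$-prefunctor} is a family of maps $C_k\to D_k$ preserving sources, targets, identities and composites. \emph{$n$-Polygraphs} $P$, the free $n$-precategories $P^*$ on them, their morphisms $F\colon P\to Q$ and the induced $n$-prefunctors $F^*\colon P^*\to Q^*$ are defined by recursion. A $0$-polygraph is a set, a morphism of $0$-polygraphs is a map, $P^*=P$ and $F^*=F$. For $n\in\mathbb N$, an $(n+1)$-polygraph consists of an $n$-polygraph $P$ and a set $G$ of $(n+1)$-generators with maps $s,t\colon G\to P^*_n$ such that $s(g)$ and $t(g)$ are parallel for every $g$; its free $(n+1)$-precategory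 is obtained from $P^*$ by freely adjoining the $g\in G$ as $(n+1)$-cells $s(g)\to t(g)$, and has $P^*$ as $n$-truncation. A morphism $(P,G)\to(Q,H)$ consists of a morphism $F\colon P\to Q$ of $n$-polygraphs and a map $f\colon G\to H$ with $s(f(g))=F^*(s(g))$ and $t(f(g))=F^*(t(g))$; the induced prefunctor is the one extending $F^*$ and $f$. An $\omega$-polygraph is a sequence of $n$-polygraphs, $n\in\mathbb N$, each being the truncation of the next one, with morphisms defined in the same way; $P^*$ and $F^*$ are determined by their $n$-truncations, which are those of the $n$-th terms of the sequences. \textbf{Proposition.} Let $n\in\mathbb N\cup\{\omega\}$ and let $F\colon P\to Q$ be a morphism of $n$-polygraphs. Then $F^*\colon P^*\to Q^*$ is \emph{Conduché}: for all $i\in\mathbb N$ and integers $1\le k_1,k_2\le n$ with $i=\min(k_1,k_2)-1$, setting $k=\max(k_1,k_2)$, for every $u\in P^*_k$ and all $i$-composable $v_1\in Q^*_{k_1}$, $v_2\in Q^*_{k_2}$ with $F^*(u)=v_1\circ_i v_2$, there is a unique pair of $i$-composable cells $u_1\in P^*_{k_1}$, $u_2\in P^*_{k_2}$ such that $F^*(u_1)=v_1$,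 $F^*(u_2)=v_2$ and $u_1\circ_i u_2=u$. -/

import Mathlib

universe u

/-- An `n`-globular set, `n ∈ ℕ ∪ {ω}`: sets of `k`-globes with source and target maps.  The
family of sets is indexed by all `k : ℕ`, with no globe of dimension `k > n`. -/
structure GlobularSet (n : ℕ∞) where
  cell : ℕ → Type u
  cell_isEmpty : ∀ k : ℕ, n < (k : ℕ∞) → IsEmpty (cell k)
  src : ∀ {k : ℕ}, cell (k + 1) → cell k
  tgt : ∀ {k : ℕ}, cell (k + 1) → cell k
  src_src : ∀ {k : ℕ} (x : cell (k + 2)), src (src x) = src (tgt x)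
  tgt_src : ∀ {k : ℕ} (x : cell (k + 2)), tgt (src x) = tgt (tgt x)

theorem le_left_of_min {i k l : ℕ} (h : i + 1 = min k l) : i ≤ k := by omega

theorem le_right_of_min {i k l : ℕ} (h : i + 1 = min k l) : i ≤ l := by omega

namespace GlobularSet

variable {n : ℕ∞} (X : GlobularSet.{u} n)

/-- Iterated source: the `i`-dimensional source of a `k`-globe, `i ≤ k`. -/
def srcAt {i k : ℕ} (h : i ≤ k) : X.cell k → X.cell i :=
  Nat.leRec (motive := fun k _ => X.cell k → X.cell i) id (fun _ _ f x => f (X.src x)) h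

/-- Iterated target: the `i`-dimensional target of a `k`-globe, `i ≤ k`. -/
def tgtAt {i k : ℕ} (h : i ≤ k) : X.cell k → X.cell i :=
  Nat.leRec (motive := fun k _ => X.cell k → X.cell i) id (fun _ _ f x => f (X.tgt x)) h

/-- `u` and `v` are `i`-composable, where `i = min k l - 1`. -/
def Composable {i k l : ℕ} (hi : i + 1 = min k l) (u : X.cell k) (v : X.cell l) : Prop :=
  X.tgtAt (le_left_of_min hi) u = X.srcAt (le_right_of_min hi) v

/-- Parallel globes (any two `0`-globes are parallel). -/
def Parallel : ∀ {k : ℕ}, X.cell k → X.cell k → Prop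
  | 0, _, _ => True
  | _ + 1, x, y => X.src x = X.src y ∧ X.tgt x = X.tgt y

theorem srcAt_self {k : ℕ} (h : k ≤ k) (x : X.cell k) : X.srcAt h x = x := by
  simp [srcAt, Nat.leRec_self]

theorem tgtAt_self {k : ℕ} (h : k ≤ k) (x : X.cell k) : X.tgtAt h x = x := by
  simp [tgtAt, Nat.leRec_self]

theorem srcAt_succ {i k : ℕ} (h : i ≤ k) (h' : i ≤ k + 1) (x : X.cell (k + 1)) :
    X.srcAt h' x = X.srcAt h (X.src x) := by
  simp [srcAt, Nat.leRec_succ _ _ h]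

theorem tgtAt_succ {i k : ℕ} (h : i ≤ k) (h' : i ≤ k + 1) (x : X.cell (k + 1)) :
    X.tgtAt h' x = X.tgtAt h (X.tgt x) := by
  simp [tgtAt, Nat.leRec_succ _ _ h]

theorem srcAt_eq_of_parallel {i k : ℕ} (h : i < k) {x y : X.cell k} (hp : X.Parallel x y) :
    X.srcAt h.le x = X.srcAt h.le y := by
  obtain _ | k := k
  · omega
  · rw [X.srcAt_succ (Nat.lt_succ_iff.mp h), X.srcAt_succ (Nat.lt_succ_iff.mp h), hp.1]

theorem tgtAt_eq_of_parallel {i k : ℕ} (h : i < k) {x y : X.cell k} (hp : X.Parallel x y) :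
    X.tgtAt h.le x = X.tgtAt h.le y := by
  obtain _ | k := k
  · omega
  · rw [X.tgtAt_succ (Nat.lt_succ_iff.mp h), X.tgtAt_succ (Nat.lt_succ_iff.mp h), hp.2]

theorem parallel_src_tgt {k : ℕ} (x : X.cell (k + 1)) : X.Parallel (X.src x) (X.tgt x) := by
  obtain _ | k := k
  · trivial
  · exact ⟨X.src_src x, X.tgt_src x⟩

theorem Parallel.refl {k : ℕ} (x : X.cell k) : X.Parallel x x := by
  obtain _ | k := k
  · trivial
  · exact ⟨rfl, rfl⟩

theorem Parallel.trans {k : ℕ} {x y z : X.cell k} (h : X.Parallel x y) (h' : X.Parallel y z) :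
    X.Parallel x z := by
  obtain _ | k := k
  · trivial
  · exact ⟨h.1.trans h'.1, h.2.trans h'.2⟩

theorem cell_le {k : ℕ} (x : X.cell k) : (k : ℕ∞) ≤ n := by
  by_contra h
  exact (X.cell_isEmpty k (not_le.mp h)).false x

end GlobularSet

/-- An `n`-precategory.  `comp hi hm u v h` is the composite `u ∘ᵢ v` of a `k`-cell `u` and an
`l`-cell `v`, where `i = min k l - 1`; it is an `m`-cell for `m = max k l`.  The composability
proofs that occur in the axioms as extra hypotheses are consequences of the other hypotheses. -/
structure NPrecategory (n : ℕ∞) extends GlobularSet.{u} n where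
  ident : ∀ {k : ℕ}, ((k + 1 : ℕ) : ℕ∞) ≤ n → cell k → cell (k + 1)
  comp : ∀ {i k l m : ℕ} (hi : i + 1 = min k l) (_ : m = max k l) (u : cell k) (v : cell l),
    toGlobularSet.Composable hi u v → cell m
  src_ident : ∀ {k : ℕ} (hk : ((k + 1 : ℕ) : ℕ∞) ≤ n) (u : cell k), src (ident hk u) = u
  tgt_ident : ∀ {k : ℕ} (hk : ((k + 1 : ℕ) : ℕ∞) ≤ n) (u : cell k), tgt (ident hk u) = u
  src_comp_lt : ∀ {i k l m : ℕ} (hi : i + 1 = min k (l + 1)) (hm : m + 1 = max k (l + 1))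
    (hi' : i + 1 = min k l) (hm' : m = max k l) (u : cell k) (v : cell (l + 1))
    (h : toGlobularSet.Composable hi u v) (h' : toGlobularSet.Composable hi' u (src v)),
    k < l + 1 → src (comp hi hm u v h) = comp hi' hm' u (src v) h'
  tgt_comp_lt : ∀ {i k l m : ℕ} (hi : i + 1 = min k (l + 1)) (hm : m + 1 = max k (l + 1))
    (hi' : i + 1 = min k l) (hm' : m = max k l) (u : cell k) (v : cell (l + 1))
    (h : toGlobularSet.Composable hi u v) (h' : toGlobularSet.Composable hi' u (tgt v)),
    k < l + 1 → tgt (comp hi hm u v h) = comp hi' hm' u (tgt v) h'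
  src_comp_eq : ∀ {i k : ℕ} (hi : i + 1 = min (k + 1) (k + 1)) (hm : k + 1 = max (k + 1) (k + 1))
    (u v : cell (k + 1)) (h : toGlobularSet.Composable hi u v), src (comp hi hm u v h) = src u
  tgt_comp_eq : ∀ {i k : ℕ} (hi : i + 1 = min (k + 1) (k + 1)) (hm : k + 1 = max (k + 1) (k + 1))
    (u v : cell (k + 1)) (h : toGlobularSet.Composable hi u v), tgt (comp hi hm u v h) = tgt v
  src_comp_gt : ∀ {i k l m : ℕ} (hi : i + 1 = min (k + 1) l) (hm : m + 1 = max (k + 1) l)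
    (hi' : i + 1 = min k l) (hm' : m = max k l) (u : cell (k + 1)) (v : cell l)
    (h : toGlobularSet.Composable hi u v) (h' : toGlobularSet.Composable hi' (src u) v),
    l < k + 1 → src (comp hi hm u v h) = comp hi' hm' (src u) v h'
  tgt_comp_gt : ∀ {i k l m : ℕ} (hi : i + 1 = min (k + 1) l) (hm : m + 1 = max (k + 1) l)
    (hi' : i + 1 = min k l) (hm' : m = max k l) (u : cell (k + 1)) (v : cell l)
    (h : toGlobularSet.Composable hi u v) (h' : toGlobularSet.Composable hi' (tgt u) v),
    l < k + 1 → tgt (comp hi hm u v h) = comp hi' hm' (tgt u) v h'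
  ident_comp_le : ∀ {i k l : ℕ} (hk : ((k + 1 : ℕ) : ℕ∞) ≤ n) (hi : i + 1 = min (k + 1) l)
    (hm : l = max (k + 1) l) (u : cell k) (v : cell l)
    (h : toGlobularSet.Composable hi (ident hk u) v), comp hi hm (ident hk u) v h = v
  ident_comp_gt : ∀ {i k l m : ℕ} (hk : ((k + 1 : ℕ) : ℕ∞) ≤ n) (hmn : ((m + 1 : ℕ) : ℕ∞) ≤ n)
    (hi : i + 1 = min (k + 1) l) (hm : m + 1 = max (k + 1) l)
    (hi' : i + 1 = min k l) (hm' : m = max k l) (u : cell k) (v : cell l)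
    (h : toGlobularSet.Composable hi (ident hk u) v) (h' : toGlobularSet.Composable hi' u v),
    l < k + 1 → comp hi hm (ident hk u) v h = ident hmn (comp hi' hm' u v h')
  comp_ident_le : ∀ {i k l : ℕ} (hl : ((l + 1 : ℕ) : ℕ∞) ≤ n) (hi : i + 1 = min k (l + 1))
    (hm : k = max k (l + 1)) (u : cell k) (v : cell l)
    (h : toGlobularSet.Composable hi u (ident hl v)), comp hi hm u (ident hl v) h = u
  comp_ident_gt : ∀ {i k l m : ℕ} (hl : ((l + 1 : ℕ) : ℕ∞) ≤ n) (hmn : ((m + 1 : ℕ) : ℕ∞) ≤ n)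
    (hi : i + 1 = min k (l + 1)) (hm : m + 1 = max k (l + 1))
    (hi' : i + 1 = min k l) (hm' : m = max k l) (u : cell k) (v : cell l)
    (h : toGlobularSet.Composable hi u (ident hl v)) (h' : toGlobularSet.Composable hi' u v),
    k < l + 1 → comp hi hm u (ident hl v) h = ident hmn (comp hi' hm' u v h')
  /-- `(u ∘ᵢ v) ∘ᵢ w = u ∘ᵢ (v ∘ᵢ w)` whenever all these composites are defined. -/
  assoc : ∀ {i k l m p q r : ℕ} (hkl : i + 1 = min k l) (hlm : i + 1 = min l m)
    (hp : p = max k l) (hq : q = max l m) (hpm : i + 1 = min p m) (hkq : i + 1 = min k q)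
    (hr : r = max p m) (hr' : r = max k q) (u : cell k) (v : cell l) (w : cell m)
    (huv : toGlobularSet.Composable hkl u v) (hvw : toGlobularSet.Composable hlm v w)
    (h : toGlobularSet.Composable hpm (comp hkl hp u v huv) w)
    (h' : toGlobularSet.Composable hkq u (comp hlm hq v w hvw)),
    comp hpm hr (comp hkl hp u v huv) w h = comp hkq hr' u (comp hlm hq v w hvw) h'
  /-- `u ∘ᵢ (v ∘ⱼ v') = (u ∘ᵢ v) ∘ⱼ (u ∘ᵢ v')` for `i < j`. -/
  comp_distrib : ∀ {i j k l l' m p p' q : ℕ} (hj : j + 1 = min l l') (hm : m = max l l')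
    (hi : i + 1 = min k m) (hq : q = max k m) (hi₁ : i + 1 = min k l) (hp : p = max k l)
    (hi₂ : i + 1 = min k l') (hp' : p' = max k l') (hj' : j + 1 = min p p') (hq' : q = max p p')
    (u : cell k) (v : cell l) (v' : cell l')
    (hvv' : toGlobularSet.Composable hj v v')
    (h : toGlobularSet.Composable hi u (comp hj hm v v' hvv'))
    (huv : toGlobularSet.Composable hi₁ u v) (huv' : toGlobularSet.Composable hi₂ u v')
    (h' : toGlobularSet.Composable hj' (comp hi₁ hp u v huv) (comp hi₂ hp' u v' huv')),
    i < j → comp hi hq u (comp hj hm v v' hvv') h =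
      comp hj' hq' (comp hi₁ hp u v huv) (comp hi₂ hp' u v' huv') h'
  /-- `(u ∘ⱼ u') ∘ᵢ v = (u ∘ᵢ v) ∘ⱼ (u' ∘ᵢ v)` for `i < j`. -/
  distrib_comp : ∀ {i j k l l' m p p' q : ℕ} (hj : j + 1 = min l l') (hm : m = max l l')
    (hi : i + 1 = min m k) (hq : q = max m k) (hi₁ : i + 1 = min l k) (hp : p = max l k)
    (hi₂ : i + 1 = min l' k) (hp' : p' = max l' k) (hj' : j + 1 = min p p') (hq' : q = max p p')
    (u : cell l) (u' : cell l') (v : cell k)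
    (huu' : toGlobularSet.Composable hj u u')
    (h : toGlobularSet.Composable hi (comp hj hm u u' huu') v)
    (huv : toGlobularSet.Composable hi₁ u v) (hu'v : toGlobularSet.Composable hi₂ u' v)
    (h' : toGlobularSet.Composable hj' (comp hi₁ hp u v huv) (comp hi₂ hp' u' v hu'v)),
    i < j → comp hi hq (comp hj hm u u' huu') v h =
      comp hj' hq' (comp hi₁ hp u v huv) (comp hi₂ hp' u' v hu'v) h'

/-- A prefunctor `C → D`.  For `C` and `D` of the same dimension `n` this is an `n`-prefunctor; if
the dimension `n` of `C` is smaller than the dimension `m` of `D`, it is an `n`-prefunctor from `C`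
to the `n`-truncation of `D`. -/
structure NPrefunctor {n m : ℕ∞} (C : NPrecategory.{u} n) (D : NPrecategory.{u} m) where
  le : n ≤ m
  map : ∀ {k : ℕ}, C.cell k → D.cell k
  map_src : ∀ {k : ℕ} (x : C.cell (k + 1)), map (C.src x) = D.src (map x)
  map_tgt : ∀ {k : ℕ} (x : C.cell (k + 1)), map (C.tgt x) = D.tgt (map x)
  map_ident : ∀ {k : ℕ} (hk : ((k + 1 : ℕ) : ℕ∞) ≤ n) (x : C.cell k),
    map (C.ident hk x) = D.ident (hk.trans le) (map x)
  map_comp : ∀ {i k l p : ℕ} (hi : i + 1 = min k l) (hp : p = max k l) (x : C.cell k)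
    (y : C.cell l) (h : C.Composable hi x y) (h' : D.Composable hi (map x) (map y)),
    map (C.comp hi hp x y h) = D.comp hi hp (map x) (map y) h'

/-- A prefunctor is Conduché if every decomposition `F u = v₁ ∘ᵢ v₂` lifts uniquely to a
decomposition `u = u₁ ∘ᵢ u₂`. -/
def NPrefunctor.IsConduche {n : ℕ∞} {C D : NPrecategory.{u} n} (F : NPrefunctor C D) : Prop :=
  ∀ {i k₁ k₂ k : ℕ} (hi : i + 1 = min k₁ k₂) (hk : k = max k₁ k₂) (u : C.cell k)
    (v₁ : D.cell k₁) (v₂ : D.cell k₂) (hv : D.Composable hi v₁ v₂),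
    F.map u = D.comp hi hk v₁ v₂ hv →
      ∃! p : C.cell k₁ × C.cell k₂, ∃ hu : C.Composable hi p.1 p.2,
        F.map p.1 = v₁ ∧ F.map p.2 = v₂ ∧ C.comp hi hk p.1 p.2 hu = u

namespace NPrecategory

variable {n : ℕ∞} (C : NPrecategory.{u} n)

/-- `w` is the composite of `u` and `v`, which are in particular composable. -/
def IsComp {k l m : ℕ} (u : C.cell k) (v : C.cell l) (w : C.cell m) : Prop :=
  ∃ (i : ℕ) (hi : i + 1 = min k l) (hm : m = max k l) (h : C.Composable hi u v),
    C.comp hi hm u v h = w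

variable {C}

theorem isComp_comp {i k l m : ℕ} (hi : i + 1 = min k l) (hm : m = max k l) (u : C.cell k)
    (v : C.cell l) (h : C.Composable hi u v) : C.IsComp u v (C.comp hi hm u v h) :=
  ⟨i, hi, hm, h, rfl⟩

theorem IsComp.unique {k l m : ℕ} {u : C.cell k} {v : C.cell l} {w w' : C.cell m}
    (h : C.IsComp u v w) (h' : C.IsComp u v w') : w = w' := by
  obtain ⟨i, hi, hm, h, rfl⟩ := h
  obtain ⟨j, hj, hm', h', rfl⟩ := h'
  obtain rfl : i = j := by omega
  rfl

theorem IsComp.eq {i k l m : ℕ} {u : C.cell k} {v : C.cell l} {w : C.cell m}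
    (h : C.IsComp u v w) (hi : i + 1 = min k l) (hm : m = max k l) :
    ∃ h : C.Composable hi u v, C.comp hi hm u v h = w := by
  obtain ⟨j, hj, hm', h', rfl⟩ := h
  obtain rfl : i = j := by omega
  exact ⟨h', rfl⟩

theorem IsComp.dim {k l m : ℕ} {u : C.cell k} {v : C.cell l} {w : C.cell m}
    (h : C.IsComp u v w) : 0 < k ∧ 0 < l ∧ m = max k l := by
  obtain ⟨j, hj, hm', h', rfl⟩ := h
  omega

/-- Boundary of a whiskering: if `u` has dimension at most `l`, the cells `u ∘ x` and `u ∘ y` are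
parallel when `x` and `y` are. -/
theorem parallel_of_isComp_left {k l : ℕ} {u : C.cell k} {x y x' y' : C.cell l}
    (hp : C.Parallel x y) (hx : C.IsComp u x x') (hy : C.IsComp u y y') : C.Parallel x' y' := by
  obtain _ | l := l
  · trivial
  obtain ⟨i, hi, hm, h, rfl⟩ := hx
  obtain ⟨h', rfl⟩ := hy.eq hi hm
  obtain hk | rfl : k < l + 1 ∨ k = l + 1 := by omega
  · have hi' : i + 1 = min k l := by omega
    have hm' : l = max k l := by omega
    have e1 : ∀ z : C.cell (l + 1), C.Composable hi u z → C.Composable hi' u (C.src z) := by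
      intro z hz
      rw [GlobularSet.Composable, ← C.srcAt_succ]
      exact hz
    have e2 : ∀ z : C.cell (l + 1), C.Composable hi u z → C.Composable hi' u (C.tgt z) := by
      intro z hz
      rw [GlobularSet.Composable, ← C.srcAt_eq_of_parallel (by omega) (C.parallel_src_tgt z)]
      exact e1 z hz
    constructor
    · rw [C.src_comp_lt hi hm hi' hm' u x h (e1 _ h) hk,
        C.src_comp_lt hi hm hi' hm' u y h' (e1 _ h') hk]
      congr 1
      exact hp.1
    · rw [C.tgt_comp_lt hi hm hi' hm' u x h (e2 _ h) hk,
        C.tgt_comp_lt hi hm hi' hm' u y h' (e2 _ h') hk]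
      congr 1
      exact hp.2
  · constructor
    · rw [C.src_comp_eq hi hm, C.src_comp_eq hi hm]
    · rw [C.tgt_comp_eq hi hm, C.tgt_comp_eq hi hm]
      exact hp.2

theorem parallel_of_isComp_right {k l : ℕ} {u : C.cell k} {x y x' y' : C.cell l}
    (hp : C.Parallel x y) (hx : C.IsComp x u x') (hy : C.IsComp y u y') : C.Parallel x' y' := by
  obtain _ | l := l
  · trivial
  obtain ⟨i, hi, hm, h, rfl⟩ := hx
  obtain ⟨h', rfl⟩ := hy.eq hi hm
  obtain hk | rfl : k < l + 1 ∨ k = l + 1 := by omega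
  · have hi' : i + 1 = min l k := by omega
    have hm' : l = max l k := by omega
    have e2 : ∀ z : C.cell (l + 1), C.Composable hi z u → C.Composable hi' (C.tgt z) u := by
      intro z hz
      rw [GlobularSet.Composable, ← C.tgtAt_succ]
      exact hz
    have e1 : ∀ z : C.cell (l + 1), C.Composable hi z u → C.Composable hi' (C.src z) u := by
      intro z hz
      rw [GlobularSet.Composable, C.tgtAt_eq_of_parallel (by omega) (C.parallel_src_tgt z)]
      exact e2 z hz
    constructor
    · rw [C.src_comp_gt hi hm hi' hm' x u h (e1 _ h) hk,
        C.src_comp_gt hi hm hi' hm' y u h' (e1 _ h') hk]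
      congr 1
      exact hp.1
    · rw [C.tgt_comp_gt hi hm hi' hm' x u h (e2 _ h) hk,
        C.tgt_comp_gt hi hm hi' hm' y u h' (e2 _ h') hk]
      congr 1
      exact hp.2
  · constructor
    · rw [C.src_comp_eq hi hm, C.src_comp_eq hi hm]
      exact hp.1
    · rw [C.tgt_comp_eq hi hm, C.tgt_comp_eq hi hm]

theorem assoc_eq {k l m p q r : ℕ} {a : C.cell k} {b : C.cell l} {c : C.cell m}
    {ab : C.cell p} {bc : C.cell q} {d d' : C.cell r} (h₁ : C.IsComp a b ab)
    (h₂ : C.IsComp b c bc) (h₃ : C.IsComp ab c d) (h₄ : C.IsComp a bc d')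
    (e₁ : min k l = min l m) (e₂ : min k l = min p m) (e₃ : min k l = min k q) : d = d' := by
  obtain ⟨i, hi, hm, h, rfl⟩ := h₁
  have d₂ := h₂.dim
  obtain ⟨h', rfl⟩ := h₂.eq (i := i) (by omega) d₂.2.2
  have d₃ := h₃.dim
  obtain ⟨h'', rfl⟩ := h₃.eq (i := i) (by omega) d₃.2.2
  have d₄ := h₄.dim
  obtain ⟨h''', rfl⟩ := h₄.eq (i := i) (by omega) d₄.2.2
  apply C.assoc

theorem comp_distrib_eq {k l l' m p p' r : ℕ} {a : C.cell k} {b : C.cell l} {c : C.cell l'}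
    {bc : C.cell m} {ab : C.cell p} {ac : C.cell p'} {d d' : C.cell r} (h₁ : C.IsComp b c bc)
    (h₂ : C.IsComp a bc d) (h₃ : C.IsComp a b ab) (h₄ : C.IsComp a c ac)
    (h₅ : C.IsComp ab ac d') (hk : k < l) (hk' : k < l') : d = d' := by
  obtain ⟨j, hj, hm, h, rfl⟩ := h₁
  obtain ⟨i, hi, hm', h', rfl⟩ := h₂
  have d₃ := h₃.dim
  obtain ⟨h'', rfl⟩ := h₃.eq (i := i) (by omega) d₃.2.2
  have d₄ := h₄.dim
  obtain ⟨h''', rfl⟩ := h₄.eq (i := i) (by omega) d₄.2.2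
  have d₅ := h₅.dim
  obtain ⟨h'''', rfl⟩ := h₅.eq (i := j) (by omega) d₅.2.2
  apply C.comp_distrib
  omega

theorem distrib_comp_eq {k l l' m p p' r : ℕ} {a : C.cell k} {b : C.cell l} {c : C.cell l'}
    {bc : C.cell m} {ba : C.cell p} {ca : C.cell p'} {d d' : C.cell r} (h₁ : C.IsComp b c bc)
    (h₂ : C.IsComp bc a d) (h₃ : C.IsComp b a ba) (h₄ : C.IsComp c a ca)
    (h₅ : C.IsComp ba ca d') (hk : k < l) (hk' : k < l') : d = d' := by
  obtain ⟨j, hj, hm, h, rfl⟩ := h₁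
  obtain ⟨i, hi, hm', h', rfl⟩ := h₂
  have d₃ := h₃.dim
  obtain ⟨h'', rfl⟩ := h₃.eq (i := i) (by omega) d₃.2.2
  have d₄ := h₄.dim
  obtain ⟨h''', rfl⟩ := h₄.eq (i := i) (by omega) d₄.2.2
  have d₅ := h₅.dim
  obtain ⟨h'''', rfl⟩ := h₅.eq (i := j) (by omega) d₅.2.2
  apply C.distrib_comp
  omega

end NPrecategory

/-- A set of `(n+1)`-generators attached to an `n`-precategory. -/
structure CellExtension {n : ℕ} (C : NPrecategory.{u} n) where
  gen : Type u
  src : gen → C.cell n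
  tgt : gen → C.cell n
  parallel : ∀ g, C.Parallel (src g) (tgt g)

namespace CellExtension

variable {n : ℕ} {C : NPrecategory.{u} n} (G : CellExtension C)

/-- Formal expressions for the `(n+1)`-cells `x ⟶ y` freely generated by `G` over `C`: generators,
identities, `n`-composites, and composites with a `k`-cell of `C` (`0 < k ≤ n`) on the left or on
the right. -/
inductive Tm : C.cell n → C.cell n → Type u
  | gen (g : G.gen) : Tm (G.src g) (G.tgt g)
  | ident (x : C.cell n) : Tm x x
  | comp {x y z : C.cell n} (t : Tm x y) (t' : Tm y z) : Tm x z
  | left {k : ℕ} (a : C.cell k) {x y x' y' : C.cell n} (t : Tm x y)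
      (hx : C.IsComp a x x') (hy : C.IsComp a y y') : Tm x' y'
  | right {k : ℕ} (a : C.cell k) {x y x' y' : C.cell n} (t : Tm x y)
      (hx : C.IsComp x a x') (hy : C.IsComp y a y') : Tm x' y'

variable {G}

/-- The congruence generated by the instances of the axioms of precategories that involve
expressions of dimension `n+1`. -/
inductive Rel : ∀ {x y : C.cell n}, Tm G x y → Tm G x y → Prop
  | comp_congr_left {x y z : C.cell n} {t₁ t₂ : Tm G x y} (t' : Tm G y z) :
      Rel t₁ t₂ → Rel (.comp t₁ t') (.comp t₂ t')
  | comp_congr_right {x y z : C.cell n} (t : Tm G x y) {t₁ t₂ : Tm G y z} :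
      Rel t₁ t₂ → Rel (.comp t t₁) (.comp t t₂)
  | left_congr {k : ℕ} (a : C.cell k) {x y x' y' : C.cell n} {t₁ t₂ : Tm G x y}
      (hx : C.IsComp a x x') (hy : C.IsComp a y y') :
      Rel t₁ t₂ → Rel (.left a t₁ hx hy) (.left a t₂ hx hy)
  | right_congr {k : ℕ} (a : C.cell k) {x y x' y' : C.cell n} {t₁ t₂ : Tm G x y}
      (hx : C.IsComp x a x') (hy : C.IsComp y a y') :
      Rel t₁ t₂ → Rel (.right a t₁ hx hy) (.right a t₂ hx hy)
  -- units
  | ident_comp {x y : C.cell n} (t : Tm G x y) : Rel (.comp (.ident x) t) t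
  | comp_ident {x y : C.cell n} (t : Tm G x y) : Rel (.comp t (.ident y)) t
  | left_ident {k : ℕ} (a : C.cell k) {x x' : C.cell n} (hx hy : C.IsComp a x x') :
      Rel (.left a (.ident x) hx hy) (.ident x')
  | right_ident {k : ℕ} (a : C.cell k) {x x' : C.cell n} (hx hy : C.IsComp x a x') :
      Rel (.right a (.ident x) hx hy) (.ident x')
  | ident_left {k : ℕ} (hk : ((k + 1 : ℕ) : ℕ∞) ≤ n) (a : C.cell k) {x y : C.cell n}
      (t : Tm G x y) (hx : C.IsComp (C.ident hk a) x x) (hy : C.IsComp (C.ident hk a) y y) :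
      Rel (.left (C.ident hk a) t hx hy) t
  | ident_right {k : ℕ} (hk : ((k + 1 : ℕ) : ℕ∞) ≤ n) (a : C.cell k) {x y : C.cell n}
      (t : Tm G x y) (hx : C.IsComp x (C.ident hk a) x) (hy : C.IsComp y (C.ident hk a) y) :
      Rel (.right (C.ident hk a) t hx hy) t
  -- associativity: `(t ∘ₙ t') ∘ₙ t''`, `(a ∘ b) ∘ t`, `t ∘ (a ∘ b)` and `a ∘ (t ∘ b)`, where
  -- `a` and `b` have the same dimension
  | assoc {x y z w : C.cell n} (t : Tm G x y) (t' : Tm G y z) (t'' : Tm G z w) :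
      Rel (.comp (.comp t t') t'') (.comp t (.comp t' t''))
  | left_left {k : ℕ} {a b ab : C.cell k} (hab : C.IsComp a b ab)
      {x y x₁ y₁ x₂ y₂ : C.cell n} (t : Tm G x y)
      (hx₁ : C.IsComp b x x₁) (hy₁ : C.IsComp b y y₁)
      (hx₂ : C.IsComp a x₁ x₂) (hy₂ : C.IsComp a y₁ y₂)
      (hx : C.IsComp ab x x₂) (hy : C.IsComp ab y y₂) :
      Rel (.left ab t hx hy) (.left a (.left b t hx₁ hy₁) hx₂ hy₂)
  | right_right {k : ℕ} {a b ab : C.cell k} (hab : C.IsComp a b ab)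
      {x y x₁ y₁ x₂ y₂ : C.cell n} (t : Tm G x y)
      (hx₁ : C.IsComp x a x₁) (hy₁ : C.IsComp y a y₁)
      (hx₂ : C.IsComp x₁ b x₂) (hy₂ : C.IsComp y₁ b y₂)
      (hx : C.IsComp x ab x₂) (hy : C.IsComp y ab y₂) :
      Rel (.right b (.right a t hx₁ hy₁) hx₂ hy₂) (.right ab t hx hy)
  | left_right {k : ℕ} {a b : C.cell k}
      {x y x₁ y₁ x₂ y₂ x₃ y₃ : C.cell n} (t : Tm G x y)
      (hx₁ : C.IsComp a x x₁) (hy₁ : C.IsComp a y y₁)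
      (hx₂ : C.IsComp x₁ b x₃) (hy₂ : C.IsComp y₁ b y₃)
      (hx₁' : C.IsComp x b x₂) (hy₁' : C.IsComp y b y₂)
      (hx₂' : C.IsComp a x₂ x₃) (hy₂' : C.IsComp a y₂ y₃) :
      Rel (.right b (.left a t hx₁ hy₁) hx₂ hy₂) (.left a (.right b t hx₁' hy₁') hx₂' hy₂')
  -- distributivity over `n`-composition
  | left_comp {k : ℕ} (a : C.cell k) {x y z x' y' z' : C.cell n} (t : Tm G x y) (t' : Tm G y z)
      (hx : C.IsComp a x x') (hy : C.IsComp a y y') (hz : C.IsComp a z z') :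
      Rel (.left a (.comp t t') hx hz) (.comp (.left a t hx hy) (.left a t' hy hz))
  | right_comp {k : ℕ} (a : C.cell k) {x y z x' y' z' : C.cell n} (t : Tm G x y) (t' : Tm G y z)
      (hx : C.IsComp x a x') (hy : C.IsComp y a y') (hz : C.IsComp z a z') :
      Rel (.right a (.comp t t') hx hz) (.comp (.right a t hx hy) (.right a t' hy hz))
  -- distributivity over composition with a cell of `C`, where `a` has smaller dimension than `b`:
  -- `a ∘ (b ∘ t)`, `a ∘ (t ∘ b)`, `(b ∘ t) ∘ a` and `(t ∘ b) ∘ a`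
  | left_distrib_left {k l : ℕ} (hkl : k < l) {a : C.cell k} {b ab : C.cell l}
      (hab : C.IsComp a b ab) {x y x₁ y₁ x₂ y₂ x₃ y₃ : C.cell n} (t : Tm G x y)
      (hx₁ : C.IsComp b x x₁) (hy₁ : C.IsComp b y y₁)
      (hx₂ : C.IsComp a x₁ x₃) (hy₂ : C.IsComp a y₁ y₃)
      (hx₁' : C.IsComp a x x₂) (hy₁' : C.IsComp a y y₂)
      (hx₂' : C.IsComp ab x₂ x₃) (hy₂' : C.IsComp ab y₂ y₃) :
      Rel (.left a (.left b t hx₁ hy₁) hx₂ hy₂) (.left ab (.left a t hx₁' hy₁') hx₂' hy₂')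
  | left_distrib_right {k l : ℕ} (hkl : k < l) {a : C.cell k} {b ab : C.cell l}
      (hab : C.IsComp a b ab) {x y x₁ y₁ x₂ y₂ x₃ y₃ : C.cell n} (t : Tm G x y)
      (hx₁ : C.IsComp x b x₁) (hy₁ : C.IsComp y b y₁)
      (hx₂ : C.IsComp a x₁ x₃) (hy₂ : C.IsComp a y₁ y₃)
      (hx₁' : C.IsComp a x x₂) (hy₁' : C.IsComp a y y₂)
      (hx₂' : C.IsComp x₂ ab x₃) (hy₂' : C.IsComp y₂ ab y₃) :
      Rel (.left a (.right b t hx₁ hy₁) hx₂ hy₂) (.right ab (.left a t hx₁' hy₁') hx₂' hy₂')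
  | right_distrib_left {k l : ℕ} (hkl : k < l) {a : C.cell k} {b ba : C.cell l}
      (hba : C.IsComp b a ba) {x y x₁ y₁ x₂ y₂ x₃ y₃ : C.cell n} (t : Tm G x y)
      (hx₁ : C.IsComp b x x₁) (hy₁ : C.IsComp b y y₁)
      (hx₂ : C.IsComp x₁ a x₃) (hy₂ : C.IsComp y₁ a y₃)
      (hx₁' : C.IsComp x a x₂) (hy₁' : C.IsComp y a y₂)
      (hx₂' : C.IsComp ba x₂ x₃) (hy₂' : C.IsComp ba y₂ y₃) :
      Rel (.right a (.left b t hx₁ hy₁) hx₂ hy₂) (.left ba (.right a t hx₁' hy₁') hx₂' hy₂')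
  | right_distrib_right {k l : ℕ} (hkl : k < l) {a : C.cell k} {b ba : C.cell l}
      (hba : C.IsComp b a ba) {x y x₁ y₁ x₂ y₂ x₃ y₃ : C.cell n} (t : Tm G x y)
      (hx₁ : C.IsComp x b x₁) (hy₁ : C.IsComp y b y₁)
      (hx₂ : C.IsComp x₁ a x₃) (hy₂ : C.IsComp y₁ a y₃)
      (hx₁' : C.IsComp x a x₂) (hy₁' : C.IsComp y a y₂)
      (hx₂' : C.IsComp x₂ ba x₃) (hy₂' : C.IsComp y₂ ba y₃) :
      Rel (.right a (.right b t hx₁ hy₁) hx₂ hy₂) (.right ba (.right a t hx₁' hy₁') hx₂' hy₂')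

theorem Tm.parallel {x y : C.cell n} (t : Tm G x y) : C.Parallel x y := by
  induction t with
  | gen g => exact G.parallel g
  | ident x => exact .refl _ x
  | comp t t' h h' => exact h.trans _ h'
  | left a t hx hy h => exact NPrecategory.parallel_of_isComp_left h hx hy
  | right a t hx hy h => exact NPrecategory.parallel_of_isComp_right h hx hy

variable (G)

/-- The `(n+1)`-cells `x ⟶ y` freely generated by `G`. -/
def FreeHom (x y : C.cell n) : Type u := Quot (@Rel n C G x y)

variable {G}

namespace FreeHom

variable {x y z x' y' : C.cell n}

def ident (x : C.cell n) : FreeHom G x x := Quot.mk _ (.ident x)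

def comp : FreeHom G x y → FreeHom G y z → FreeHom G x z :=
  Quot.map₂ Tm.comp (fun t _ _ h => .comp_congr_right t h) (fun _ _ t h => .comp_congr_left t h)

def left {k : ℕ} (a : C.cell k) (hx : C.IsComp a x x') (hy : C.IsComp a y y') :
    FreeHom G x y → FreeHom G x' y' :=
  Quot.map (fun t => .left a t hx hy) (fun _ _ h => .left_congr a hx hy h)

def right {k : ℕ} (a : C.cell k) (hx : C.IsComp x a x') (hy : C.IsComp y a y') :
    FreeHom G x y → FreeHom G x' y' :=
  Quot.map (fun t => .right a t hx hy) (fun _ _ h => .right_congr a hx hy h)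

theorem parallel (q : FreeHom G x y) : C.Parallel x y := by
  obtain ⟨t⟩ := q
  exact t.parallel

end FreeHom

variable (G)

/-- The cells of the free extension of `C` by `G`: those of `C`, and the freely generated
`(n+1)`-cells. -/
inductive FreeCell : ℕ → Type u
  | low {k : ℕ} (c : C.cell k) : FreeCell k
  | top {x y : C.cell n} (q : FreeHom G x y) : FreeCell (n + 1)

namespace FreeCell

variable {G}

def src : ∀ {k : ℕ}, FreeCell G (k + 1) → FreeCell G k
  | _, low c => low (C.src c)
  | _, @top _ _ _ x _ _ => low x

def tgt : ∀ {k : ℕ}, FreeCell G (k + 1) → FreeCell G k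
  | _, low c => low (C.tgt c)
  | _, @top _ _ _ _ y _ => low y

end FreeCell

/-- The underlying globular set of the free extension. -/
@[reducible] def freeGlob : GlobularSet.{u} ((n + 1 : ℕ) : ℕ∞) where
  cell := FreeCell G
  cell_isEmpty k hk := by
    refine ⟨fun c => ?_⟩
    cases c with
    | low c =>
      have := C.cell_le c
      norm_cast at this hk
      omega
    | top q => exact lt_irrefl _ hk
  src := FreeCell.src
  tgt := FreeCell.tgt
  src_src x := by
    cases x with
    | low c => exact congrArg FreeCell.low (C.src_src c)
    | top q => exact congrArg FreeCell.low q.parallel.1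
  tgt_src x := by
    cases x with
    | low c => exact congrArg FreeCell.low (C.tgt_src c)
    | top q => exact congrArg FreeCell.low q.parallel.2

variable {G}

theorem srcAt_low {i k : ℕ} (h : i ≤ k) (c : C.cell k) :
    G.freeGlob.srcAt h (FreeCell.low c) = FreeCell.low (C.srcAt h c) := by
  induction k, h using Nat.le_induction with
  | base => rw [GlobularSet.srcAt_self, GlobularSet.srcAt_self]
  | succ k h ih => rw [GlobularSet.srcAt_succ _ h, GlobularSet.srcAt_succ _ h]; exact ih _

theorem tgtAt_low {i k : ℕ} (h : i ≤ k) (c : C.cell k) :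
    G.freeGlob.tgtAt h (FreeCell.low c) = FreeCell.low (C.tgtAt h c) := by
  induction k, h using Nat.le_induction with
  | base => rw [GlobularSet.tgtAt_self, GlobularSet.tgtAt_self]
  | succ k h ih => rw [GlobularSet.tgtAt_succ _ h, GlobularSet.tgtAt_succ _ h]; exact ih _

theorem srcAt_top {i : ℕ} (h : i ≤ n) (h' : i ≤ n + 1) {x y : C.cell n} (q : FreeHom G x y) :
    G.freeGlob.srcAt h' (FreeCell.top q) = FreeCell.low (C.srcAt h x) := by
  rw [GlobularSet.srcAt_succ _ h]
  exact srcAt_low h x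

theorem tgtAt_top {i : ℕ} (h : i ≤ n) (h' : i ≤ n + 1) {x y : C.cell n} (q : FreeHom G x y) :
    G.freeGlob.tgtAt h' (FreeCell.top q) = FreeCell.low (C.tgtAt h y) := by
  rw [GlobularSet.tgtAt_succ _ h]
  exact tgtAt_low h y

theorem low_inj {k : ℕ} {c c' : C.cell k} :
    (FreeCell.low c : FreeCell G k) = FreeCell.low c' ↔ c = c' :=
  ⟨fun h => by cases h; rfl, fun h => by rw [h]⟩

theorem dim_le {k : ℕ} (c : C.cell k) : k ≤ n := by exact_mod_cast C.cell_le c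

theorem composable_low_low {i k l : ℕ} (hi : i + 1 = min k l) {a : C.cell k} {b : C.cell l} :
    G.freeGlob.Composable hi (FreeCell.low a) (FreeCell.low b) ↔ C.Composable hi a b := by
  rw [GlobularSet.Composable, tgtAt_low, srcAt_low, low_inj, GlobularSet.Composable]

theorem composable_low_top {i k : ℕ} (hi : i + 1 = min k (n + 1)) (hi' : i + 1 = min k n)
    {a : C.cell k} {x y : C.cell n} {q : FreeHom G x y} :
    G.freeGlob.Composable hi (FreeCell.low a) (FreeCell.top q) ↔ C.Composable hi' a x := by
  rw [GlobularSet.Composable, tgtAt_low, srcAt_top (by omega), low_inj, GlobularSet.Composable]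

theorem composable_top_low {i k : ℕ} (hi : i + 1 = min (n + 1) k) (hi' : i + 1 = min n k)
    {a : C.cell k} {x y : C.cell n} {q : FreeHom G x y} :
    G.freeGlob.Composable hi (FreeCell.top q) (FreeCell.low a) ↔ C.Composable hi' y a := by
  rw [GlobularSet.Composable, srcAt_low, tgtAt_top (by omega), low_inj, GlobularSet.Composable]

theorem composable_top_top {i : ℕ} (hi : i + 1 = min (n + 1) (n + 1))
    {x y z w : C.cell n} {q : FreeHom G x y} {q' : FreeHom G z w} :
    G.freeGlob.Composable hi (FreeCell.top q) (FreeCell.top q') ↔ y = z := by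
  obtain rfl : i = n := by omega
  rw [GlobularSet.Composable, srcAt_top le_rfl, tgtAt_top le_rfl, low_inj,
    GlobularSet.srcAt_self, GlobularSet.tgtAt_self]

theorem composable_left {i k : ℕ} (hi : i + 1 = min k n) (hk : k ≤ n) {a : C.cell k}
    {x y : C.cell n} (q : FreeHom G x y) (h : C.Composable hi a x) : C.Composable hi a y := by
  rw [GlobularSet.Composable, ← C.srcAt_eq_of_parallel (by omega) q.parallel]
  exact h

theorem composable_right {i k : ℕ} (hi : i + 1 = min n k) (hk : k ≤ n) {a : C.cell k}
    {x y : C.cell n} (q : FreeHom G x y) (h : C.Composable hi y a) : C.Composable hi x a := by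
  rw [GlobularSet.Composable, C.tgtAt_eq_of_parallel (by omega) q.parallel]
  exact h

namespace FreeCell

/-- Composite `a ∘ q` of a cell of `C` and a freely generated cell. -/
def leftTop {i k : ℕ} (hi : i + 1 = min k n) (hk : k ≤ n) (a : C.cell k) {x y : C.cell n}
    (q : FreeHom G x y) (h : C.Composable hi a x) : FreeCell G (n + 1) :=
  top (q.left a (NPrecategory.isComp_comp hi (max_eq_right hk).symm a x h)
    (NPrecategory.isComp_comp hi (max_eq_right hk).symm a y (composable_left hi hk q h)))

/-- Composite `q ∘ a` of a freely generated cell and a cell of `C`. -/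
def rightTop {i k : ℕ} (hi : i + 1 = min n k) (hk : k ≤ n) (a : C.cell k) {x y : C.cell n}
    (q : FreeHom G x y) (h : C.Composable hi y a) : FreeCell G (n + 1) :=
  top (q.right a
    (NPrecategory.isComp_comp hi (max_eq_left hk).symm x a (composable_right hi hk q h))
    (NPrecategory.isComp_comp hi (max_eq_left hk).symm y a h))

def comp : ∀ {i k l m : ℕ} (hi : i + 1 = min k l) (_ : m = max k l) (u : FreeCell G k)
    (v : FreeCell G l), G.freeGlob.Composable hi u v → FreeCell G m
  | _, _, _, _, hi, hm, low a, low b, h => low (C.comp hi hm a b ((composable_low_low hi).1 h))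
  | i, k, _, m, hi, hm, low a, top q, h =>
    have hk : k ≤ n := dim_le a
    have hi' : i + 1 = min k n := by omega
    (show n + 1 = m by omega) ▸ leftTop hi' hk a q ((composable_low_top hi hi').1 h)
  | i, _, l, m, hi, hm, top q, low b, h =>
    have hl : l ≤ n := dim_le b
    have hi' : i + 1 = min n l := by omega
    (show n + 1 = m by omega) ▸ rightTop hi' hl b q ((composable_top_low hi hi').1 h)
  | _, _, _, m, hi, hm, top q, @top _ _ _ _ w q', h =>
    have hyz := (composable_top_top hi).1 h
    (show n + 1 = m by omega) ▸ top (q.comp (hyz ▸ q' : FreeHom G _ w))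

end FreeCell

theorem comp_low_top {i k : ℕ} (hi : i + 1 = min k (n + 1)) (hm : n + 1 = max k (n + 1))
    (a : C.cell k) {x y x' y' : C.cell n} (q : FreeHom G x y)
    (h : G.freeGlob.Composable hi (FreeCell.low a) (FreeCell.top q))
    (hx : C.IsComp a x x') (hy : C.IsComp a y y') :
    FreeCell.comp hi hm (FreeCell.low a) (FreeCell.top q) h = FreeCell.top (q.left a hx hy) := by
  have hk : k ≤ n := dim_le a
  obtain ⟨_, rfl⟩ := hx.eq (i := i) (by omega) (by omega)
  obtain ⟨_, rfl⟩ := hy.eq (i := i) (by omega) (by omega)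
  rfl

theorem comp_top_low {i k : ℕ} (hi : i + 1 = min (n + 1) k) (hm : n + 1 = max (n + 1) k)
    (a : C.cell k) {x y x' y' : C.cell n} (q : FreeHom G x y)
    (h : G.freeGlob.Composable hi (FreeCell.top q) (FreeCell.low a))
    (hx : C.IsComp x a x') (hy : C.IsComp y a y') :
    FreeCell.comp hi hm (FreeCell.top q) (FreeCell.low a) h = FreeCell.top (q.right a hx hy) := by
  have hk : k ≤ n := dim_le a
  obtain ⟨_, rfl⟩ := hx.eq (i := i) (by omega) (by omega)
  obtain ⟨_, rfl⟩ := hy.eq (i := i) (by omega) (by omega)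
  rfl

theorem comp_top_top {i : ℕ} (hi : i + 1 = min (n + 1) (n + 1))
    (hm : n + 1 = max (n + 1) (n + 1))
    {x y z : C.cell n} (q : FreeHom G x y) (q' : FreeHom G y z)
    (h : G.freeGlob.Composable hi (FreeCell.top q) (FreeCell.top q')) :
    FreeCell.comp hi hm (FreeCell.top q) (FreeCell.top q') h = FreeCell.top (q.comp q') := rfl

theorem comp_low_low {i k l m : ℕ} (hi : i + 1 = min k l) (hm : m = max k l)
    (a : C.cell k) (b : C.cell l)
    (h : G.freeGlob.Composable hi (FreeCell.low a) (FreeCell.low b)) :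
    FreeCell.comp hi hm (FreeCell.low a) (FreeCell.low b) h =
      FreeCell.low (C.comp hi hm a b ((composable_low_low hi).1 h)) := rfl

theorem exists_left {i k : ℕ} (hi : i + 1 = min k (n + 1)) {a : C.cell k} {x y : C.cell n}
    {q : FreeHom G x y} (h : G.freeGlob.Composable hi (FreeCell.low a) (FreeCell.top q)) :
    ∃ x' y' : C.cell n, C.IsComp a x x' ∧ C.IsComp a y y' :=
  have hk : k ≤ n := dim_le a
  have hi' : i + 1 = min k n := by omega
  have h' := (composable_low_top hi hi').1 h
  ⟨_, _, NPrecategory.isComp_comp hi' (max_eq_right hk).symm a x h',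
    NPrecategory.isComp_comp hi' (max_eq_right hk).symm a y (composable_left hi' hk q h')⟩

theorem exists_right {i k : ℕ} (hi : i + 1 = min (n + 1) k) {a : C.cell k} {x y : C.cell n}
    {q : FreeHom G x y} (h : G.freeGlob.Composable hi (FreeCell.top q) (FreeCell.low a)) :
    ∃ x' y' : C.cell n, C.IsComp x a x' ∧ C.IsComp y a y' :=
  have hk : k ≤ n := dim_le a
  have hi' : i + 1 = min n k := by omega
  have h' := (composable_top_low hi hi').1 h
  ⟨_, _, NPrecategory.isComp_comp hi' (max_eq_left hk).symm x a (composable_right hi' hk q h'),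
    NPrecategory.isComp_comp hi' (max_eq_left hk).symm y a h'⟩

theorem lt_or_eq_of_ident {k : ℕ} (hk : ((k + 1 : ℕ) : ℕ∞) ≤ ((n + 1 : ℕ) : ℕ∞)) :
    ((k + 1 : ℕ) : ℕ∞) ≤ n ∨ k = n := by
  norm_cast at hk ⊢
  omega

namespace FreeCell

open Classical in
def ident : ∀ {k : ℕ}, ((k + 1 : ℕ) : ℕ∞) ≤ ((n + 1 : ℕ) : ℕ∞) → FreeCell G k → FreeCell G (k + 1)
  | k, hk, low c =>
    if h : ((k + 1 : ℕ) : ℕ∞) ≤ n then low (C.ident h c)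
    else
      have e : k = n := (lt_or_eq_of_ident hk).resolve_left h
      (congrArg (· + 1) e.symm : n + 1 = k + 1) ▸
        top (FreeHom.ident (cast (congrArg C.cell e) c))
  | _, hk, top _ => (by norm_cast at hk; omega : False).elim

end FreeCell

theorem ident_low {k : ℕ} (hk : ((k + 1 : ℕ) : ℕ∞) ≤ ((n + 1 : ℕ) : ℕ∞))
    (hk' : ((k + 1 : ℕ) : ℕ∞) ≤ n) (c : C.cell k) :
    FreeCell.ident hk (FreeCell.low c : FreeCell G k) = FreeCell.low (C.ident hk' c) := by
  rw [FreeCell.ident, dif_pos hk']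

theorem ident_top (hk : ((n + 1 : ℕ) : ℕ∞) ≤ ((n + 1 : ℕ) : ℕ∞)) (c : C.cell n) :
    FreeCell.ident hk (FreeCell.low c : FreeCell G n) = FreeCell.top (FreeHom.ident c) := by
  have : ¬ (((n + 1 : ℕ) : ℕ∞) ≤ n) := by norm_cast; omega
  rw [FreeCell.ident, dif_neg this]
  rfl

theorem src_ident {k : ℕ} (hk : ((k + 1 : ℕ) : ℕ∞) ≤ ((n + 1 : ℕ) : ℕ∞)) (u : FreeCell G k) :
    (u.ident hk).src = u := by
  cases u with
  | low c =>
    obtain h | rfl := lt_or_eq_of_ident hk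
    · rw [ident_low hk h]
      exact congrArg FreeCell.low (C.src_ident h c)
    · rw [ident_top]; rfl
  | top q => norm_cast at hk; omega

theorem tgt_ident {k : ℕ} (hk : ((k + 1 : ℕ) : ℕ∞) ≤ ((n + 1 : ℕ) : ℕ∞)) (u : FreeCell G k) :
    (u.ident hk).tgt = u := by
  cases u with
  | low c =>
    obtain h | rfl := lt_or_eq_of_ident hk
    · rw [ident_low hk h]
      exact congrArg FreeCell.low (C.tgt_ident h c)
    · rw [ident_top]; rfl
  | top q => norm_cast at hk; omega

theorem low_comp_low {i k l m : ℕ} (hi : i + 1 = min k l) (hm : m = max k l) (a : C.cell k)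
    (b : C.cell l) (h : G.freeGlob.Composable hi (FreeCell.low a) (FreeCell.low b)) {c : C.cell m}
    (hc : C.IsComp a b c) :
    FreeCell.comp hi hm (FreeCell.low a) (FreeCell.low b) h = FreeCell.low c := by
  obtain ⟨_, rfl⟩ := hc.eq hi hm
  rfl

theorem exists_low {i k l m : ℕ} (hi : i + 1 = min k l) (hm : m = max k l) {a : C.cell k}
    {b : C.cell l} (h : G.freeGlob.Composable hi (FreeCell.low a) (FreeCell.low b)) :
    ∃ c : C.cell m, C.IsComp a b c :=
  ⟨_, NPrecategory.isComp_comp hi hm a b ((composable_low_low hi).1 h)⟩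

theorem src_comp_lt {i k l m : ℕ} (hi : i + 1 = min k (l + 1)) (hm : m + 1 = max k (l + 1))
    (hi' : i + 1 = min k l) (hm' : m = max k l) (u : FreeCell G k) (v : FreeCell G (l + 1))
    (h : G.freeGlob.Composable hi u v) (h' : G.freeGlob.Composable hi' u v.src)
    (hkl : k < l + 1) : (FreeCell.comp hi hm u v h).src = FreeCell.comp hi' hm' u v.src h' := by
  cases u with
  | top q' =>
    cases v with
    | low b => have := dim_le b; omega
    | top q => omega
  | low a =>
    cases v with
    | low b => exact congrArg FreeCell.low (C.src_comp_lt hi hm hi' hm' a b _ _ hkl)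
    | top q =>
      obtain ⟨x', y', hx, hy⟩ := exists_left hi h
      obtain rfl : m = n := by omega
      rw [comp_low_top hi hm a q h hx hy]
      exact (low_comp_low hi' hm' _ _ h' hx).symm

theorem tgt_comp_lt {i k l m : ℕ} (hi : i + 1 = min k (l + 1)) (hm : m + 1 = max k (l + 1))
    (hi' : i + 1 = min k l) (hm' : m = max k l) (u : FreeCell G k) (v : FreeCell G (l + 1))
    (h : G.freeGlob.Composable hi u v) (h' : G.freeGlob.Composable hi' u v.tgt)
    (hkl : k < l + 1) : (FreeCell.comp hi hm u v h).tgt = FreeCell.comp hi' hm' u v.tgt h' := by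
  cases u with
  | top q' =>
    cases v with
    | low b => have := dim_le b; omega
    | top q => omega
  | low a =>
    cases v with
    | low b => exact congrArg FreeCell.low (C.tgt_comp_lt hi hm hi' hm' a b _ _ hkl)
    | top q =>
      obtain ⟨x', y', hx, hy⟩ := exists_left hi h
      obtain rfl : m = n := by omega
      rw [comp_low_top hi hm a q h hx hy]
      exact (low_comp_low hi' hm' _ _ h' hy).symm

theorem src_comp_gt {i k l m : ℕ} (hi : i + 1 = min (k + 1) l) (hm : m + 1 = max (k + 1) l)
    (hi' : i + 1 = min k l) (hm' : m = max k l) (u : FreeCell G (k + 1)) (v : FreeCell G l)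
    (h : G.freeGlob.Composable hi u v) (h' : G.freeGlob.Composable hi' u.src v)
    (hkl : l < k + 1) : (FreeCell.comp hi hm u v h).src = FreeCell.comp hi' hm' u.src v h' := by
  cases v with
  | top q' =>
    cases u with
    | low b => have := dim_le b; omega
    | top q => omega
  | low a =>
    cases u with
    | low b => exact congrArg FreeCell.low (C.src_comp_gt hi hm hi' hm' b a _ _ hkl)
    | top q =>
      obtain ⟨x', y', hx, hy⟩ := exists_right hi h
      obtain rfl : m = n := by omega
      rw [comp_top_low hi hm a q h hx hy]
      exact (low_comp_low hi' hm' _ _ h' hx).symm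

theorem tgt_comp_gt {i k l m : ℕ} (hi : i + 1 = min (k + 1) l) (hm : m + 1 = max (k + 1) l)
    (hi' : i + 1 = min k l) (hm' : m = max k l) (u : FreeCell G (k + 1)) (v : FreeCell G l)
    (h : G.freeGlob.Composable hi u v) (h' : G.freeGlob.Composable hi' u.tgt v)
    (hkl : l < k + 1) : (FreeCell.comp hi hm u v h).tgt = FreeCell.comp hi' hm' u.tgt v h' := by
  cases v with
  | top q' =>
    cases u with
    | low b => have := dim_le b; omega
    | top q => omega
  | low a =>
    cases u with
    | low b => exact congrArg FreeCell.low (C.tgt_comp_gt hi hm hi' hm' b a _ _ hkl)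
    | top q =>
      obtain ⟨x', y', hx, hy⟩ := exists_right hi h
      obtain rfl : m = n := by omega
      rw [comp_top_low hi hm a q h hx hy]
      exact (low_comp_low hi' hm' _ _ h' hy).symm

theorem src_comp_eq {i k : ℕ} (hi : i + 1 = min (k + 1) (k + 1))
    (hm : k + 1 = max (k + 1) (k + 1)) (u v : FreeCell G (k + 1))
    (h : G.freeGlob.Composable hi u v) : (FreeCell.comp hi hm u v h).src = u.src := by
  cases u with
  | low a =>
    cases v with
    | low b => exact congrArg FreeCell.low (C.src_comp_eq hi hm a b _)
    | top q => have := dim_le a; omega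
  | top q =>
    cases v with
    | low b => have := dim_le b; omega
    | top q' =>
      obtain rfl := (composable_top_top hi).1 h
      rfl

theorem tgt_comp_eq {i k : ℕ} (hi : i + 1 = min (k + 1) (k + 1))
    (hm : k + 1 = max (k + 1) (k + 1)) (u v : FreeCell G (k + 1))
    (h : G.freeGlob.Composable hi u v) : (FreeCell.comp hi hm u v h).tgt = v.tgt := by
  cases u with
  | low a =>
    cases v with
    | low b => exact congrArg FreeCell.low (C.tgt_comp_eq hi hm a b _)
    | top q => have := dim_le a; omega
  | top q =>
    cases v with
    | low b => have := dim_le b; omega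
    | top q' =>
      obtain rfl := (composable_top_top hi).1 h
      rfl

theorem ident_comp_le {i k l : ℕ} (hk : ((k + 1 : ℕ) : ℕ∞) ≤ ((n + 1 : ℕ) : ℕ∞))
    (hi : i + 1 = min (k + 1) l) (hm : l = max (k + 1) l) (u : FreeCell G k) (v : FreeCell G l)
    (h : G.freeGlob.Composable hi (u.ident hk) v) : FreeCell.comp hi hm (u.ident hk) v h = v := by
  cases u with
  | top q => norm_cast at hk; omega
  | low a =>
    obtain hk' | rfl := lt_or_eq_of_ident hk
    · have e := ident_low (G := G) hk hk' a
      generalize FreeCell.ident hk (FreeCell.low a : FreeCell G k) = z at e h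
      subst e
      cases v with
      | low b => exact congrArg FreeCell.low (C.ident_comp_le hk' hi hm a b _)
      | @top x y q =>
        obtain ⟨x', y', hx, hy⟩ := exists_left hi h
        obtain rfl : x = x' := by
          obtain ⟨_, rfl⟩ := hx.eq (i := i) (by norm_cast at hk'; omega)
            (by norm_cast at hk'; omega)
          exact (C.ident_comp_le hk' _ _ a x _).symm
        obtain rfl : y = y' := by
          obtain ⟨_, rfl⟩ := hy.eq (i := i) (by norm_cast at hk'; omega)
            (by norm_cast at hk'; omega)
          exact (C.ident_comp_le hk' _ _ a y _).symm
        rw [comp_low_top hi hm _ q h hx hy]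
        congr 1
        obtain ⟨t⟩ := q
        exact Quot.sound (.ident_left hk' a t hx hy)
    · have e := ident_top (G := G) hk a
      generalize FreeCell.ident hk (FreeCell.low a : FreeCell G k) = z at e h
      subst e
      cases v with
      | low b => have := dim_le b; omega
      | @top x y q =>
        obtain rfl := (composable_top_top hi).1 h
        rw [comp_top_top]
        congr 1
        obtain ⟨t⟩ := q
        exact Quot.sound (.ident_comp t)

theorem comp_ident_le {i k l : ℕ} (hl : ((l + 1 : ℕ) : ℕ∞) ≤ ((n + 1 : ℕ) : ℕ∞))
    (hi : i + 1 = min k (l + 1)) (hm : k = max k (l + 1)) (u : FreeCell G k) (v : FreeCell G l)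
    (h : G.freeGlob.Composable hi u (v.ident hl)) : FreeCell.comp hi hm u (v.ident hl) h = u := by
  cases v with
  | top q => norm_cast at hl; omega
  | low a =>
    obtain hk' | rfl := lt_or_eq_of_ident hl
    · have e := ident_low (G := G) hl hk' a
      generalize FreeCell.ident hl (FreeCell.low a : FreeCell G l) = z at e h
      subst e
      cases u with
      | low b => exact congrArg FreeCell.low (C.comp_ident_le hk' hi hm b a _)
      | @top x y q =>
        obtain ⟨x', y', hx, hy⟩ := exists_right hi h
        obtain rfl : x = x' := by
          obtain ⟨_, rfl⟩ := hx.eq (i := i) (by norm_cast at hk'; omega)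
            (by norm_cast at hk'; omega)
          exact (C.comp_ident_le hk' _ _ x a _).symm
        obtain rfl : y = y' := by
          obtain ⟨_, rfl⟩ := hy.eq (i := i) (by norm_cast at hk'; omega)
            (by norm_cast at hk'; omega)
          exact (C.comp_ident_le hk' _ _ y a _).symm
        rw [comp_top_low hi hm _ q h hx hy]
        congr 1
        obtain ⟨t⟩ := q
        exact Quot.sound (.ident_right hk' a t hx hy)
    · have e := ident_top (G := G) hl a
      generalize FreeCell.ident hl (FreeCell.low a : FreeCell G l) = z at e h
      subst e
      cases u with
      | low b => have := dim_le b; omega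
      | @top x y q =>
        obtain rfl := (composable_top_top hi).1 h
        rw [comp_top_top]
        congr 1
        obtain ⟨t⟩ := q
        exact Quot.sound (.comp_ident t)

theorem ident_comp_gt {i k l m : ℕ} (hk : ((k + 1 : ℕ) : ℕ∞) ≤ ((n + 1 : ℕ) : ℕ∞))
    (hmn : ((m + 1 : ℕ) : ℕ∞) ≤ ((n + 1 : ℕ) : ℕ∞)) (hi : i + 1 = min (k + 1) l)
    (hm : m + 1 = max (k + 1) l) (hi' : i + 1 = min k l) (hm' : m = max k l) (u : FreeCell G k)
    (v : FreeCell G l) (h : G.freeGlob.Composable hi (u.ident hk) v)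
    (h' : G.freeGlob.Composable hi' u v) (hlk : l < k + 1) :
    FreeCell.comp hi hm (u.ident hk) v h = (FreeCell.comp hi' hm' u v h').ident hmn := by
  obtain rfl : m = k := by omega
  cases u with
  | top q => norm_cast at hk; omega
  | low a =>
    cases v with
    | top q => have := dim_le a; omega
    | low b =>
      obtain ⟨c, hc⟩ := exists_low hi' hm' h'
      rw [low_comp_low hi' hm' _ _ h' hc]
      obtain hk' | rfl := lt_or_eq_of_ident hk
      · have e := ident_low (G := G) hk hk' a
        generalize FreeCell.ident hk (FreeCell.low a : FreeCell G m) = z at e h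
        subst e
        rw [ident_low hmn hk']
        obtain ⟨_, rfl⟩ := hc.eq hi' hm'
        exact congrArg FreeCell.low (C.ident_comp_gt hk' hk' hi hm hi' hm' a b _ _ hlk)
      · have e := ident_top (G := G) hk a
        generalize FreeCell.ident hk (FreeCell.low a : FreeCell G m) = z at e h
        subst e
        rw [ident_top, comp_top_low hi hm b _ h hc hc]
        congr 1
        exact Quot.sound (.right_ident b hc hc)

theorem comp_ident_gt {i k l m : ℕ} (hl : ((l + 1 : ℕ) : ℕ∞) ≤ ((n + 1 : ℕ) : ℕ∞))
    (hmn : ((m + 1 : ℕ) : ℕ∞) ≤ ((n + 1 : ℕ) : ℕ∞)) (hi : i + 1 = min k (l + 1))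
    (hm : m + 1 = max k (l + 1)) (hi' : i + 1 = min k l) (hm' : m = max k l) (u : FreeCell G k)
    (v : FreeCell G l) (h : G.freeGlob.Composable hi u (v.ident hl))
    (h' : G.freeGlob.Composable hi' u v) (hkl : k < l + 1) :
    FreeCell.comp hi hm u (v.ident hl) h = (FreeCell.comp hi' hm' u v h').ident hmn := by
  obtain rfl : m = l := by omega
  cases v with
  | top q => norm_cast at hl; omega
  | low b =>
    cases u with
    | top q => have := dim_le b; omega
    | low a =>
      obtain ⟨c, hc⟩ := exists_low hi' hm' h'
      rw [low_comp_low hi' hm' _ _ h' hc]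
      obtain hk' | rfl := lt_or_eq_of_ident hl
      · have e := ident_low (G := G) hl hk' b
        generalize FreeCell.ident hl (FreeCell.low b : FreeCell G m) = z at e h
        subst e
        rw [ident_low hmn hk']
        obtain ⟨_, rfl⟩ := hc.eq hi' hm'
        exact congrArg FreeCell.low (C.comp_ident_gt hk' hk' hi hm hi' hm' a b _ _ hkl)
      · have e := ident_top (G := G) hl b
        generalize FreeCell.ident hl (FreeCell.low b : FreeCell G m) = z at e h
        subst e
        rw [ident_top, comp_low_top hi hm a _ h hc hc]
        congr 1
        exact Quot.sound (.left_ident a hc hc)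

theorem assoc {i k l m p q r : ℕ} (hkl : i + 1 = min k l) (hlm : i + 1 = min l m)
    (hp : p = max k l) (hq : q = max l m) (hpm : i + 1 = min p m) (hkq : i + 1 = min k q)
    (hr : r = max p m) (hr' : r = max k q) (u : FreeCell G k) (v : FreeCell G l) (w : FreeCell G m)
    (huv : G.freeGlob.Composable hkl u v) (hvw : G.freeGlob.Composable hlm v w)
    (h : G.freeGlob.Composable hpm (FreeCell.comp hkl hp u v huv) w)
    (h' : G.freeGlob.Composable hkq u (FreeCell.comp hlm hq v w hvw)) :
    FreeCell.comp hpm hr (FreeCell.comp hkl hp u v huv) w h =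
      FreeCell.comp hkq hr' u (FreeCell.comp hlm hq v w hvw) h' := by
  cases u with
  | low a =>
    have := dim_le a
    cases v with
    | low b =>
      have := dim_le b
      cases w with
      | low c => exact congrArg FreeCell.low (C.assoc hkl hlm hp hq hpm hkq hr hr' a b c _ _ _ _)
      | @top x y t =>
        obtain rfl : k = l := by omega
        obtain rfl : p = k := by omega
        obtain rfl : q = n + 1 := by omega
        obtain rfl : r = n + 1 := by omega
        obtain ⟨ab, hab⟩ := exists_low hkl hp huv
        have e₁ := low_comp_low hkl hp a b huv hab
        obtain ⟨x₁, y₁, hx₁, hy₁⟩ := exists_left hlm hvw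
        have e₂ := comp_low_top hlm hq b t hvw hx₁ hy₁
        generalize FreeCell.comp hkl hp _ _ huv = z₁ at e₁ h ⊢
        generalize FreeCell.comp hlm hq _ _ hvw = z₂ at e₂ h' ⊢
        subst e₁ e₂
        obtain ⟨x₂, y₂, hx₂, hy₂⟩ := exists_left hkq h'
        obtain ⟨x₃, y₃, hx₃, hy₃⟩ := exists_left hpm h
        obtain rfl := NPrecategory.assoc_eq hab hx₁ hx₃ hx₂ (by omega) (by omega) (by omega)
        obtain rfl := NPrecategory.assoc_eq hab hy₁ hy₃ hy₂ (by omega) (by omega) (by omega)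
        rw [comp_low_top hkq hr' a _ h' hx₂ hy₂, comp_low_top hpm hr ab _ h hx₃ hy₃]
        congr 1
        obtain ⟨t⟩ := t
        exact Quot.sound (.left_left hab t hx₁ hy₁ hx₂ hy₂ hx₃ hy₃)
    | @top x y t =>
      cases w with
      | low b =>
        have := dim_le b
        obtain rfl : k = m := by omega
        obtain rfl : p = n + 1 := by omega
        obtain rfl : q = n + 1 := by omega
        obtain rfl : r = n + 1 := by omega
        obtain ⟨x₁, y₁, hx₁, hy₁⟩ := exists_left hkl huv
        have e₁ := comp_low_top hkl hp a t huv hx₁ hy₁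
        obtain ⟨x₂, y₂, hx₂, hy₂⟩ := exists_right hlm hvw
        have e₂ := comp_top_low hlm hq b t hvw hx₂ hy₂
        generalize FreeCell.comp hkl hp _ _ huv = z₁ at e₁ h ⊢
        generalize FreeCell.comp hlm hq _ _ hvw = z₂ at e₂ h' ⊢
        subst e₁ e₂
        obtain ⟨x₃, y₃, hx₃, hy₃⟩ := exists_right hpm h
        obtain ⟨x₄, y₄, hx₄, hy₄⟩ := exists_left hkq h'
        obtain rfl := NPrecategory.assoc_eq hx₁ hx₂ hx₃ hx₄ (by omega) (by omega) (by omega)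
        obtain rfl := NPrecategory.assoc_eq hy₁ hy₂ hy₃ hy₄ (by omega) (by omega) (by omega)
        rw [comp_low_top hkq hr' a _ h' hx₄ hy₄, comp_top_low hpm hr b _ h hx₃ hy₃]
        congr 1
        obtain ⟨t⟩ := t
        exact Quot.sound (.left_right t hx₁ hy₁ hx₃ hy₃ hx₂ hy₂ hx₄ hy₄)
      | top t' => omega
  | @top x y t =>
    cases v with
    | low a =>
      have := dim_le a
      cases w with
      | low b =>
        have := dim_le b
        obtain rfl : l = m := by omega
        obtain rfl : p = n + 1 := by omega
        obtain rfl : q = l := by omega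
        obtain rfl : r = n + 1 := by omega
        obtain ⟨ab, hab⟩ := exists_low hlm hq hvw
        have e₂ := low_comp_low hlm hq a b hvw hab
        obtain ⟨x₁, y₁, hx₁, hy₁⟩ := exists_right hkl huv
        have e₁ := comp_top_low hkl hp a t huv hx₁ hy₁
        generalize FreeCell.comp hkl hp _ _ huv = z₁ at e₁ h ⊢
        generalize FreeCell.comp hlm hq _ _ hvw = z₂ at e₂ h' ⊢
        subst e₁ e₂
        obtain ⟨x₂, y₂, hx₂, hy₂⟩ := exists_right hpm h
        obtain ⟨x₃, y₃, hx₃, hy₃⟩ := exists_right hkq h'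
        obtain rfl := NPrecategory.assoc_eq hx₁ hab hx₂ hx₃ (by omega) (by omega) (by omega)
        obtain rfl := NPrecategory.assoc_eq hy₁ hab hy₂ hy₃ (by omega) (by omega) (by omega)
        rw [comp_top_low hkq hr' ab _ h' hx₃ hy₃, comp_top_low hpm hr b _ h hx₂ hy₂]
        congr 1
        obtain ⟨t⟩ := t
        exact Quot.sound (.right_right hab t hx₁ hy₁ hx₂ hy₂ hx₃ hy₃)
      | top t' => omega
    | top t' =>
      cases w with
      | low b => have := dim_le b; omega
      | top t'' =>
        obtain rfl := (composable_top_top hkl).1 huv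
        obtain rfl := (composable_top_top hlm).1 hvw
        obtain rfl : p = n + 1 := by omega
        obtain rfl : q = n + 1 := by omega
        obtain rfl : r = n + 1 := by omega
        refine congrArg FreeCell.top ?_
        obtain ⟨t⟩ := t
        obtain ⟨t'⟩ := t'
        obtain ⟨t''⟩ := t''
        exact Quot.sound (.assoc t t' t'')

theorem comp_distrib {i j k l l' m p p' q : ℕ} (hj : j + 1 = min l l') (hm : m = max l l')
    (hi : i + 1 = min k m) (hq : q = max k m) (hi₁ : i + 1 = min k l) (hp : p = max k l)
    (hi₂ : i + 1 = min k l') (hp' : p' = max k l') (hj' : j + 1 = min p p') (hq' : q = max p p')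
    (u : FreeCell G k) (v : FreeCell G l) (v' : FreeCell G l')
    (hvv' : G.freeGlob.Composable hj v v')
    (h : G.freeGlob.Composable hi u (FreeCell.comp hj hm v v' hvv'))
    (huv : G.freeGlob.Composable hi₁ u v) (huv' : G.freeGlob.Composable hi₂ u v')
    (h' : G.freeGlob.Composable hj' (FreeCell.comp hi₁ hp u v huv)
      (FreeCell.comp hi₂ hp' u v' huv')) (hij : i < j) :
    FreeCell.comp hi hq u (FreeCell.comp hj hm v v' hvv') h =
      FreeCell.comp hj' hq' (FreeCell.comp hi₁ hp u v huv) (FreeCell.comp hi₂ hp' u v' huv') h' := by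
  cases u with
  | top t =>
    exfalso
    cases v with
    | low b => cases v' with
      | low c => have := dim_le b; have := dim_le c; omega
      | top => omega
    | top t => cases v' <;> omega
  | low a =>
    have := dim_le a
    cases v with
    | low b =>
      have := dim_le b
      cases v' with
      | low c =>
        exact congrArg FreeCell.low
          (C.comp_distrib hj hm hi hq hi₁ hp hi₂ hp' hj' hq' a b c _ _ _ _ _ hij)
      | top t =>
        obtain rfl : p = l := by omega
        obtain rfl : m = n + 1 := by omega
        obtain rfl : p' = n + 1 := by omega
        obtain rfl : q = n + 1 := by omega
        obtain ⟨ab, hab⟩ := exists_low hi₁ hp huv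
        have e₁ := low_comp_low hi₁ hp a b huv hab
        obtain ⟨x₁, y₁, hx₁, hy₁⟩ := exists_left hj hvv'
        have e₂ := comp_low_top hj hm b t hvv' hx₁ hy₁
        obtain ⟨x₂, y₂, hx₂, hy₂⟩ := exists_left hi₂ huv'
        have e₃ := comp_low_top hi₂ hp' a t huv' hx₂ hy₂
        generalize FreeCell.comp hi₁ hp _ _ huv = z₁ at e₁ h' ⊢
        generalize FreeCell.comp hj hm _ _ hvv' = z₂ at e₂ h ⊢
        generalize FreeCell.comp hi₂ hp' _ _ huv' = z₃ at e₃ h' ⊢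
        subst e₁ e₂ e₃
        obtain ⟨x₃, y₃, hx₃, hy₃⟩ := exists_left hi h
        obtain ⟨x₄, y₄, hx₄, hy₄⟩ := exists_left hj' h'
        obtain rfl := NPrecategory.comp_distrib_eq hx₁ hx₃ hab hx₂ hx₄ (by omega) (by omega)
        obtain rfl := NPrecategory.comp_distrib_eq hy₁ hy₃ hab hy₂ hy₄ (by omega) (by omega)
        rw [comp_low_top hi hq a _ h hx₃ hy₃, comp_low_top hj' hq' ab _ h' hx₄ hy₄]
        congr 1
        obtain ⟨t⟩ := t
        exact Quot.sound (.left_distrib_left (by omega) hab t hx₁ hy₁ hx₃ hy₃ hx₂ hy₂ hx₄ hy₄)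
    | top t =>
      cases v' with
      | low b =>
        have := dim_le b
        obtain rfl : p' = l' := by omega
        obtain rfl : m = n + 1 := by omega
        obtain rfl : p = n + 1 := by omega
        obtain rfl : q = n + 1 := by omega
        obtain ⟨ab, hab⟩ := exists_low hi₂ hp' huv'
        have e₁ := low_comp_low hi₂ hp' a b huv' hab
        obtain ⟨x₁, y₁, hx₁, hy₁⟩ := exists_right hj hvv'
        have e₂ := comp_top_low hj hm b t hvv' hx₁ hy₁
        obtain ⟨x₂, y₂, hx₂, hy₂⟩ := exists_left hi₁ huv
        have e₃ := comp_low_top hi₁ hp a t huv hx₂ hy₂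
        generalize FreeCell.comp hi₁ hp _ _ huv = z₁ at e₃ h' ⊢
        generalize FreeCell.comp hj hm _ _ hvv' = z₂ at e₂ h ⊢
        generalize FreeCell.comp hi₂ hp' _ _ huv' = z₃ at e₁ h' ⊢
        subst e₁ e₂ e₃
        obtain ⟨x₃, y₃, hx₃, hy₃⟩ := exists_left hi h
        obtain ⟨x₄, y₄, hx₄, hy₄⟩ := exists_right hj' h'
        obtain rfl := NPrecategory.comp_distrib_eq hx₁ hx₃ hx₂ hab hx₄ (by omega) (by omega)
        obtain rfl := NPrecategory.comp_distrib_eq hy₁ hy₃ hy₂ hab hy₄ (by omega) (by omega)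
        rw [comp_low_top hi hq a _ h hx₃ hy₃, comp_top_low hj' hq' ab _ h' hx₄ hy₄]
        congr 1
        obtain ⟨t⟩ := t
        exact Quot.sound (.left_distrib_right (by omega) hab t hx₁ hy₁ hx₃ hy₃ hx₂ hy₂ hx₄ hy₄)
      | top t' =>
        obtain rfl := (composable_top_top hj).1 hvv'
        obtain rfl : m = n + 1 := by omega
        obtain rfl : p = n + 1 := by omega
        obtain rfl : p' = n + 1 := by omega
        obtain rfl : q = n + 1 := by omega
        obtain ⟨x₁, y₁, hx, hy⟩ := exists_left hi₁ huv
        obtain ⟨_, z₁, hy', hz⟩ := exists_left hi₂ huv'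
        obtain rfl := hy.unique hy'
        have e₁ := comp_low_top hi₁ hp a t huv hx hy
        have e₂ := comp_low_top hi₂ hp' a t' huv' hy hz
        generalize FreeCell.comp hi₁ hp _ _ huv = z₁ at e₁ h' ⊢
        generalize FreeCell.comp hi₂ hp' _ _ huv' = z₃ at e₂ h' ⊢
        subst e₁ e₂
        have e₃ := comp_top_top hj hm t t' hvv'
        generalize FreeCell.comp hj hm _ _ hvv' = z₃ at e₃ h ⊢
        subst e₃
        rw [comp_low_top hi hq a _ h hx hz, comp_top_top]
        congr 1
        obtain ⟨t⟩ := t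
        obtain ⟨t'⟩ := t'
        exact Quot.sound (.left_comp a t t' hx hy hz)

theorem distrib_comp {i j k l l' m p p' q : ℕ} (hj : j + 1 = min l l') (hm : m = max l l')
    (hi : i + 1 = min m k) (hq : q = max m k) (hi₁ : i + 1 = min l k) (hp : p = max l k)
    (hi₂ : i + 1 = min l' k) (hp' : p' = max l' k) (hj' : j + 1 = min p p') (hq' : q = max p p')
    (v : FreeCell G l) (v' : FreeCell G l') (u : FreeCell G k)
    (hvv' : G.freeGlob.Composable hj v v')
    (h : G.freeGlob.Composable hi (FreeCell.comp hj hm v v' hvv') u)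
    (huv : G.freeGlob.Composable hi₁ v u) (huv' : G.freeGlob.Composable hi₂ v' u)
    (h' : G.freeGlob.Composable hj' (FreeCell.comp hi₁ hp v u huv)
      (FreeCell.comp hi₂ hp' v' u huv')) (hij : i < j) :
    FreeCell.comp hi hq (FreeCell.comp hj hm v v' hvv') u h =
      FreeCell.comp hj' hq' (FreeCell.comp hi₁ hp v u huv) (FreeCell.comp hi₂ hp' v' u huv') h' := by
  cases u with
  | top t =>
    exfalso
    cases v with
    | low b => cases v' with
      | low c => have := dim_le b; have := dim_le c; omega
      | top => omega
    | top t => cases v' <;> omega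
  | low a =>
    have := dim_le a
    cases v with
    | low b =>
      have := dim_le b
      cases v' with
      | low c =>
        exact congrArg FreeCell.low
          (C.distrib_comp hj hm hi hq hi₁ hp hi₂ hp' hj' hq' b c a _ _ _ _ _ hij)
      | top t =>
        obtain rfl : p = l := by omega
        obtain rfl : m = n + 1 := by omega
        obtain rfl : p' = n + 1 := by omega
        obtain rfl : q = n + 1 := by omega
        obtain ⟨ab, hab⟩ := exists_low hi₁ hp huv
        have e₁ := low_comp_low hi₁ hp b a huv hab
        obtain ⟨x₁, y₁, hx₁, hy₁⟩ := exists_left hj hvv'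
        have e₂ := comp_low_top hj hm b t hvv' hx₁ hy₁
        obtain ⟨x₂, y₂, hx₂, hy₂⟩ := exists_right hi₂ huv'
        have e₃ := comp_top_low hi₂ hp' a t huv' hx₂ hy₂
        generalize FreeCell.comp hi₁ hp _ _ huv = z₁ at e₁ h' ⊢
        generalize FreeCell.comp hj hm _ _ hvv' = z₂ at e₂ h ⊢
        generalize FreeCell.comp hi₂ hp' _ _ huv' = z₃ at e₃ h' ⊢
        subst e₁ e₂ e₃
        obtain ⟨x₃, y₃, hx₃, hy₃⟩ := exists_right hi h
        obtain ⟨x₄, y₄, hx₄, hy₄⟩ := exists_left hj' h'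
        obtain rfl := NPrecategory.distrib_comp_eq hx₁ hx₃ hab hx₂ hx₄ (by omega) (by omega)
        obtain rfl := NPrecategory.distrib_comp_eq hy₁ hy₃ hab hy₂ hy₄ (by omega) (by omega)
        rw [comp_top_low hi hq a _ h hx₃ hy₃, comp_low_top hj' hq' ab _ h' hx₄ hy₄]
        congr 1
        obtain ⟨t⟩ := t
        exact Quot.sound (.right_distrib_left (by omega) hab t hx₁ hy₁ hx₃ hy₃ hx₂ hy₂ hx₄ hy₄)
    | top t =>
      cases v' with
      | low b =>
        have := dim_le b
        obtain rfl : p' = l' := by omega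
        obtain rfl : m = n + 1 := by omega
        obtain rfl : p = n + 1 := by omega
        obtain rfl : q = n + 1 := by omega
        obtain ⟨ab, hab⟩ := exists_low hi₂ hp' huv'
        have e₁ := low_comp_low hi₂ hp' b a huv' hab
        obtain ⟨x₁, y₁, hx₁, hy₁⟩ := exists_right hj hvv'
        have e₂ := comp_top_low hj hm b t hvv' hx₁ hy₁
        obtain ⟨x₂, y₂, hx₂, hy₂⟩ := exists_right hi₁ huv
        have e₃ := comp_top_low hi₁ hp a t huv hx₂ hy₂
        generalize FreeCell.comp hi₁ hp _ _ huv = z₁ at e₃ h' ⊢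
        generalize FreeCell.comp hj hm _ _ hvv' = z₂ at e₂ h ⊢
        generalize FreeCell.comp hi₂ hp' _ _ huv' = z₃ at e₁ h' ⊢
        subst e₁ e₂ e₃
        obtain ⟨x₃, y₃, hx₃, hy₃⟩ := exists_right hi h
        obtain ⟨x₄, y₄, hx₄, hy₄⟩ := exists_right hj' h'
        obtain rfl := NPrecategory.distrib_comp_eq hx₁ hx₃ hx₂ hab hx₄ (by omega) (by omega)
        obtain rfl := NPrecategory.distrib_comp_eq hy₁ hy₃ hy₂ hab hy₄ (by omega) (by omega)
        rw [comp_top_low hi hq a _ h hx₃ hy₃, comp_top_low hj' hq' ab _ h' hx₄ hy₄]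
        congr 1
        obtain ⟨t⟩ := t
        exact Quot.sound (.right_distrib_right (by omega) hab t hx₁ hy₁ hx₃ hy₃ hx₂ hy₂ hx₄ hy₄)
      | top t' =>
        obtain rfl := (composable_top_top hj).1 hvv'
        obtain rfl : m = n + 1 := by omega
        obtain rfl : p = n + 1 := by omega
        obtain rfl : p' = n + 1 := by omega
        obtain rfl : q = n + 1 := by omega
        obtain ⟨x₁, y₁, hx, hy⟩ := exists_right hi₁ huv
        obtain ⟨_, z₁, hy', hz⟩ := exists_right hi₂ huv'
        obtain rfl := hy.unique hy'
        have e₁ := comp_top_low hi₁ hp a t huv hx hy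
        have e₂ := comp_top_low hi₂ hp' a t' huv' hy hz
        generalize FreeCell.comp hi₁ hp _ _ huv = z₁ at e₁ h' ⊢
        generalize FreeCell.comp hi₂ hp' _ _ huv' = z₃ at e₂ h' ⊢
        subst e₁ e₂
        have e₃ := comp_top_top hj hm t t' hvv'
        generalize FreeCell.comp hj hm _ _ hvv' = z₃ at e₃ h ⊢
        subst e₃
        rw [comp_top_low hi hq a _ h hx hz, comp_top_top]
        congr 1
        obtain ⟨t⟩ := t
        obtain ⟨t'⟩ := t'
        exact Quot.sound (.right_comp a t t' hx hy hz)

variable (G)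

/-- The `(n+1)`-precategory freely generated by attaching the generators `G` to the
`n`-precategory `C`: the pushout of `C` (with formal identities added in dimension `n+1`) and of
the free `(n+1)`-precategory on `G`. -/
@[reducible] def free : NPrecategory.{u} ((n + 1 : ℕ) : ℕ∞) where
  toGlobularSet := G.freeGlob
  ident := FreeCell.ident
  comp := FreeCell.comp
  src_ident := src_ident
  tgt_ident := tgt_ident
  src_comp_lt := src_comp_lt
  tgt_comp_lt := tgt_comp_lt
  src_comp_eq := src_comp_eq
  tgt_comp_eq := tgt_comp_eq
  src_comp_gt := src_comp_gt
  tgt_comp_gt := tgt_comp_gt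
  ident_comp_le := ident_comp_le
  ident_comp_gt := ident_comp_gt
  comp_ident_le := comp_ident_le
  comp_ident_gt := comp_ident_gt
  assoc := assoc
  comp_distrib := comp_distrib
  distrib_comp := distrib_comp

end CellExtension

namespace NPrecategory

variable {n : ℕ∞} {C : NPrecategory.{u} n}

theorem ident_isComp_le {k l : ℕ} (hk : ((k + 1 : ℕ) : ℕ∞) ≤ n) {u : C.cell k} {v w : C.cell l}
    (h : C.IsComp (C.ident hk u) v w) : w = v := by
  obtain ⟨i, hi, hm, h, rfl⟩ := h
  exact C.ident_comp_le hk hi hm u v h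

theorem isComp_ident_le {k l : ℕ} (hl : ((l + 1 : ℕ) : ℕ∞) ≤ n) {u w : C.cell k} {v : C.cell l}
    (h : C.IsComp u (C.ident hl v) w) : w = u := by
  obtain ⟨i, hi, hm, h, rfl⟩ := h
  exact C.comp_ident_le hl hi hm u v h

theorem ident_isComp_gt {k l m : ℕ} (hk : ((k + 1 : ℕ) : ℕ∞) ≤ n)
    (hm : ((m + 1 : ℕ) : ℕ∞) ≤ n) {u : C.cell k} {v : C.cell l} {w : C.cell m}
    {w' : C.cell (m + 1)} (h : C.IsComp (C.ident hk u) v w') (h' : C.IsComp u v w) (hlk : l ≤ k) :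
    w' = C.ident hm w := by
  obtain ⟨i, hi, hm', h, rfl⟩ := h
  have d := h'.dim
  obtain ⟨hc, rfl⟩ := h'.eq (i := i) (by omega) d.2.2
  exact C.ident_comp_gt hk hm hi hm' _ _ u v h hc (by omega)

theorem isComp_ident_gt {k l m : ℕ} (hl : ((l + 1 : ℕ) : ℕ∞) ≤ n)
    (hm : ((m + 1 : ℕ) : ℕ∞) ≤ n) {u : C.cell k} {v : C.cell l} {w : C.cell m}
    {w' : C.cell (m + 1)} (h : C.IsComp u (C.ident hl v) w') (h' : C.IsComp u v w) (hkl : k ≤ l) :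
    w' = C.ident hm w := by
  obtain ⟨i, hi, hm', h, rfl⟩ := h
  have d := h'.dim
  obtain ⟨hc, rfl⟩ := h'.eq (i := i) (by omega) d.2.2
  exact C.comp_ident_gt hl hm hi hm' _ _ u v h hc (by omega)

theorem IsComp.src_of_lt {k l m : ℕ} {u : C.cell k} {v : C.cell (l + 1)} {w : C.cell (m + 1)}
    {w' : C.cell m} (h : C.IsComp u v w) (h' : C.IsComp u (C.src v) w') (hk : k < l + 1) :
    C.src w = w' := by
  obtain ⟨i, hi, hm, h, rfl⟩ := h
  obtain ⟨hc, rfl⟩ := h'.eq (i := i) (by omega) (by omega)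
  exact C.src_comp_lt hi hm _ _ u v h hc hk

theorem IsComp.tgt_of_lt {k l m : ℕ} {u : C.cell k} {v : C.cell (l + 1)} {w : C.cell (m + 1)}
    {w' : C.cell m} (h : C.IsComp u v w) (h' : C.IsComp u (C.tgt v) w') (hk : k < l + 1) :
    C.tgt w = w' := by
  obtain ⟨i, hi, hm, h, rfl⟩ := h
  obtain ⟨hc, rfl⟩ := h'.eq (i := i) (by omega) (by omega)
  exact C.tgt_comp_lt hi hm _ _ u v h hc hk

theorem IsComp.src_of_gt {k l m : ℕ} {u : C.cell (k + 1)} {v : C.cell l} {w : C.cell (m + 1)}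
    {w' : C.cell m} (h : C.IsComp u v w) (h' : C.IsComp (C.src u) v w') (hk : l < k + 1) :
    C.src w = w' := by
  obtain ⟨i, hi, hm, h, rfl⟩ := h
  obtain ⟨hc, rfl⟩ := h'.eq (i := i) (by omega) (by omega)
  exact C.src_comp_gt hi hm _ _ u v h hc hk

theorem IsComp.tgt_of_gt {k l m : ℕ} {u : C.cell (k + 1)} {v : C.cell l} {w : C.cell (m + 1)}
    {w' : C.cell m} (h : C.IsComp u v w) (h' : C.IsComp (C.tgt u) v w') (hk : l < k + 1) :
    C.tgt w = w' := by
  obtain ⟨i, hi, hm, h, rfl⟩ := h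
  obtain ⟨hc, rfl⟩ := h'.eq (i := i) (by omega) (by omega)
  exact C.tgt_comp_gt hi hm _ _ u v h hc hk

theorem IsComp.src_of_eq {k : ℕ} {u v w : C.cell (k + 1)} (h : C.IsComp u v w) :
    C.src w = C.src u := by
  obtain ⟨i, hi, hm, h, rfl⟩ := h
  exact C.src_comp_eq hi hm u v h

theorem IsComp.tgt_of_eq {k : ℕ} {u v w : C.cell (k + 1)} (h : C.IsComp u v w) :
    C.tgt w = C.tgt v := by
  obtain ⟨i, hi, hm, h, rfl⟩ := h
  exact C.tgt_comp_eq hi hm u v h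

theorem exists_comp_of_eq {k : ℕ} (u v : C.cell (k + 1)) (h : C.tgt u = C.src v) :
    ∃ w, C.IsComp u v w ∧ C.src w = C.src u ∧ C.tgt w = C.tgt v := by
  have hi : k + 1 = min (k + 1) (k + 1) := by omega
  have hm : k + 1 = max (k + 1) (k + 1) := by omega
  have hc : C.Composable hi u v := by
    rw [GlobularSet.Composable, C.srcAt_succ le_rfl, C.tgtAt_succ le_rfl, C.srcAt_self,
      C.tgtAt_self, h]
  exact ⟨_, isComp_comp hi hm u v hc, C.src_comp_eq .., C.tgt_comp_eq ..⟩

theorem exists_comp_left {k l : ℕ} (u : C.cell k) (v : C.cell (l + 1)) {x y : C.cell l}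
    (hx : C.IsComp u (C.src v) x) (hy : C.IsComp u (C.tgt v) y) :
    ∃ w, C.IsComp u v w ∧ C.src w = x ∧ C.tgt w = y := by
  have d := hx.dim
  obtain ⟨i, hi, hm, hx, rfl⟩ := hx
  obtain ⟨hy', rfl⟩ := hy.eq hi hm
  have hc : C.Composable (i := i) (by omega : i + 1 = min k (l + 1)) u v := by
    rw [GlobularSet.Composable, C.srcAt_succ (by omega)]
    exact hx
  exact ⟨_, isComp_comp _ (by omega) u v hc,
    C.src_comp_lt _ _ hi hm u v hc hx (by omega), C.tgt_comp_lt _ _ hi hm u v hc hy' (by omega)⟩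

theorem exists_comp_right {k l : ℕ} (u : C.cell k) (v : C.cell (l + 1)) {x y : C.cell l}
    (hx : C.IsComp (C.src v) u x) (hy : C.IsComp (C.tgt v) u y) :
    ∃ w, C.IsComp v u w ∧ C.src w = x ∧ C.tgt w = y := by
  have d := hx.dim
  obtain ⟨i, hi, hm, hx, rfl⟩ := hx
  obtain ⟨hy', rfl⟩ := hy.eq hi hm
  have hc : C.Composable (i := i) (by omega : i + 1 = min (l + 1) k) v u := by
    rw [GlobularSet.Composable, C.tgtAt_succ (by omega)]
    exact hy'
  exact ⟨_, isComp_comp _ (by omega) v u hc,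
    C.src_comp_gt _ _ hi hm v u hc hx (by omega), C.tgt_comp_gt _ _ hi hm v u hc hy' (by omega)⟩

end NPrecategory

namespace NPrefunctor

variable {n m p : ℕ∞} {C : NPrecategory.{u} n} {D : NPrecategory.{u} m} {E : NPrecategory.{u} p}

theorem map_srcAt (F : NPrefunctor C D) {i k : ℕ} (h : i ≤ k) (x : C.cell k) :
    F.map (C.srcAt h x) = D.srcAt h (F.map x) := by
  induction k, h using Nat.le_induction with
  | base => rw [C.srcAt_self, D.srcAt_self]
  | succ k h ih => rw [C.srcAt_succ h, D.srcAt_succ h, ih, F.map_src]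

theorem map_tgtAt (F : NPrefunctor C D) {i k : ℕ} (h : i ≤ k) (x : C.cell k) :
    F.map (C.tgtAt h x) = D.tgtAt h (F.map x) := by
  induction k, h using Nat.le_induction with
  | base => rw [C.tgtAt_self, D.tgtAt_self]
  | succ k h ih => rw [C.tgtAt_succ h, D.tgtAt_succ h, ih, F.map_tgt]

theorem map_composable (F : NPrefunctor C D) {i k l : ℕ} (hi : i + 1 = min k l) {x : C.cell k}
    {y : C.cell l} (h : C.Composable hi x y) : D.Composable hi (F.map x) (F.map y) := by
  rw [GlobularSet.Composable, ← F.map_srcAt, ← F.map_tgtAt, h]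

theorem map_isComp (F : NPrefunctor C D) {k l m : ℕ} {x : C.cell k} {y : C.cell l} {z : C.cell m}
    (h : C.IsComp x y z) : D.IsComp (F.map x) (F.map y) (F.map z) := by
  obtain ⟨i, hi, hm, h, rfl⟩ := h
  exact ⟨i, hi, hm, F.map_composable hi h, (F.map_comp hi hm x y h _).symm⟩

def id (C : NPrecategory.{u} n) : NPrefunctor C C where
  le := le_rfl
  map x := x
  map_src _ := rfl
  map_tgt _ := rfl
  map_ident _ _ := rfl
  map_comp _ _ _ _ _ _ := rfl

def comp (F : NPrefunctor C D) (F' : NPrefunctor D E) : NPrefunctor C E where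
  le := F.le.trans F'.le
  map x := F'.map (F.map x)
  map_src x := by rw [F.map_src, F'.map_src]
  map_tgt x := by rw [F.map_tgt, F'.map_tgt]
  map_ident hk x := by rw [F.map_ident, F'.map_ident]
  map_comp hi hp x y h h' := by
    rw [F.map_comp hi hp x y h (F.map_composable hi h), F'.map_comp]

end NPrefunctor

namespace CellExtension

variable {n : ℕ} {C : NPrecategory.{u} n} (G : CellExtension C)

/-- The inclusion of `C` in its free extension. -/
@[reducible] def incl : NPrefunctor C G.free where
  le := by norm_cast; omega
  map := FreeCell.low
  map_src _ := rfl
  map_tgt _ := rfl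
  map_ident hk x := (ident_low (hk.trans (by norm_cast; omega)) hk x).symm
  map_comp _ _ _ _ _ _ := rfl

/-- The generators as cells of the free extension. -/
def inj (g : G.gen) : G.free.cell (n + 1) := FreeCell.top (Quot.mk _ (.gen g))

variable {G}

section lift

variable {m : ℕ∞} {D : NPrecategory.{u} m} (F : NPrefunctor C D) (hm : ((n + 1 : ℕ) : ℕ∞) ≤ m)
  (f : G.gen → D.cell (n + 1)) (hs : ∀ g, D.src (f g) = F.map (G.src g))
  (ht : ∀ g, D.tgt (f g) = F.map (G.tgt g))

/-- Evaluation of an expression in a precategory `D`, given the values of the cells of `C` and of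
the generators. -/
noncomputable def Tm.eval : ∀ {x y : C.cell n}, Tm G x y →
    {d : D.cell (n + 1) // D.src d = F.map x ∧ D.tgt d = F.map y}
  | _, _, .gen g => ⟨f g, hs g, ht g⟩
  | _, _, .ident x => ⟨D.ident hm (F.map x), D.src_ident hm _, D.tgt_ident hm _⟩
  | _, _, .comp t t' =>
    have h := NPrecategory.exists_comp_of_eq t.eval.1 t'.eval.1
      (t.eval.2.2.trans t'.eval.2.1.symm)
    ⟨h.choose, h.choose_spec.2.1.trans t.eval.2.1, h.choose_spec.2.2.trans t'.eval.2.2⟩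
  | _, _, .left a t hx hy =>
    have h := NPrecategory.exists_comp_left (F.map a) t.eval.1
      (t.eval.2.1.symm ▸ F.map_isComp hx) (t.eval.2.2.symm ▸ F.map_isComp hy)
    ⟨h.choose, h.choose_spec.2⟩
  | _, _, .right a t hx hy =>
    have h := NPrecategory.exists_comp_right (F.map a) t.eval.1
      (t.eval.2.1.symm ▸ F.map_isComp hx) (t.eval.2.2.symm ▸ F.map_isComp hy)
    ⟨h.choose, h.choose_spec.2⟩

theorem Tm.isComp_eval {x y z : C.cell n} (t : Tm G x y) (t' : Tm G y z) :
    D.IsComp (t.eval F hm f hs ht).1 (t'.eval F hm f hs ht).1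
      ((Tm.comp t t').eval F hm f hs ht).1 :=
  (NPrecategory.exists_comp_of_eq (t.eval F hm f hs ht).1 (t'.eval F hm f hs ht).1
      ((t.eval F hm f hs ht).2.2.trans (t'.eval F hm f hs ht).2.1.symm)).choose_spec.1

theorem Tm.isComp_eval_left {k : ℕ} (a : C.cell k) {x y x' y' : C.cell n} (t : Tm G x y)
    (hx : C.IsComp a x x') (hy : C.IsComp a y y') :
    D.IsComp (F.map a) (t.eval F hm f hs ht).1 ((Tm.left a t hx hy).eval F hm f hs ht).1 :=
  (NPrecategory.exists_comp_left (F.map a) (t.eval F hm f hs ht).1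
    ((t.eval F hm f hs ht).2.1.symm ▸ F.map_isComp hx)
    ((t.eval F hm f hs ht).2.2.symm ▸ F.map_isComp hy)).choose_spec.1

theorem Tm.isComp_eval_right {k : ℕ} (a : C.cell k) {x y x' y' : C.cell n} (t : Tm G x y)
    (hx : C.IsComp x a x') (hy : C.IsComp y a y') :
    D.IsComp (t.eval F hm f hs ht).1 (F.map a) ((Tm.right a t hx hy).eval F hm f hs ht).1 :=
  (NPrecategory.exists_comp_right (F.map a) (t.eval F hm f hs ht).1
    ((t.eval F hm f hs ht).2.1.symm ▸ F.map_isComp hx)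
    ((t.eval F hm f hs ht).2.2.symm ▸ F.map_isComp hy)).choose_spec.1

theorem Rel.eval_eq {x y : C.cell n} {t t' : Tm G x y} (h : Rel t t') :
    (t.eval F hm f hs ht).1 = (t'.eval F hm f hs ht).1 := by
  have L := @Tm.isComp_eval_left n C G m D F hm f hs ht
  have R := @Tm.isComp_eval_right n C G m D F hm f hs ht
  have K := @Tm.isComp_eval n C G m D F hm f hs ht
  induction h with
  | comp_congr_left t' _ ih => exact (K ..).unique (ih ▸ K _ t')
  | comp_congr_right t _ ih => exact (K ..).unique (ih ▸ K t _)
  | left_congr a hx hy _ ih => exact (L ..).unique (ih ▸ L a _ hx hy)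
  | right_congr a hx hy _ ih => exact (R ..).unique (ih ▸ R a _ hx hy)
  | ident_comp t => exact NPrecategory.ident_isComp_le hm (K (.ident _) t)
  | comp_ident t => exact NPrecategory.isComp_ident_le hm (K t (.ident _))
  | left_ident a hx hy =>
    exact NPrecategory.isComp_ident_gt hm hm (L a (.ident _) hx hy) (F.map_isComp hx)
      (dim_le a)
  | right_ident a hx hy =>
    exact NPrecategory.ident_isComp_gt hm hm (R a (.ident _) hx hy) (F.map_isComp hx)
      (dim_le a)
  | ident_left hk a t hx hy =>
    exact NPrecategory.ident_isComp_le (hk.trans F.le) (F.map_ident hk a ▸ L _ t hx hy)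
  | ident_right hk a t hx hy =>
    exact NPrecategory.isComp_ident_le (hk.trans F.le) (F.map_ident hk a ▸ R _ t hx hy)
  | assoc t t' t'' =>
    exact NPrecategory.assoc_eq (K t t') (K t' t'') (K ..) (K ..) rfl rfl rfl
  | @left_left k a b ab hab x y x₁ y₁ x₂ y₂ t hx₁ hy₁ hx₂ hy₂ hx hy =>
    have := dim_le a
    exact NPrecategory.assoc_eq (F.map_isComp hab) (L b t hx₁ hy₁) (L ..) (L ..)
      (by omega) (by omega) (by omega)
  | @right_right k a b ab hab x y x₁ y₁ x₂ y₂ t hx₁ hy₁ hx₂ hy₂ hx hy =>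
    have := dim_le a
    exact NPrecategory.assoc_eq (R a t hx₁ hy₁) (F.map_isComp hab) (R ..) (R ..)
      (by omega) (by omega) (by omega)
  | @left_right k a b x y x₁ y₁ x₂ y₂ x₃ y₃ t hx₁ hy₁ hx₂ hy₂ hx₁' hy₁' hx₂' hy₂' =>
    have := dim_le a
    exact NPrecategory.assoc_eq (L a t hx₁ hy₁) (R b t hx₁' hy₁') (R ..) (L ..)
      (by omega) (by omega) (by omega)
  | left_comp a t t' hx hy hz =>
    have := dim_le a
    exact NPrecategory.comp_distrib_eq (K t t') (L ..) (L a t hx hy) (L a t' hy hz) (K ..)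
      (by omega) (by omega)
  | right_comp a t t' hx hy hz =>
    have := dim_le a
    exact NPrecategory.distrib_comp_eq (K t t') (R ..) (R a t hx hy) (R a t' hy hz) (K ..)
      (by omega) (by omega)
  | @left_distrib_left k l hkl a b ab hab x y x₁ y₁ x₂ y₂ x₃ y₃ t hx₁ hy₁ _ _ hx₁' hy₁' =>
    have := dim_le b
    exact NPrecategory.comp_distrib_eq (L b t hx₁ hy₁) (L ..) (F.map_isComp hab)
      (L a t hx₁' hy₁') (L ..) (by omega) (by omega)
  | @left_distrib_right k l hkl a b ab hab x y x₁ y₁ x₂ y₂ x₃ y₃ t hx₁ hy₁ _ _ hx₁' hy₁' =>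
    have := dim_le b
    exact NPrecategory.comp_distrib_eq (R b t hx₁ hy₁) (L ..) (L a t hx₁' hy₁')
      (F.map_isComp hab) (R ..) (by omega) (by omega)
  | @right_distrib_left k l hkl a b ab hab x y x₁ y₁ x₂ y₂ x₃ y₃ t hx₁ hy₁ _ _ hx₁' hy₁' =>
    have := dim_le b
    exact NPrecategory.distrib_comp_eq (L b t hx₁ hy₁) (R ..) (F.map_isComp hab)
      (R a t hx₁' hy₁') (L ..) (by omega) (by omega)
  | @right_distrib_right k l hkl a b ab hab x y x₁ y₁ x₂ y₂ x₃ y₃ t hx₁ hy₁ _ _ hx₁' hy₁' =>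
    have := dim_le b
    exact NPrecategory.distrib_comp_eq (R b t hx₁ hy₁) (R ..) (R a t hx₁' hy₁')
      (F.map_isComp hab) (R ..) (by omega) (by omega)

/-- The map on cells underlying `lift`. -/
noncomputable def FreeCell.eval : ∀ {k : ℕ}, FreeCell G k → D.cell k
  | _, .low c => F.map c
  | _, .top q => Quot.lift (fun t => (t.eval F hm f hs ht).1)
      (fun _ _ h => h.eval_eq F hm f hs ht) q

/-- The universal property of the free extension: a prefunctor on `C` and a compatible map on
generators extend to the free extension. -/
noncomputable def lift : NPrefunctor G.free D where
  le := hm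
  map := FreeCell.eval F hm f hs ht
  map_src x := by
    cases x with
    | low c => exact F.map_src c
    | top q => obtain ⟨t⟩ := q; exact (t.eval F hm f hs ht).2.1.symm
  map_tgt x := by
    cases x with
    | low c => exact F.map_tgt c
    | top q => obtain ⟨t⟩ := q; exact (t.eval F hm f hs ht).2.2.symm
  map_ident {k} hk x := by
    cases x with
    | low c =>
      obtain h | rfl := lt_or_eq_of_ident hk
      · exact (congrArg (FreeCell.eval F hm f hs ht) (ident_low hk h c)).trans (F.map_ident h c)
      · exact congrArg (FreeCell.eval F hm f hs ht) (ident_top hk c)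
    | top q => norm_cast at hk; omega
  map_comp {i k l p} hi hp x y h h' := by
    cases x with
    | low a =>
      cases y with
      | low b => exact F.map_comp hi hp a b _ _
      | top q =>
        have := dim_le a
        obtain rfl : p = n + 1 := by omega
        obtain ⟨x', y', hx, hy⟩ := exists_left hi h
        refine (congrArg _ (comp_low_top hi hp a q h hx hy)).trans ?_
        obtain ⟨t⟩ := q
        exact (t.isComp_eval_left F hm f hs ht a hx hy).unique ⟨i, hi, hp, h', rfl⟩
    | top q =>
      cases y with
      | low a =>
        have := dim_le a
        obtain rfl : p = n + 1 := by omega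
        obtain ⟨x', y', hx, hy⟩ := exists_right hi h
        refine (congrArg _ (comp_top_low hi hp a q h hx hy)).trans ?_
        obtain ⟨t⟩ := q
        exact (t.isComp_eval_right F hm f hs ht a hx hy).unique ⟨i, hi, hp, h', rfl⟩
      | top q' =>
        obtain rfl : p = n + 1 := by omega
        obtain rfl := (composable_top_top hi).1 h
        refine (congrArg _ (comp_top_top hi hp q q' h)).trans ?_
        obtain ⟨t⟩ := q
        obtain ⟨t'⟩ := q'
        exact (t.isComp_eval F hm f hs ht t').unique ⟨i, hi, hp, h', rfl⟩

theorem lift_incl {k : ℕ} (c : C.cell k) :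
    (lift F hm f hs ht).map (G.incl.map c) = F.map c := rfl

theorem lift_inj (g : G.gen) : (lift F hm f hs ht).map (G.inj g) = f g := rfl

end lift

/-- The uniqueness part of the universal property of the free extension. -/
theorem lift_unique {m : ℕ∞} {D : NPrecategory.{u} m} (H H' : NPrefunctor G.free D)
    (hC : ∀ {k : ℕ} (c : C.cell k), H.map (G.incl.map c) = H'.map (G.incl.map c))
    (hG : ∀ g, H.map (G.inj g) = H'.map (G.inj g)) {k : ℕ} (x : G.free.cell k) :
    H.map x = H'.map x := by
  cases x with
  | low c => exact hC c
  | top q =>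
    obtain ⟨t⟩ := q
    clear q
    have hmax : n + 1 = max (n + 1) (n + 1) := by omega
    have hmin : n + 1 = min (n + 1) (n + 1) := by omega
    induction t with
    | gen g => exact hG g
    | ident x =>
      have e : (FreeCell.top (Quot.mk _ (.ident x)) : FreeCell G (n + 1)) =
        G.free.ident le_rfl (FreeCell.low x) := (ident_top le_rfl x).symm
      exact (congrArg H.map e).trans ((H.map_ident le_rfl _).trans ((congrArg _ (hC x)).trans
        ((H'.map_ident le_rfl _).symm.trans (congrArg H'.map e.symm))))
    | comp t t' h h' =>
      have hc : G.free.IsComp (FreeCell.top (Quot.mk _ t)) (FreeCell.top (Quot.mk _ t'))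
          (FreeCell.top (Quot.mk _ (t.comp t'))) :=
        ⟨n, hmin, hmax, (composable_top_top hmin).2 rfl, rfl⟩
      have e := H.map_isComp hc
      rw [h, h'] at e
      exact e.unique (H'.map_isComp hc)
    | @left k a x y x' y' t hx hy h =>
      have := dim_le a
      have d := hx.dim
      obtain ⟨i, rfl⟩ : ∃ i, k = i + 1 := ⟨k - 1, by omega⟩
      have hi : i + 1 = min (i + 1) (n + 1) := by omega
      have hm : n + 1 = max (i + 1) (n + 1) := by omega
      have hi' : i + 1 = min (i + 1) n := by omega
      have hx' := (composable_low_top (q := Quot.mk _ t) hi hi').2 (hx.eq hi' d.2.2).choose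
      have hc : G.free.IsComp (FreeCell.low a) (FreeCell.top (Quot.mk _ t))
          (FreeCell.top (Quot.mk _ (t.left a hx hy))) :=
        ⟨i, hi, hm, hx', comp_low_top hi hm a (Quot.mk _ t) hx' hx hy⟩
      have e := H.map_isComp hc
      rw [h, hC a] at e
      exact e.unique (H'.map_isComp hc)
    | @right k a x y x' y' t hx hy h =>
      have := dim_le a
      have d := hx.dim
      obtain ⟨i, rfl⟩ : ∃ i, k = i + 1 := ⟨k - 1, by omega⟩
      have hi : i + 1 = min (n + 1) (i + 1) := by omega
      have hm : n + 1 = max (n + 1) (i + 1) := by omega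
      have hi' : i + 1 = min n (i + 1) := by omega
      have hy' := (composable_top_low (q := Quot.mk _ t) hi hi').2 (hy.eq hi' d.2.2).choose
      have hc : G.free.IsComp (FreeCell.top (Quot.mk _ t)) (FreeCell.low a)
          (FreeCell.top (Quot.mk _ (t.right a hx hy))) :=
        ⟨i, hi, hm, hy', comp_top_low hi hm a (Quot.mk _ t) hy' hx hy⟩
      have e := H.map_isComp hc
      rw [h, hC a] at e
      exact e.unique (H'.map_isComp hc)

/-- The prefunctor between free extensions induced by a prefunctor `F` and a map `f` between the
generators. -/
noncomputable def freeMap {D : NPrecategory.{u} n} {H : CellExtension D} (F : NPrefunctor C D)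
    (f : G.gen → H.gen) (hs : ∀ g, H.src (f g) = F.map (G.src g))
    (ht : ∀ g, H.tgt (f g) = F.map (G.tgt g)) : NPrefunctor G.free H.free :=
  lift (F.comp H.incl) le_rfl (fun g => H.inj (f g)) (fun g => congrArg FreeCell.low (hs g))
    (fun g => congrArg FreeCell.low (ht g))

end CellExtension

/-- `F` identifies the `n`-precategory `C` with the `n`-truncation of `D`. -/
def NPrefunctor.IsTruncation {n m : ℕ∞} {C : NPrecategory.{u} n} {D : NPrecategory.{u} m}
    (F : NPrefunctor C D) : Prop :=
  ∀ k : ℕ, (k : ℕ∞) ≤ n → Function.Bijective (F.map (k := k))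

/-- A sequence of `n`-precategories for `n : ℕ`, each being identified with the truncation of the
next one. -/
structure PrecategoryTower where
  obj : ∀ n : ℕ, NPrecategory.{u} n
  incl : ∀ n : ℕ, NPrefunctor (obj n) (obj (n + 1))
  isTruncation : ∀ n : ℕ, (incl n).IsTruncation

namespace PrecategoryTower

variable (T : PrecategoryTower.{u})

/-- The inclusion of the `k`-th precategory of the sequence in the `m`-th one. -/
def up {k m : ℕ} (h : k ≤ m) : NPrefunctor (T.obj k) (T.obj m) :=
  Nat.leRec (motive := fun m _ => NPrefunctor (T.obj k) (T.obj m)) (.id _)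
    (fun m _ F => F.comp (T.incl m)) h

theorem up_self {k : ℕ} (h : k ≤ k) : T.up h = .id _ := by
  simp [up, Nat.leRec_self]

theorem up_succ {k m : ℕ} (h : k ≤ m) (h' : k ≤ m + 1) : T.up h' = (T.up h).comp (T.incl m) := by
  simp [up, Nat.leRec_succ _ _ h]

theorem up_trans {k l m : ℕ} (h : k ≤ l) (h' : l ≤ m) {j : ℕ} (x : (T.obj k).cell j) :
    (T.up h').map ((T.up h).map x) = (T.up (h.trans h')).map x := by
  induction m, h' using Nat.le_induction with
  | base => rw [up_self]; rfl
  | succ m h' ih =>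
    rw [T.up_succ h', T.up_succ (h.trans h')]
    exact congrArg _ ih

theorem up_incl {k m : ℕ} (h : k + 1 ≤ m) {j : ℕ} (x : (T.obj k).cell j) :
    (T.up h).map ((T.incl k).map x) = (T.up (Nat.le_of_succ_le h)).map x := by
  rw [← T.up_trans (Nat.le_succ k) h, T.up_succ le_rfl, up_self]
  rfl

theorem up_injective {k m : ℕ} (h : k ≤ m) {j : ℕ} (hj : j ≤ k) :
    Function.Injective ((T.up h).map (k := j)) := by
  induction m, h using Nat.le_induction with
  | base => rw [up_self]; exact fun _ _ h => h
  | succ m h ih =>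
    rw [T.up_succ h]
    exact ((T.isTruncation m j (by exact_mod_cast hj.trans h)).1).comp ih

/-- The inverse of `T.incl k` on `k`-cells. -/
noncomputable def down {k : ℕ} (x : (T.obj (k + 1)).cell k) : (T.obj k).cell k :=
  ((T.isTruncation k k le_rfl).2 x).choose

theorem incl_down {k : ℕ} (x : (T.obj (k + 1)).cell k) : (T.incl k).map (T.down x) = x :=
  ((T.isTruncation k k le_rfl).2 x).choose_spec

theorem up_down {k m : ℕ} (h : k + 1 ≤ m) (x : (T.obj (k + 1)).cell k) :
    (T.up (Nat.le_of_succ_le h)).map (T.down x) = (T.up h).map x := by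
  rw [← T.up_incl h, incl_down]

/-- The underlying globular set of the limit of a tower: its `k`-cells are those of the `k`-th
precategory of the tower. -/
@[reducible] noncomputable def limitGlob : GlobularSet.{u} ⊤ where
  cell k := (T.obj k).cell k
  cell_isEmpty k hk := (not_top_lt hk).elim
  src x := T.down ((T.obj _).src x)
  tgt x := T.down ((T.obj _).tgt x)
  src_src x := by
    apply T.up_injective (Nat.le_add_right _ 2) le_rfl
    rw [T.up_down (Nat.le_succ _), T.up_down (Nat.le_succ _), NPrefunctor.map_src,
      NPrefunctor.map_src, T.up_down le_rfl, T.up_down le_rfl, up_self]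
    exact (T.obj _).src_src x
  tgt_src x := by
    apply T.up_injective (Nat.le_add_right _ 2) le_rfl
    rw [T.up_down (Nat.le_succ _), T.up_down (Nat.le_succ _), NPrefunctor.map_tgt,
      NPrefunctor.map_tgt, T.up_down le_rfl, T.up_down le_rfl, up_self]
    exact (T.obj _).tgt_src x

theorem up_src {k m : ℕ} (h : k + 1 ≤ m) (x : (T.obj (k + 1)).cell (k + 1)) :
    (T.up (Nat.le_of_succ_le h)).map (T.limitGlob.src x) = (T.obj m).src ((T.up h).map x) := by
  rw [← NPrefunctor.map_src]
  exact T.up_down h _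

theorem up_tgt {k m : ℕ} (h : k + 1 ≤ m) (x : (T.obj (k + 1)).cell (k + 1)) :
    (T.up (Nat.le_of_succ_le h)).map (T.limitGlob.tgt x) = (T.obj m).tgt ((T.up h).map x) := by
  rw [← NPrefunctor.map_tgt]
  exact T.up_down h _

theorem up_srcAt {i k m : ℕ} (hi : i ≤ k) (h : k ≤ m) (x : (T.obj k).cell k) :
    (T.up (hi.trans h)).map (T.limitGlob.srcAt hi x) = (T.obj m).srcAt hi ((T.up h).map x) := by
  induction k, hi using Nat.le_induction with
  | base =>
    rw [(T.obj m).srcAt_self]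
    exact congrArg _ (T.limitGlob.srcAt_self _ x)
  | succ k hi ih =>
    rw [(T.obj m).srcAt_succ hi, ← T.up_src h, ← ih]
    exact congrArg _ (T.limitGlob.srcAt_succ hi _ x)

theorem up_tgtAt {i k m : ℕ} (hi : i ≤ k) (h : k ≤ m) (x : (T.obj k).cell k) :
    (T.up (hi.trans h)).map (T.limitGlob.tgtAt hi x) = (T.obj m).tgtAt hi ((T.up h).map x) := by
  induction k, hi using Nat.le_induction with
  | base =>
    rw [(T.obj m).tgtAt_self]
    exact congrArg _ (T.limitGlob.tgtAt_self _ x)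
  | succ k hi ih =>
    rw [(T.obj m).tgtAt_succ hi, ← T.up_tgt h, ← ih]
    exact congrArg _ (T.limitGlob.tgtAt_succ hi _ x)

theorem composable_up {i k l m : ℕ} (hi : i + 1 = min k l) (hk : k ≤ m) (hl : l ≤ m)
    {x : (T.obj k).cell k} {y : (T.obj l).cell l} :
    T.limitGlob.Composable hi x y ↔
      (T.obj m).Composable hi ((T.up hk).map x) ((T.up hl).map y) := by
  constructor
  · intro h
    rw [GlobularSet.Composable, ← T.up_tgtAt, ← T.up_srcAt]
    exact congrArg _ h
  · intro h
    apply T.up_injective ((le_left_of_min hi).trans hk) le_rfl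
    exact (T.up_tgtAt _ hk x).trans (h.trans (T.up_srcAt _ hl y).symm)

noncomputable def limitComp {i k l m : ℕ} (hi : i + 1 = min k l) (hm : m = max k l)
    (x : (T.obj k).cell k) (y : (T.obj l).cell l) (h : T.limitGlob.Composable hi x y) :
    (T.obj m).cell m :=
  (T.obj m).comp hi hm ((T.up (by omega)).map x) ((T.up (by omega)).map y)
    ((T.composable_up hi _ _).1 h)

theorem isComp_up {i k l m N : ℕ} (hi : i + 1 = min k l) (hm : m = max k l)
    (x : (T.obj k).cell k) (y : (T.obj l).cell l) (h : T.limitGlob.Composable hi x y)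
    (hk : k ≤ N) (hl : l ≤ N) (hmN : m ≤ N) :
    (T.obj N).IsComp ((T.up hk).map x) ((T.up hl).map y)
      ((T.up hmN).map (T.limitComp hi hm x y h)) := by
  have := (T.up hmN).map_isComp (NPrecategory.isComp_comp (C := T.obj m) hi hm _ _
    ((T.composable_up hi (by omega) (by omega)).1 h))
  rwa [up_trans, up_trans] at this

theorem isComp_self {i k l m : ℕ} (hi : i + 1 = min k l) (hm : m = max k l)
    (x : (T.obj k).cell k) (y : (T.obj l).cell l) (h : T.limitGlob.Composable hi x y) :
    (T.obj m).IsComp ((T.up (by omega : k ≤ m)).map x) ((T.up (by omega : l ≤ m)).map y)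
      (T.limitComp hi hm x y h) :=
  NPrecategory.isComp_comp _ _ _ _ _

def limitIdent {k : ℕ} (x : (T.obj k).cell k) : (T.obj (k + 1)).cell (k + 1) :=
  (T.obj (k + 1)).ident le_rfl ((T.incl k).map x)

theorem up_ident {k m : ℕ} (h : k + 1 ≤ m) (hk : ((k + 1 : ℕ) : ℕ∞) ≤ m) (x : (T.obj k).cell k) :
    (T.up h).map (T.limitIdent x) =
      (T.obj m).ident hk ((T.up (Nat.le_of_succ_le h)).map x) := by
  rw [limitIdent, NPrefunctor.map_ident, up_incl]

/-- The `ω`-precategory defined by a tower. -/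
@[reducible] noncomputable def limit : NPrecategory.{u} ⊤ where
  toGlobularSet := T.limitGlob
  ident _ x := T.limitIdent x
  comp := T.limitComp
  src_ident {k} hk x := by
    apply T.up_injective (Nat.le_add_right _ 1) le_rfl
    rw [T.up_src le_rfl, T.up_ident le_rfl le_rfl, (T.obj _).src_ident]
  tgt_ident {k} hk x := by
    apply T.up_injective (Nat.le_add_right _ 1) le_rfl
    rw [T.up_tgt le_rfl, T.up_ident le_rfl le_rfl, (T.obj _).tgt_ident]
  src_comp_lt {i k l m} hi hm hi' hm' u v h h' hkl := by
    apply T.up_injective (Nat.le_add_right _ 1) le_rfl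
    rw [T.up_src le_rfl]
    have e := T.isComp_up hi' hm' u _ h' (N := m + 1) (by omega) (by omega) (by omega)
    rw [T.up_src (by omega)] at e
    exact (T.isComp_up hi hm u v h (by omega) (by omega) le_rfl).src_of_lt e hkl
  tgt_comp_lt {i k l m} hi hm hi' hm' u v h h' hkl := by
    apply T.up_injective (Nat.le_add_right _ 1) le_rfl
    rw [T.up_tgt le_rfl]
    have e := T.isComp_up hi' hm' u _ h' (N := m + 1) (by omega) (by omega) (by omega)
    rw [T.up_tgt (by omega)] at e
    exact (T.isComp_up hi hm u v h (by omega) (by omega) le_rfl).tgt_of_lt e hkl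
  src_comp_eq {i k} hi hm u v h := by
    apply T.up_injective (Nat.le_add_right _ 1) le_rfl
    rw [T.up_src le_rfl, T.up_src le_rfl]
    exact (T.isComp_up hi hm u v h le_rfl le_rfl le_rfl).src_of_eq
  tgt_comp_eq {i k} hi hm u v h := by
    apply T.up_injective (Nat.le_add_right _ 1) le_rfl
    rw [T.up_tgt le_rfl, T.up_tgt le_rfl]
    exact (T.isComp_up hi hm u v h le_rfl le_rfl le_rfl).tgt_of_eq
  src_comp_gt {i k l m} hi hm hi' hm' u v h h' hkl := by
    apply T.up_injective (Nat.le_add_right _ 1) le_rfl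
    rw [T.up_src le_rfl]
    have e := T.isComp_up hi' hm' _ v h' (N := m + 1) (by omega) (by omega) (by omega)
    rw [T.up_src (by omega)] at e
    exact (T.isComp_up hi hm u v h (by omega) (by omega) le_rfl).src_of_gt e hkl
  tgt_comp_gt {i k l m} hi hm hi' hm' u v h h' hkl := by
    apply T.up_injective (Nat.le_add_right _ 1) le_rfl
    rw [T.up_tgt le_rfl]
    have e := T.isComp_up hi' hm' _ v h' (N := m + 1) (by omega) (by omega) (by omega)
    rw [T.up_tgt (by omega)] at e
    exact (T.isComp_up hi hm u v h (by omega) (by omega) le_rfl).tgt_of_gt e hkl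
  ident_comp_le {i k l} hk hi hm u v h := by
    have hkl : ((k + 1 : ℕ) : ℕ∞) ≤ l := by norm_cast; omega
    apply T.up_injective le_rfl le_rfl
    have e := T.isComp_up hi hm _ v h (N := l) (by omega) le_rfl le_rfl
    rw [T.up_ident (by omega) hkl] at e
    exact NPrecategory.ident_isComp_le hkl e
  ident_comp_gt {i k l m} hk hmn hi hm hi' hm' u v h h' hlk := by
    apply T.up_injective le_rfl le_rfl
    have hkm : ((k + 1 : ℕ) : ℕ∞) ≤ ((m + 1 : ℕ) : ℕ∞) := by norm_cast; omega
    have e := T.isComp_up hi hm _ v h (N := m + 1) (by omega) (by omega) le_rfl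
    rw [T.up_ident (by omega) hkm] at e
    rw [T.up_ident le_rfl le_rfl]
    exact NPrecategory.ident_isComp_gt _ _ e (T.isComp_up hi' hm' u v h' _ _ _) (by omega)
  comp_ident_le {i k l} hl hi hm u v h := by
    have hlk : ((l + 1 : ℕ) : ℕ∞) ≤ k := by norm_cast; omega
    apply T.up_injective le_rfl le_rfl
    have e := T.isComp_up hi hm u _ h (N := k) le_rfl (by omega) le_rfl
    rw [T.up_ident (by omega) hlk] at e
    exact NPrecategory.isComp_ident_le hlk e
  comp_ident_gt {i k l m} hk hmn hi hm hi' hm' u v h h' hlk := by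
    apply T.up_injective le_rfl le_rfl
    have hkm : ((l + 1 : ℕ) : ℕ∞) ≤ ((m + 1 : ℕ) : ℕ∞) := by norm_cast; omega
    have e := T.isComp_up hi hm u _ h (N := m + 1) (by omega) (by omega) le_rfl
    rw [T.up_ident (by omega) hkm] at e
    rw [T.up_ident le_rfl le_rfl]
    exact NPrecategory.isComp_ident_gt _ _ e (T.isComp_up hi' hm' u v h' _ _ _) (by omega)
  assoc {i k l m p q r} hkl hlm hp hq hpm hkq hr hr' u v w huv hvw h h' := by
    apply T.up_injective le_rfl le_rfl
    exact NPrecategory.assoc_eq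
      (T.isComp_up hkl hp u v huv (by omega) (by omega) (by omega))
      (T.isComp_up hlm hq v w hvw (by omega) (by omega) (by omega))
      (T.isComp_up hpm hr _ w h (by omega) (by omega) (by omega))
      (T.isComp_up hkq hr' u _ h' (by omega) (by omega) (by omega))
      (by omega) (by omega) (by omega)
  comp_distrib {i j k l l' m p p' q} hj hm hi hq hi₁ hp hi₂ hp' hj' hq' u v v' hvv' h huv huv' h'
      hij := by
    apply T.up_injective le_rfl le_rfl
    exact NPrecategory.comp_distrib_eq
      (T.isComp_up hj hm v v' hvv' (by omega) (by omega) (by omega))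
      (T.isComp_up hi hq u _ h (by omega) (by omega) (by omega))
      (T.isComp_up hi₁ hp u v huv (by omega) (by omega) (by omega))
      (T.isComp_up hi₂ hp' u v' huv' (by omega) (by omega) (by omega))
      (T.isComp_up hj' hq' _ _ h' (by omega) (by omega) (by omega))
      (by omega) (by omega)
  distrib_comp {i j k l l' m p p' q} hj hm hi hq hi₁ hp hi₂ hp' hj' hq' v v' u hvv' h huv huv' h'
      hij := by
    apply T.up_injective le_rfl le_rfl
    exact NPrecategory.distrib_comp_eq
      (T.isComp_up hj hm v v' hvv' (by omega) (by omega) (by omega))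
      (T.isComp_up hi hq _ u h (by omega) (by omega) (by omega))
      (T.isComp_up hi₁ hp v u huv (by omega) (by omega) (by omega))
      (T.isComp_up hi₂ hp' v' u huv' (by omega) (by omega) (by omega))
      (T.isComp_up hj' hq' _ _ h' (by omega) (by omega) (by omega))
      (by omega) (by omega)

/-- The `ω`-prefunctor induced by a family of prefunctors that are compatible with the
inclusions. -/
noncomputable def limitMap {T T' : PrecategoryTower.{u}}
    (F : ∀ n, NPrefunctor (T.obj n) (T'.obj n))
    (hF : ∀ n {k : ℕ} (x : (T.obj n).cell k),
      (F (n + 1)).map ((T.incl n).map x) = (T'.incl n).map ((F n).map x)) :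
    NPrefunctor T.limit T'.limit :=
  have hup : ∀ {k m : ℕ} (h : k ≤ m) {j : ℕ} (x : (T.obj k).cell j),
      (F m).map ((T.up h).map x) = (T'.up h).map ((F k).map x) := by
    intro k m h j x
    induction m, h using Nat.le_induction with
    | base => rw [up_self, up_self]; rfl
    | succ m h ih =>
      rw [T.up_succ h, T'.up_succ h]
      exact (hF m _).trans (congrArg _ ih)
  { le := le_rfl
    map := fun {k} x => (F k).map x
    map_src := fun {k} x => by
      apply T'.up_injective (Nat.le_add_right _ 1) le_rfl
      rw [T'.up_src le_rfl, ← hup, ← hup, T.up_src le_rfl, NPrefunctor.map_src]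
    map_tgt := fun {k} x => by
      apply T'.up_injective (Nat.le_add_right _ 1) le_rfl
      rw [T'.up_tgt le_rfl, ← hup, ← hup, T.up_tgt le_rfl, NPrefunctor.map_tgt]
    map_ident := fun {k} hk x => by
      exact ((F (k + 1)).map_ident le_rfl _).trans (congrArg _ (hF k x))
    map_comp := fun {i k l p} hi hp x y h h' => by
      have e := (F p).map_isComp (T.isComp_self hi hp x y h)
      rw [hup, hup] at e
      exact e.unique (T'.isComp_self hi hp _ _ h') }

end PrecategoryTower

/-- The cells of a set seen as a `0`-precategory. -/
def DiscreteCell (X : Type u) : ℕ → Type u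
  | 0 => X
  | _ + 1 => PEmpty

theorem DiscreteCell.false {X : Type u} {k : ℕ} (hk : 0 < k) (x : DiscreteCell X k) : False := by
  obtain _ | k := k
  · exact lt_irrefl _ hk
  · exact PEmpty.elim x

theorem DiscreteCell.not_le {k : ℕ} (hk : ((k + 1 : ℕ) : ℕ∞) ≤ ((0 : ℕ) : ℕ∞)) : False := by
  norm_cast at hk

/-- The `0`-precategory on a set. -/
@[reducible] def NPrecategory.discrete (X : Type u) : NPrecategory.{u} ((0 : ℕ) : ℕ∞) where
  cell := DiscreteCell X
  cell_isEmpty _ hk := ⟨fun x => x.false (by exact_mod_cast hk)⟩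
  src x := (DiscreteCell.false (Nat.succ_pos _) x).elim
  tgt x := (DiscreteCell.false (Nat.succ_pos _) x).elim
  src_src x := (DiscreteCell.false (Nat.succ_pos _) x).elim
  tgt_src x := (DiscreteCell.false (Nat.succ_pos _) x).elim
  ident hk _ := (DiscreteCell.not_le hk).elim
  comp hi _ u _ _ := (DiscreteCell.false (by omega) u).elim
  src_ident hk _ := (DiscreteCell.not_le hk).elim
  tgt_ident hk _ := (DiscreteCell.not_le hk).elim
  src_comp_lt _ _ hi _ u _ _ _ _ := (DiscreteCell.false (by omega) u).elim
  tgt_comp_lt _ _ hi _ u _ _ _ _ := (DiscreteCell.false (by omega) u).elim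
  src_comp_eq _ _ u _ _ := (DiscreteCell.false (by omega) u).elim
  tgt_comp_eq _ _ u _ _ := (DiscreteCell.false (by omega) u).elim
  src_comp_gt _ _ _ _ u _ _ _ _ := (DiscreteCell.false (by omega) u).elim
  tgt_comp_gt _ _ _ _ u _ _ _ _ := (DiscreteCell.false (by omega) u).elim
  ident_comp_le hk _ _ _ _ _ := (DiscreteCell.not_le hk).elim
  ident_comp_gt hk _ _ _ _ _ _ _ _ _ _ := (DiscreteCell.not_le hk).elim
  comp_ident_le hk _ _ _ _ _ := (DiscreteCell.not_le hk).elim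
  comp_ident_gt hk _ _ _ _ _ _ _ _ _ _ := (DiscreteCell.not_le hk).elim
  assoc hi _ _ _ _ _ _ _ u _ _ _ _ _ _ := (DiscreteCell.false (by omega) u).elim
  comp_distrib _ _ hi _ _ _ _ _ _ _ u _ _ _ _ _ _ _ _ := (DiscreteCell.false (by omega) u).elim
  distrib_comp _ _ _ _ hi _ _ _ _ _ u _ _ _ _ _ _ _ _ := (DiscreteCell.false (by omega) u).elim

/-- The prefunctor between `0`-precategories induced by a map. -/
@[reducible] def NPrefunctor.discrete {X Y : Type u} (f : X → Y) :
    NPrefunctor (NPrecategory.discrete X) (NPrecategory.discrete Y) where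
  le := le_rfl
  map {k} x := match k, x with
    | 0, x => f x
    | _ + 1, x => PEmpty.elim x
  map_src x := PEmpty.elim x
  map_tgt x := PEmpty.elim x
  map_ident hk _ := (DiscreteCell.not_le hk).elim
  map_comp hi _ x _ _ _ := (DiscreteCell.false (by omega) x).elim

/-- The `n`-polygraphs for `n : ℕ`, together with the `n`-precategories that they freely generate,
by recursion on `n`: a `0`-polygraph is a set, and an `(n+1)`-polygraph is an `n`-polygraph `P`
with a set of `(n+1)`-generators, whose sources and targets are parallel `n`-cells of the free
`n`-precategory on `P`. -/
def finPolygraphAux : (n : ℕ) → Σ P : Type (u + 1), P → NPrecategory.{u} (n : ℕ∞)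
  | 0 => ⟨Type u, fun X => NPrecategory.discrete X⟩
  | n + 1 => ⟨Σ P : (finPolygraphAux n).1, CellExtension ((finPolygraphAux n).2 P),
      fun P => P.2.free⟩

/-- The type of `n`-polygraphs, `n : ℕ`. -/
def FinPolygraph (n : ℕ) : Type (u + 1) := (finPolygraphAux.{u} n).1

namespace FinPolygraph

/-- The `n`-precategory freely generated by an `n`-polygraph. -/
def free {n : ℕ} (P : FinPolygraph.{u} n) : NPrecategory.{u} (n : ℕ∞) := (finPolygraphAux n).2 P

/-- The truncation of an `(n+1)`-polygraph. -/
def trunc {n : ℕ} (P : FinPolygraph.{u} (n + 1)) : FinPolygraph.{u} n := P.1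

/-- The `(n+1)`-generators of an `(n+1)`-polygraph, with their sources and targets. -/
def ext {n : ℕ} (P : FinPolygraph.{u} (n + 1)) : CellExtension P.trunc.free := P.2

theorem free_zero (P : FinPolygraph.{u} 0) : P.free = NPrecategory.discrete P := rfl

theorem free_succ {n : ℕ} (P : FinPolygraph.{u} (n + 1)) : P.free = P.ext.free := rfl

/-- The morphisms between `n`-polygraphs, together with the induced `n`-prefunctors, by recursion
on `n`: a morphism of `(n+1)`-polygraphs is a morphism `F` between the truncations with a map `f`
between the sets of `(n+1)`-generators which is compatible with the sources and targets. -/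
noncomputable def homAux : (n : ℕ) → (P Q : FinPolygraph.{u} n) →
    Σ H : Type u, H → NPrefunctor P.free Q.free
  | 0, P, Q => ⟨(show Type u from P) → (show Type u from Q), fun f => NPrefunctor.discrete f⟩
  | n + 1, P, Q =>
    ⟨Σ F : (homAux n P.trunc Q.trunc).1, {f : P.ext.gen → Q.ext.gen //
        ∀ g, Q.ext.src (f g) = ((homAux n P.trunc Q.trunc).2 F).map (P.ext.src g) ∧
          Q.ext.tgt (f g) = ((homAux n P.trunc Q.trunc).2 F).map (P.ext.tgt g)},
      fun F => CellExtension.freeMap ((homAux n P.trunc Q.trunc).2 F.1) F.2.1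
        (fun g => (F.2.2 g).1) (fun g => (F.2.2 g).2)⟩

/-- Morphisms of `n`-polygraphs, `n : ℕ`. -/
def Hom {n : ℕ} (P Q : FinPolygraph.{u} n) : Type u := (homAux n P Q).1

namespace Hom

/-- The prefunctor between free precategories induced by a morphism of polygraphs. -/
noncomputable def free {n : ℕ} {P Q : FinPolygraph.{u} n} (F : Hom P Q) :
    NPrefunctor P.free Q.free :=
  (homAux n P Q).2 F

/-- The truncation of a morphism of `(n+1)`-polygraphs. -/
def trunc {n : ℕ} {P Q : FinPolygraph.{u} (n + 1)} (F : Hom P Q) : Hom P.trunc Q.trunc := F.1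

/-- The action of a morphism of `(n+1)`-polygraphs on `(n+1)`-generators. -/
def onGen {n : ℕ} {P Q : FinPolygraph.{u} (n + 1)} (F : Hom P Q) : P.ext.gen → Q.ext.gen := F.2.1

theorem src_onGen {n : ℕ} {P Q : FinPolygraph.{u} (n + 1)} (F : Hom P Q) (g : P.ext.gen) :
    Q.ext.src (F.onGen g) = F.trunc.free.map (P.ext.src g) :=
  (F.2.2 g).1

theorem tgt_onGen {n : ℕ} {P Q : FinPolygraph.{u} (n + 1)} (F : Hom P Q) (g : P.ext.gen) :
    Q.ext.tgt (F.onGen g) = F.trunc.free.map (P.ext.tgt g) :=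
  (F.2.2 g).2

theorem free_succ {n : ℕ} {P Q : FinPolygraph.{u} (n + 1)} (F : Hom P Q) :
    F.free = CellExtension.freeMap F.trunc.free F.onGen F.src_onGen F.tgt_onGen := rfl

end Hom

/-- The inclusion of the free `n`-precategory on the truncation of `Q` in the free
`(n+1)`-precategory on `Q`. -/
def incl {n : ℕ} {P : FinPolygraph.{u} n} {Q : FinPolygraph.{u} (n + 1)} (h : Q.trunc = P) :
    NPrefunctor P.free Q.free :=
  h ▸ Q.ext.incl

theorem isTruncation_incl {n : ℕ} {P : FinPolygraph.{u} n} {Q : FinPolygraph.{u} (n + 1)}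
    (h : Q.trunc = P) : (incl h).IsTruncation := by
  subst h
  intro k hk
  refine ⟨fun x y e => CellExtension.low_inj.1 e, fun x => ?_⟩
  change CellExtension.FreeCell Q.ext k at x
  cases x with
  | low c => exact ⟨c, rfl⟩
  | top q => norm_cast at hk; omega

theorem Hom.free_incl {n : ℕ} {P Q : FinPolygraph.{u} n} {P' Q' : FinPolygraph.{u} (n + 1)}
    (hP : P'.trunc = P) (hQ : Q'.trunc = Q) (F : Hom P Q) (F' : Hom P' Q')
    (h : HEq F'.trunc F) {k : ℕ} (x : P.free.cell k) :
    F'.free.map ((incl hP).map x) = (incl hQ).map (F.free.map x) := by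
  subst hP hQ
  obtain rfl := eq_of_heq h
  rfl

end FinPolygraph

/-- An `ω`-polygraph: a sequence of `n`-polygraphs for `n : ℕ`, each being the truncation of the
next one. -/
structure OmegaPolygraph : Type (u + 1) where
  stage : ∀ n : ℕ, FinPolygraph.{u} n
  trunc_stage : ∀ n : ℕ, (stage (n + 1)).trunc = stage n

namespace OmegaPolygraph

/-- The free precategories on the truncations of an `ω`-polygraph. -/
@[reducible] def tower (P : OmegaPolygraph.{u}) : PrecategoryTower.{u} where
  obj n := (P.stage n).free
  incl n := FinPolygraph.incl (P.trunc_stage n)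
  isTruncation n := FinPolygraph.isTruncation_incl (P.trunc_stage n)

/-- The `ω`-precategory freely generated by an `ω`-polygraph. -/
noncomputable def free (P : OmegaPolygraph.{u}) : NPrecategory.{u} ⊤ := P.tower.limit

/-- A morphism of `ω`-polygraphs: a sequence of morphisms of `n`-polygraphs, each being the
truncation of the next one. -/
structure Hom (P Q : OmegaPolygraph.{u}) : Type u where
  stage : ∀ n : ℕ, FinPolygraph.Hom (P.stage n) (Q.stage n)
  trunc_stage : ∀ n : ℕ, HEq (stage (n + 1)).trunc (stage n)

/-- The prefunctor between free `ω`-precategories induced by a morphism of `ω`-polygraphs. -/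
noncomputable def Hom.free {P Q : OmegaPolygraph.{u}} (F : Hom P Q) :
    NPrefunctor P.free Q.free :=
  PrecategoryTower.limitMap (T := P.tower) (T' := Q.tower) (fun n => (F.stage n).free)
    (fun n _ x => FinPolygraph.Hom.free_incl (P.trunc_stage n) (Q.trunc_stage n) (F.stage n)
      (F.stage (n + 1)) (F.trunc_stage n) x)

end OmegaPolygraph

/-- The type of `n`-polygraphs, `n ∈ ℕ ∪ {ω}`. -/
def Polygraph : ℕ∞ → Type (u + 1)
  | some n => FinPolygraph.{u} n
  | none => OmegaPolygraph.{u}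

namespace Polygraph

/-- The `n`-precategory `P*` freely generated by an `n`-polygraph `P`. -/
noncomputable def free : ∀ {n : ℕ∞}, Polygraph.{u} n → NPrecategory.{u} n
  | some _, P => FinPolygraph.free P
  | none, P => OmegaPolygraph.free P

/-- Morphisms of `n`-polygraphs. -/
def Hom : ∀ {n : ℕ∞}, Polygraph.{u} n → Polygraph.{u} n → Type u
  | some _, P, Q => FinPolygraph.Hom P Q
  | none, P, Q => OmegaPolygraph.Hom P Q

/-- The `n`-prefunctor `F* : P* → Q*` induced by a morphism of `n`-polygraphs `F : P → Q`. -/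
noncomputable def Hom.free : ∀ {n : ℕ∞} {P Q : Polygraph.{u} n}, Hom P Q →
    NPrefunctor P.free Q.free
  | some _, _, _, F => FinPolygraph.Hom.free F
  | none, _, _, F => OmegaPolygraph.Hom.free F

end Polygraph

/-! The proof is by induction on the dimension. The case of `ω` is then read off stage by stage,
since a decomposition of an `m`-cell only involves cells that live in the `m`-th stage. In dimension
`0` there is nothing to decompose, so everything rests on one step, `isConduche_freeMap`: if `F : C
→ D` is Conduché and `f` maps generators over `C` to generators over `D` compatibly with boundaries,
then the prefunctor between the free extensions is Conduché. A decomposition of a cell of dimension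
at most `n` is one for `F`, so let `u` be a freely generated `(n+1)`-cell, that is, the class of an
expression `t` modulo the relations `Rel`.

Existence. Suppose that `u` is mapped to `v₁ ∘ v₂`. Replacing each symbol of `t` by its image gives
an expression that is joined by a zigzag of relations to a formal composite `s` denoting `v₁ ∘ v₂`.
This zigzag lifts to `C`: by `Rel.lifts`, every relation over `D` lifts, in both directions and from
any preimage of the end where one starts, to a relation over `C` with the same boundary. Some
relations require a cell of `C` to be split, or two cells of `C` to be recognised as equal, and this
is where the Conduché property of `F` is used. The lifted zigzag ends at an expression for `u` whose
image is literally `s`. Taking images preserves the shape of expressions, so this expression is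
itself a formal composite, and its parts denote the required factors.

Uniqueness. As there is no interchange law, all relations preserve the ordered list of generators
occurring in an expression (`Rel.gens_eq`). An expression is determined by its source, this list and
its image (`Tm.eq_of_map_eq`); lifting a zigzag again, the same holds for cells
(`cell_eq_of_freeMap_eq`). For two decompositions of `u` into `(n+1)`-cells with the same images,
the first factors have the same source as `u`, and their lists have the same length, so they are the
same initial segment of the list of `u`. The first factors thus agree, hence so do the sources of
the second factors, which agree in turn. If one factor is a cell of `C`, the other one carries the
whole list, and uniqueness for `F`, applied to the source of `u`, identifies the cells of `C` and
the sources. -/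

/-! ### Iterated sources and targets in a globular set. -/

namespace GlobularSet

variable {n : ℕ∞} (X : GlobularSet.{u} n)

theorem srcAt_srcAt {i j k : ℕ} (hij : i ≤ j) (hjk : j ≤ k) (x : X.cell k) :
    X.srcAt hij (X.srcAt hjk x) = X.srcAt (hij.trans hjk) x := by
  induction k, hjk using Nat.le_induction with
  | base => rw [X.srcAt_self]
  | succ k h ih => rw [X.srcAt_succ h, X.srcAt_succ (hij.trans h), ih]

theorem tgtAt_tgtAt {i j k : ℕ} (hij : i ≤ j) (hjk : j ≤ k) (x : X.cell k) :
    X.tgtAt hij (X.tgtAt hjk x) = X.tgtAt (hij.trans hjk) x := by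
  induction k, hjk using Nat.le_induction with
  | base => rw [X.tgtAt_self]
  | succ k h ih => rw [X.tgtAt_succ h, X.tgtAt_succ (hij.trans h), ih]

/-- Globularity: the source and the target of a cell share all faces of strictly smaller dimension.
Hence the strict inequality `i < j` for mixed faces, where `i ≤ j` suffices for iterated sources or
iterated targets. -/
theorem srcAt_tgtAt {i j k : ℕ} (hij : i < j) (hjk : j ≤ k) (x : X.cell k) :
    X.srcAt hij.le (X.tgtAt hjk x) = X.srcAt (hij.le.trans hjk) x := by
  induction k, hjk using Nat.le_induction with
  | base => rw [X.tgtAt_self]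
  | succ k h ih =>
    rw [X.tgtAt_succ h, X.srcAt_succ (hij.le.trans h), ih,
      X.srcAt_eq_of_parallel (hij.trans_le h) (X.parallel_src_tgt x)]

theorem tgtAt_srcAt {i j k : ℕ} (hij : i < j) (hjk : j ≤ k) (x : X.cell k) :
    X.tgtAt hij.le (X.srcAt hjk x) = X.tgtAt (hij.le.trans hjk) x := by
  induction k, hjk using Nat.le_induction with
  | base => rw [X.srcAt_self]
  | succ k h ih =>
    rw [X.srcAt_succ h, X.tgtAt_succ (hij.le.trans h), ih,
      X.tgtAt_eq_of_parallel (hij.trans_le h) (X.parallel_src_tgt x)]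

end GlobularSet

/-! ### Faces of composites, and definedness of the other side of the axioms. -/

namespace NPrecategory

variable {n : ℕ∞} {C : NPrecategory.{u} n}

theorem exists_isComp {i k l m : ℕ} (hi : i + 1 = min k l) (hm : m = max k l) {a : C.cell k}
    {b : C.cell l} (h : C.tgtAt (le_left_of_min hi) a = C.srcAt (le_right_of_min hi) b) :
    ∃ c : C.cell m, C.IsComp a b c :=
  ⟨_, isComp_comp hi hm a b h⟩

namespace IsComp

theorem tgtAt_eq_srcAt {i k l m : ℕ} {a : C.cell k} {b : C.cell l} {c : C.cell m}
    (h : C.IsComp a b c) (hi : i + 1 = min k l) :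
    C.tgtAt (le_left_of_min hi) a = C.srcAt (le_right_of_min hi) b :=
  (h.eq hi h.dim.2.2).choose

/-- The `j`-source of `a ∘ b` is `a ∘ b'`, for `b'` the `j`-source of `b`, if the dimension of `a`
is at most `j`. -/
theorem srcAt_right {j k l m : ℕ} {a : C.cell k} {b : C.cell l} {c : C.cell m}
    (h : C.IsComp a b c) (hkj : k ≤ j) (hjl : j ≤ l) (hjm : j ≤ m) :
    C.IsComp a (C.srcAt hjl b) (C.srcAt hjm c) := by
  obtain rfl : m = l := by have := h.dim; omega
  induction m, hjl using Nat.le_induction with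
  | base => rwa [C.srcAt_self, C.srcAt_self]
  | succ m hj ih =>
    rw [C.srcAt_succ hj, C.srcAt_succ hj]
    refine ih hj ?_
    obtain ⟨i, hi, hm, h, rfl⟩ := h
    rw [C.src_comp_lt hi hm (by omega) (by omega) a b h ?_ (by omega)]
    · exact isComp_comp ..
    · rw [GlobularSet.Composable, ← C.srcAt_succ]
      exact h

theorem tgtAt_right {j k l m : ℕ} {a : C.cell k} {b : C.cell l} {c : C.cell m}
    (h : C.IsComp a b c) (hkj : k ≤ j) (hjl : j ≤ l) (hjm : j ≤ m) :
    C.IsComp a (C.tgtAt hjl b) (C.tgtAt hjm c) := by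
  obtain rfl : m = l := by have := h.dim; omega
  induction m, hjl using Nat.le_induction with
  | base => rwa [C.tgtAt_self, C.tgtAt_self]
  | succ m hj ih =>
    rw [C.tgtAt_succ hj, C.tgtAt_succ hj]
    refine ih hj ?_
    obtain ⟨i, hi, hm, h, rfl⟩ := h
    rw [C.tgt_comp_lt hi hm (by omega) (by omega) a b h ?_ (by omega)]
    · exact isComp_comp ..
    · rw [GlobularSet.Composable, ← C.srcAt_eq_of_parallel (by omega) (C.parallel_src_tgt b),
        ← C.srcAt_succ]
      exact h

theorem srcAt_left {j k l m : ℕ} {a : C.cell k} {b : C.cell l} {c : C.cell m}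
    (h : C.IsComp b a c) (hkj : k ≤ j) (hjl : j ≤ l) (hjm : j ≤ m) :
    C.IsComp (C.srcAt hjl b) a (C.srcAt hjm c) := by
  obtain rfl : m = l := by have := h.dim; omega
  induction m, hjl using Nat.le_induction with
  | base => rwa [C.srcAt_self, C.srcAt_self]
  | succ m hj ih =>
    rw [C.srcAt_succ hj, C.srcAt_succ hj]
    refine ih hj ?_
    obtain ⟨i, hi, hm, h, rfl⟩ := h
    rw [C.src_comp_gt hi hm (by omega) (by omega) b a h ?_ (by omega)]
    · exact isComp_comp ..
    · rw [GlobularSet.Composable, C.tgtAt_eq_of_parallel (by omega) (C.parallel_src_tgt b),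
        ← C.tgtAt_succ]
      exact h

theorem tgtAt_left {j k l m : ℕ} {a : C.cell k} {b : C.cell l} {c : C.cell m}
    (h : C.IsComp b a c) (hkj : k ≤ j) (hjl : j ≤ l) (hjm : j ≤ m) :
    C.IsComp (C.tgtAt hjl b) a (C.tgtAt hjm c) := by
  obtain rfl : m = l := by have := h.dim; omega
  induction m, hjl using Nat.le_induction with
  | base => rwa [C.tgtAt_self, C.tgtAt_self]
  | succ m hj ih =>
    rw [C.tgtAt_succ hj, C.tgtAt_succ hj]
    refine ih hj ?_
    obtain ⟨i, hi, hm, h, rfl⟩ := h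
    rw [C.tgt_comp_gt hi hm (by omega) (by omega) b a h ?_ (by omega)]
    · exact isComp_comp ..
    · rw [GlobularSet.Composable, ← C.tgtAt_succ]
      exact h

theorem srcAt_of_eq {i k : ℕ} {a b c : C.cell k} (h : C.IsComp a b c) (hi : i < k) :
    C.srcAt hi.le c = C.srcAt hi.le a := by
  obtain _ | k := k
  · omega
  rw [C.srcAt_succ (Nat.lt_succ_iff.mp hi), C.srcAt_succ (Nat.lt_succ_iff.mp hi), h.src_of_eq]

theorem tgtAt_of_eq {i k : ℕ} {a b c : C.cell k} (h : C.IsComp a b c) (hi : i < k) :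
    C.tgtAt hi.le c = C.tgtAt hi.le b := by
  obtain _ | k := k
  · omega
  rw [C.tgtAt_succ (Nat.lt_succ_iff.mp hi), C.tgtAt_succ (Nat.lt_succ_iff.mp hi), h.tgt_of_eq]

/-- The `i`-source of an `i`-composite is that of its first factor. -/
theorem srcAt_eq {i k l m : ℕ} {a : C.cell k} {b : C.cell l} {c : C.cell m}
    (h : C.IsComp a b c) (hik : i < k) (hil : i < l) (him : i < m) :
    C.srcAt him.le c = C.srcAt hik.le a := by
  have d := h.dim
  -- Cutting the larger factor down to the dimension of the smaller one leaves a composite of two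
  -- cells of equal dimension, whose source is that of its first factor.
  obtain hkl | hkl := le_total k l
  · have h' := h.srcAt_right le_rfl hkl (by omega)
    rw [← h'.srcAt_of_eq hik, C.srcAt_srcAt]
  · have h' := h.srcAt_left le_rfl hkl (by omega)
    rw [← C.srcAt_srcAt hil.le (by omega), h'.srcAt_of_eq hil, C.srcAt_srcAt]

theorem tgtAt_eq {i k l m : ℕ} {a : C.cell k} {b : C.cell l} {c : C.cell m}
    (h : C.IsComp a b c) (hik : i < k) (hil : i < l) (him : i < m) :
    C.tgtAt him.le c = C.tgtAt hil.le b := by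
  have d := h.dim
  obtain hkl | hkl := le_total k l
  · have h' := h.tgtAt_right le_rfl hkl (by omega)
    rw [← C.tgtAt_tgtAt hik.le (by omega), h'.tgtAt_of_eq hik, C.tgtAt_tgtAt]
  · have h' := h.tgtAt_left le_rfl hkl (by omega)
    rw [← h'.tgtAt_of_eq hil, C.tgtAt_tgtAt]

/-- If `(a ∘ b) ∘ c` is defined, with the three cells composed in the same dimension, then so is
`a ∘ (b ∘ c)`. -/
theorem assoc_right {k l m p q r : ℕ} {a : C.cell k} {b : C.cell l} {c : C.cell m}
    {ab : C.cell p} {d : C.cell r} (h₁ : C.IsComp a b ab) (h₂ : C.IsComp ab c d)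
    (hkl : min k l = min l m) (hpm : min p m = min k l) (hq : q = max l m)
    (hkq : min k q = min k l) : ∃ bc : C.cell q, C.IsComp b c bc ∧ C.IsComp a bc d := by
  have d₁ := h₁.dim
  have d₂ := h₂.dim
  obtain ⟨i, hi⟩ : ∃ i, i + 1 = min k l := ⟨min k l - 1, by omega⟩
  have e₁ := h₁.tgtAt_eq_srcAt hi
  have e₂ := h₂.tgtAt_eq_srcAt (hi.trans hpm.symm)
  -- The axiom `assoc` presupposes both bracketings. The second one exists because `ab` has the same
  -- `i`-target as `b`, and `bc` the same `i`-source as `b`.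
  obtain ⟨bc, hbc⟩ := C.exists_isComp (hi.trans hkl) hq
    ((h₁.tgtAt_eq (i := i) (by omega) (by omega) (by omega)).symm.trans e₂)
  obtain ⟨d', hd'⟩ := C.exists_isComp (m := r) (hi.trans hkq.symm) (by omega)
    (e₁.trans (hbc.srcAt_eq (i := i) (by omega) (by omega) (by omega)).symm)
  obtain rfl := assoc_eq h₁ hbc h₂ hd' hkl hpm.symm hkq.symm
  exact ⟨bc, hbc, hd'⟩

theorem assoc_left {k l m p q r : ℕ} {a : C.cell k} {b : C.cell l} {c : C.cell m}
    {bc : C.cell q} {d : C.cell r} (h₁ : C.IsComp b c bc) (h₂ : C.IsComp a bc d)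
    (hkl : min k l = min l m) (hkq : min k q = min k l) (hp : p = max k l)
    (hpm : min p m = min k l) : ∃ ab : C.cell p, C.IsComp a b ab ∧ C.IsComp ab c d := by
  have d₁ := h₁.dim
  have d₂ := h₂.dim
  obtain ⟨i, hi⟩ : ∃ i, i + 1 = min k l := ⟨min k l - 1, by omega⟩
  have e₁ := h₁.tgtAt_eq_srcAt (hi.trans hkl)
  have e₂ := h₂.tgtAt_eq_srcAt (hi.trans hkq.symm)
  obtain ⟨ab, hab⟩ := C.exists_isComp hi hp
    (e₂.trans (h₁.srcAt_eq (i := i) (by omega) (by omega) (by omega)))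
  obtain ⟨d', hd'⟩ := C.exists_isComp (m := r) (hi.trans hpm.symm) (by omega)
    ((hab.tgtAt_eq (i := i) (by omega) (by omega) (by omega)).trans e₁)
  obtain rfl := assoc_eq hab h₁ hd' h₂ hkl hpm.symm hkq.symm
  exact ⟨ab, hab, hd'⟩

/-- If `a ∘ (b ∘ c)` is defined, where `a` has smaller dimension than `b` and `c`, then so is
`(a ∘ b) ∘ (a ∘ c)`. -/
theorem comp_distrib {k l l' m r : ℕ} {a : C.cell k} {b : C.cell l} {c : C.cell l'}
    {bc : C.cell m} {d : C.cell r} (h₁ : C.IsComp b c bc) (h₂ : C.IsComp a bc d) (hk : k < l)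
    (hk' : k < l') : ∃ (ab : C.cell l) (ac : C.cell l'), C.IsComp a b ab ∧ C.IsComp a c ac ∧
      C.IsComp ab ac d := by
  have d₁ := h₁.dim
  have d₂ := h₂.dim
  obtain ⟨i, rfl⟩ : ∃ i, k = i + 1 := ⟨k - 1, by omega⟩
  obtain ⟨j, hj⟩ : ∃ j, j + 1 = min l l' := ⟨min l l' - 1, by omega⟩
  have e₁ := h₁.tgtAt_eq_srcAt hj
  have e₂ := h₂.tgtAt_eq_srcAt (i := i) (by omega)
  have e₃ := h₁.srcAt_eq (i := j) (by omega) (by omega) (by omega)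
  -- The cell `a` meets its right factor along the `i`-source only, and `b`, `c` and `bc` have the
  -- same `i`-source by globularity, since `i < j`.
  have e₄ : C.tgtAt (by omega) a = C.srcAt (by omega : i ≤ l) b := by
    rw [e₂, ← C.srcAt_srcAt (j := j) (by omega) (by omega), e₃, C.srcAt_srcAt]
  have e₅ : C.tgtAt (by omega) a = C.srcAt (by omega : i ≤ l') c := by
    rw [e₄, ← C.srcAt_tgtAt (j := j) (by omega) (by omega), e₁, C.srcAt_srcAt]
  obtain ⟨ab, hab⟩ := C.exists_isComp (m := l) (by omega) (by omega) e₄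
  obtain ⟨ac, hac⟩ := C.exists_isComp (m := l') (by omega) (by omega) e₅
  -- The `j`-target of `ab` is `a` composed with that of `b`, and the `j`-source of `ac` is `a`
  -- composed with that of `c`; these are the same cell because `b` and `c` are `j`-composable.
  have h₃ := hab.tgtAt_right (j := j) (by omega) (by omega) (by omega)
  rw [e₁] at h₃
  obtain ⟨d', hd'⟩ := C.exists_isComp (m := r) hj (by omega)
    (h₃.unique (hac.srcAt_right (j := j) (by omega) (by omega) (by omega)))
  obtain rfl := comp_distrib_eq h₁ h₂ hab hac hd' hk hk'
  exact ⟨ab, ac, hab, hac, hd'⟩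

theorem distrib_comp {k l l' m r : ℕ} {a : C.cell k} {b : C.cell l} {c : C.cell l'}
    {bc : C.cell m} {d : C.cell r} (h₁ : C.IsComp b c bc) (h₂ : C.IsComp bc a d) (hk : k < l)
    (hk' : k < l') : ∃ (ba : C.cell l) (ca : C.cell l'), C.IsComp b a ba ∧ C.IsComp c a ca ∧
      C.IsComp ba ca d := by
  have d₁ := h₁.dim
  have d₂ := h₂.dim
  obtain ⟨i, rfl⟩ : ∃ i, k = i + 1 := ⟨k - 1, by omega⟩
  obtain ⟨j, hj⟩ : ∃ j, j + 1 = min l l' := ⟨min l l' - 1, by omega⟩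
  have e₁ := h₁.tgtAt_eq_srcAt hj
  have e₂ := h₂.tgtAt_eq_srcAt (i := i) (by omega)
  have e₃ := h₁.tgtAt_eq (i := j) (by omega) (by omega) (by omega)
  have e₄ : C.tgtAt (by omega : i ≤ l') c = C.srcAt (by omega) a := by
    rw [← e₂, ← C.tgtAt_tgtAt (i := i) (j := j) (k := m) (by omega) (by omega), e₃,
      C.tgtAt_tgtAt]
  have e₅ : C.tgtAt (by omega : i ≤ l) b = C.srcAt (by omega) a := by
    rw [← e₄, ← C.tgtAt_srcAt (k := l') (j := j) (by omega) (by omega), ← e₁, C.tgtAt_tgtAt]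
  obtain ⟨ba, hba⟩ := C.exists_isComp (m := l) (by omega) (by omega) e₅
  obtain ⟨ca, hca⟩ := C.exists_isComp (m := l') (by omega) (by omega) e₄
  have h₃ := hba.tgtAt_left (j := j) (by omega) (by omega) (by omega)
  rw [e₁] at h₃
  obtain ⟨d', hd'⟩ := C.exists_isComp (m := r) hj (by omega)
    (h₃.unique (hca.srcAt_left (j := j) (by omega) (by omega) (by omega)))
  obtain rfl := distrib_comp_eq h₁ h₂ hba hca hd' hk hk'
  exact ⟨ba, ca, hba, hca, hd'⟩

end IsComp

/-- Cells that are parallel to a cell composable with `a` are composable with `a`. -/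
theorem exists_isComp_of_parallel_left {k l : ℕ} {a : C.cell k} {x y x' : C.cell l}
    (h : C.IsComp a x x') (hp : C.Parallel x y) :
    ∃ y' : C.cell l, C.IsComp a y y' := by
  have d := h.dim
  obtain ⟨i, hi⟩ : ∃ i, i + 1 = min k l := ⟨min k l - 1, by omega⟩
  exact C.exists_isComp hi (by omega)
    ((h.tgtAt_eq_srcAt hi).trans (C.srcAt_eq_of_parallel (by omega) hp))

theorem exists_isComp_of_parallel_right {k l : ℕ} {a : C.cell k} {x y x' : C.cell l}
    (h : C.IsComp x a x') (hp : C.Parallel x y) :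
    ∃ y' : C.cell l, C.IsComp y a y' := by
  have d := h.dim
  obtain ⟨i, hi⟩ : ∃ i, i + 1 = min l k := ⟨min l k - 1, by omega⟩
  exact C.exists_isComp hi (by omega)
    ((C.tgtAt_eq_of_parallel (by omega) hp).symm.trans (h.tgtAt_eq_srcAt hi))

end NPrecategory

/-! ### Consequences of the Conduché property. -/

namespace NPrefunctor.IsConduche

open NPrecategory

variable {n : ℕ∞} {C D : NPrecategory.{u} n} {F : NPrefunctor C D}

/-- The existence half of the Conduché property, in terms of `IsComp`, which carries the index of
the composition and the dimension equations with it. The uniqueness half is `isComp_unique`, and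
`of_isComp` goes back. -/
theorem exists_isComp (hF : F.IsConduche) {k l m : ℕ} {u : C.cell m} {v₁ : D.cell k}
    {v₂ : D.cell l} {v : D.cell m} (h : D.IsComp v₁ v₂ v) (hu : F.map u = v) :
    ∃ u₁ u₂, F.map u₁ = v₁ ∧ F.map u₂ = v₂ ∧ C.IsComp u₁ u₂ u := by
  obtain ⟨i, hi, hm, hc, rfl⟩ := h
  obtain ⟨p, ⟨hp, h₁, h₂, h₃⟩, -⟩ := hF hi hm u v₁ v₂ hc hu
  exact ⟨p.1, p.2, h₁, h₂, i, hi, hm, hp, h₃⟩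

theorem isComp_unique (hF : F.IsConduche) {k l m : ℕ} {u : C.cell m} {u₁ u₁' : C.cell k}
    {u₂ u₂' : C.cell l} (h : C.IsComp u₁ u₂ u) (h' : C.IsComp u₁' u₂' u)
    (h₁ : F.map u₁ = F.map u₁') (h₂ : F.map u₂ = F.map u₂') : u₁ = u₁' ∧ u₂ = u₂' := by
  obtain ⟨i, hi, hm, hc, h⟩ := h
  obtain ⟨hc', h'⟩ := h'.eq hi hm
  have e : F.map u = D.comp hi hm (F.map u₁) (F.map u₂) (F.map_composable hi hc) := by
    rw [← h]
    exact F.map_comp ..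
  have := (hF hi hm u _ _ _ e).unique (y₁ := (u₁, u₂)) (y₂ := (u₁', u₂')) ⟨hc, rfl, rfl, h⟩
    ⟨hc', h₁.symm, h₂.symm, h'⟩
  exact ⟨congrArg Prod.fst this, congrArg Prod.snd this⟩

theorem of_isComp (hex : ∀ {k l m : ℕ} {u : C.cell m} {v₁ : D.cell k} {v₂ : D.cell l},
      D.IsComp v₁ v₂ (F.map u) →
      ∃ u₁ u₂, F.map u₁ = v₁ ∧ F.map u₂ = v₂ ∧ C.IsComp u₁ u₂ u)
    (huniq : ∀ {k l m : ℕ} {u : C.cell m} {u₁ u₁' : C.cell k} {u₂ u₂' : C.cell l},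
      C.IsComp u₁ u₂ u → C.IsComp u₁' u₂' u → F.map u₁ = F.map u₁' → F.map u₂ = F.map u₂' →
      u₁ = u₁' ∧ u₂ = u₂') : F.IsConduche := by
  intro i k₁ k₂ k hi hk u v₁ v₂ hv h
  obtain ⟨u₁, u₂, h₁, h₂, hu⟩ := hex (u := u) ⟨i, hi, hk, hv, h.symm⟩
  obtain ⟨hc, e⟩ := hu.eq hi hk
  refine ⟨(u₁, u₂), ⟨hc, h₁, h₂, e⟩, ?_⟩
  rintro ⟨w₁, w₂⟩ ⟨hw, e₁, e₂, e₃⟩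
  obtain ⟨rfl, rfl⟩ := huniq ⟨i, hi, hk, hw, e₃⟩ hu (e₁.trans h₁.symm) (e₂.trans h₂.symm)
  rfl

/-- The cell `u` is both `id ∘ u`, with the identity of its source, and `u ∘ id`, with the identity
of its target. Both decompositions lie over `id_a ∘ id_a`, so uniqueness equates their first
factors. -/
theorem exists_ident (hF : F.IsConduche) {k : ℕ} (hk : ((k + 1 : ℕ) : ℕ∞) ≤ n)
    {u : C.cell (k + 1)} {a : D.cell k} (h : F.map u = D.ident hk a) :
    ∃ b, F.map b = a ∧ u = C.ident hk b := by
  have hs : F.map (C.src u) = a := by rw [F.map_src, h, D.src_ident]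
  have ht : F.map (C.tgt u) = a := by rw [F.map_tgt, h, D.tgt_ident]
  have hi : k + 1 = min (k + 1) (k + 1) := by omega
  have hm : k + 1 = max (k + 1) (k + 1) := by omega
  have h₁ : C.IsComp (C.ident hk (C.src u)) u u := by
    obtain ⟨w, hw, -⟩ := C.exists_comp_of_eq (C.ident hk (C.src u)) u (C.tgt_ident hk _)
    obtain rfl := C.ident_isComp_le hk hw
    exact hw
  have h₂ : C.IsComp u (C.ident hk (C.tgt u)) u := by
    obtain ⟨w, hw, -⟩ := C.exists_comp_of_eq u (C.ident hk (C.tgt u)) (C.src_ident hk _).symm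
    obtain rfl := C.isComp_ident_le hk hw
    exact hw
  refine ⟨C.src u, hs, ((hF.isComp_unique h₁ h₂ ?_ ?_).1).symm⟩
  · rw [F.map_ident, hs, h]
  · rw [F.map_ident, ht, h]

/-- If `(a ∘ b) ∘ (a' ∘ c)` is defined, where `a` and `a'` have the same image and the images of
`b` and `c` are composable, then `a = a'` and `a ∘ (b ∘ c)` is defined. -/
theorem comp_distrib (hF : F.IsConduche) {k l l' m r : ℕ} {a a' : C.cell k} {b ab : C.cell l}
    {c ac : C.cell l'} {d : C.cell r} {bc : D.cell m} (hab : C.IsComp a b ab)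
    (hac : C.IsComp a' c ac) (h : C.IsComp ab ac d) (ha : F.map a = F.map a')
    (hbc : D.IsComp (F.map b) (F.map c) bc) (hk : k < l) (hk' : k < l') :
    a = a' ∧ ∃ bc : C.cell m, C.IsComp b c bc ∧ C.IsComp a bc d := by
  have d₁ := hbc.dim
  have d₂ := h.dim
  obtain ⟨j, hj⟩ : ∃ j, j + 1 = min l l' := ⟨min l l' - 1, by omega⟩
  -- The face along which `ab` and `ac` meet is both `a` composed with the `j`-target of `b` and
  -- `a'` composed with the `j`-source of `c`, over the same pair of cells of `D`. Uniqueness for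
  -- this face gives `a = a'` and the composability of `b` and `c`.
  have h₁ := hab.tgtAt_right (j := j) (by omega) (by omega) (by omega)
  have h₂ := hac.srcAt_right (j := j) (by omega) (by omega) (by omega)
  rw [← h.tgtAt_eq_srcAt hj] at h₂
  obtain ⟨rfl, e⟩ := hF.isComp_unique h₁ h₂ ha
    (by rw [F.map_tgtAt, F.map_srcAt, hbc.tgtAt_eq_srcAt hj])
  obtain ⟨bc', hbc'⟩ := C.exists_isComp hj d₁.2.2 e
  obtain ⟨i, rfl⟩ : ∃ i, k = i + 1 := ⟨k - 1, by have := hab.dim; omega⟩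
  have e' := hab.tgtAt_eq_srcAt (i := i) (by omega)
  obtain ⟨d', hd'⟩ := C.exists_isComp (k := i + 1) (a := a) (b := bc') (i := i) (m := r) (by omega)
    (by omega) (by
      rw [e', ← C.srcAt_srcAt (j := j) (k := m) (by omega) (by omega),
        hbc'.srcAt_eq (by omega) (by omega) (by omega), C.srcAt_srcAt])
  obtain rfl := comp_distrib_eq hbc' hd' hab hac h hk hk'
  exact ⟨rfl, bc', hbc', hd'⟩

theorem distrib_comp (hF : F.IsConduche) {k l l' m r : ℕ} {a a' : C.cell k} {b ba : C.cell l}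
    {c ca : C.cell l'} {d : C.cell r} {bc : D.cell m} (hba : C.IsComp b a ba)
    (hca : C.IsComp c a' ca) (h : C.IsComp ba ca d) (ha : F.map a = F.map a')
    (hbc : D.IsComp (F.map b) (F.map c) bc) (hk : k < l) (hk' : k < l') :
    a = a' ∧ ∃ bc : C.cell m, C.IsComp b c bc ∧ C.IsComp bc a d := by
  have d₁ := hbc.dim
  have d₂ := h.dim
  obtain ⟨j, hj⟩ : ∃ j, j + 1 = min l l' := ⟨min l l' - 1, by omega⟩
  have h₁ := hba.tgtAt_left (j := j) (by omega) (by omega) (by omega)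
  have h₂ := hca.srcAt_left (j := j) (by omega) (by omega) (by omega)
  rw [← h.tgtAt_eq_srcAt hj] at h₂
  obtain ⟨e, rfl⟩ := hF.isComp_unique h₁ h₂
    (by rw [F.map_tgtAt, F.map_srcAt, hbc.tgtAt_eq_srcAt hj]) ha
  obtain ⟨bc', hbc'⟩ := C.exists_isComp hj d₁.2.2 e
  obtain ⟨i, rfl⟩ : ∃ i, k = i + 1 := ⟨k - 1, by have := hba.dim; omega⟩
  have e' := hca.tgtAt_eq_srcAt (i := i) (by omega)
  obtain ⟨d', hd'⟩ := C.exists_isComp (l := i + 1) (a := bc') (b := a) (i := i) (m := r) (by omega)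
    (by omega) (by
      rw [← e', ← C.tgtAt_tgtAt (i := i) (j := j) (k := m) (by omega) (by omega),
        hbc'.tgtAt_eq (by omega) (by omega) (by omega), C.tgtAt_tgtAt])
  obtain rfl := distrib_comp_eq hbc' hd' hba hca h hk hk'
  exact ⟨rfl, bc', hbc', hd'⟩

end NPrefunctor.IsConduche

/-! ### Untyped expressions and their lists of generators. -/

namespace CellExtension

variable {n : ℕ} {C D : NPrecategory.{u} n} {G : CellExtension C} {H : CellExtension D}

variable (G) in
/-- Expressions for the freely generated `(n+1)`-cells, without their sources and targets. -/
inductive Raw : Type u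
  | gen (g : G.gen) : Raw
  | ident (x : C.cell n) : Raw
  | comp (r r' : Raw) : Raw
  | left {k : ℕ} (a : C.cell k) (r : Raw) : Raw
  | right {k : ℕ} (a : C.cell k) (r : Raw) : Raw

namespace Raw

/-- The list of the generators that occur in an expression. -/
def gens : Raw G → List G.gen
  | gen g => [g]
  | ident _ => []
  | comp r r' => r.gens ++ r'.gens
  | left _ r => r.gens
  | right _ r => r.gens

/-- Without boundaries in the type, this needs no compatibility of `f` with sources and targets, and
images can be compared without transport along equalities of cells. -/
def map (F : NPrefunctor C D) (f : G.gen → H.gen) : Raw G → Raw H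
  | gen g => gen (f g)
  | ident x => ident (F.map x)
  | comp r r' => comp (r.map F f) (r'.map F f)
  | left a r => left (F.map a) (r.map F f)
  | right a r => right (F.map a) (r.map F f)

theorem gens_map (F : NPrefunctor C D) (f : G.gen → H.gen) (r : Raw G) :
    (r.map F f).gens = r.gens.map f := by
  induction r <;> simp_all [map, gens]

end Raw

namespace Tm

def raw : ∀ {x y : C.cell n}, Tm G x y → Raw G
  | _, _, gen g => .gen g
  | _, _, ident x => .ident x
  | _, _, comp t t' => .comp t.raw t'.raw
  | _, _, left a t _ _ => .left a t.raw
  | _, _, right a t _ _ => .right a t.raw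

/-- Forgetting boundaries loses nothing: a generator or an identity fixes its own, and those of the
other expressions follow because composites of cells are unique. All that remains is proofs. -/
theorem raw_injective {x y x' y' : C.cell n} (t : Tm G x y) (t' : Tm G x' y')
    (h : t.raw = t'.raw) : x = x' ∧ y = y' ∧ HEq t t' := by
  induction t generalizing x' y' with
  | gen g =>
    cases t' <;> simp only [raw, Raw.gen.injEq, reduceCtorEq] at h
    subst h
    exact ⟨rfl, rfl, .rfl⟩
  | ident x =>
    cases t' <;> simp only [raw, Raw.ident.injEq, reduceCtorEq] at h
    subst h
    exact ⟨rfl, rfl, .rfl⟩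
  | comp t₁ t₂ ih₁ ih₂ =>
    cases t' <;> simp only [raw, Raw.comp.injEq, reduceCtorEq] at h
    obtain ⟨rfl, rfl, h₁⟩ := ih₁ _ h.1
    obtain ⟨-, rfl, h₂⟩ := ih₂ _ h.2
    obtain rfl := eq_of_heq h₁
    obtain rfl := eq_of_heq h₂
    exact ⟨rfl, rfl, .rfl⟩
  | left a t hx hy ih =>
    cases t' <;> simp only [raw, Raw.left.injEq, reduceCtorEq] at h
    rename_i hx' hy'
    obtain ⟨rfl, h₁, h₂⟩ := h
    obtain rfl := eq_of_heq h₁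
    obtain ⟨rfl, rfl, h₃⟩ := ih _ h₂
    obtain rfl := eq_of_heq h₃
    obtain rfl := hx.unique hx'
    obtain rfl := hy.unique hy'
    exact ⟨rfl, rfl, .rfl⟩
  | right a t hx hy ih =>
    cases t' <;> simp only [raw, Raw.right.injEq, reduceCtorEq] at h
    rename_i hx' hy'
    obtain ⟨rfl, h₁, h₂⟩ := h
    obtain rfl := eq_of_heq h₁
    obtain ⟨rfl, rfl, h₃⟩ := ih _ h₂
    obtain rfl := eq_of_heq h₃
    obtain rfl := hx.unique hx'
    obtain rfl := hy.unique hy'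
    exact ⟨rfl, rfl, .rfl⟩

end Tm

/-- The relations rearrange brackets, identities and whiskering cells but never exchange two
generators. An interchange law would, and the argument for uniqueness would break down. -/
theorem Rel.gens_eq {x y : C.cell n} {t t' : Tm G x y} (h : Rel t t') :
    t.raw.gens = t'.raw.gens := by
  induction h <;> simp_all [Tm.raw, Raw.gens]

theorem Rel.gens_eq_of_eqvGen {x y : C.cell n} {t t' : Tm G x y}
    (h : Relation.EqvGen Rel t t') : t.raw.gens = t'.raw.gens := by
  induction h with
  | rel _ _ h => exact h.gens_eq
  | refl => rfl
  | symm _ _ _ ih => exact ih.symm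
  | trans _ _ _ _ _ ih ih' => exact ih.trans ih'

/-! ### Expressions and their images under a prefunctor. -/

namespace Tm

section map

variable {F : NPrefunctor C D} {f : G.gen → H.gen}

/-- `Raw.map` keeps the outermost constructor, so the shape of an image can be read back in `C`; the
next three lemmas do the same for the other operations. Here the two ends of `t` have to be
identified before `t` can be compared with an identity, hence the heterogeneous equality. -/
theorem exists_of_map_eq_ident {x y : C.cell n} {t : Tm G x y} {z : D.cell n}
    (h : t.raw.map F f = .ident z) : ∃ x₀, x = x₀ ∧ y = x₀ ∧ HEq t (ident (G := G) x₀) ∧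
      F.map x₀ = z := by
  cases t <;> simp only [raw, Raw.map, Raw.ident.injEq, reduceCtorEq] at h
  exact ⟨_, rfl, rfl, .rfl, h⟩

theorem exists_of_map_eq_comp {x z : C.cell n} {t : Tm G x z} {r r' : Raw H}
    (h : t.raw.map F f = .comp r r') : ∃ (y : C.cell n) (t₁ : Tm G x y) (t₂ : Tm G y z),
      t = comp t₁ t₂ ∧ t₁.raw.map F f = r ∧ t₂.raw.map F f = r' := by
  cases t <;> simp only [raw, Raw.map, Raw.comp.injEq, reduceCtorEq] at h
  exact ⟨_, _, _, rfl, h⟩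

theorem exists_of_map_eq_left {x' y' : C.cell n} {t : Tm G x' y'} {k : ℕ} {a : D.cell k}
    {r : Raw H} (h : t.raw.map F f = .left a r) :
    ∃ (x y : C.cell n) (a₀ : C.cell k) (t₀ : Tm G x y) (hx : C.IsComp a₀ x x')
      (hy : C.IsComp a₀ y y'), t = left a₀ t₀ hx hy ∧ F.map a₀ = a ∧ t₀.raw.map F f = r := by
  cases t <;> simp only [raw, Raw.map, Raw.left.injEq, reduceCtorEq] at h
  obtain ⟨rfl, h₁, h₂⟩ := h
  exact ⟨_, _, _, _, _, _, rfl, eq_of_heq h₁, h₂⟩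

theorem exists_of_map_eq_right {x' y' : C.cell n} {t : Tm G x' y'} {k : ℕ} {a : D.cell k}
    {r : Raw H} (h : t.raw.map F f = .right a r) :
    ∃ (x y : C.cell n) (a₀ : C.cell k) (t₀ : Tm G x y) (hx : C.IsComp x a₀ x')
      (hy : C.IsComp y a₀ y'), t = right a₀ t₀ hx hy ∧ F.map a₀ = a ∧ t₀.raw.map F f = r := by
  cases t <;> simp only [raw, Raw.map, Raw.right.injEq, reduceCtorEq] at h
  obtain ⟨rfl, h₁, h₂⟩ := h
  exact ⟨_, _, _, _, _, _, rfl, eq_of_heq h₁, h₂⟩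

end map

variable (F : NPrefunctor C D) (f : G.gen → H.gen) (hs : ∀ g, H.src (f g) = F.map (G.src g))
  (ht : ∀ g, H.tgt (f g) = F.map (G.tgt g))

include hs ht

/-- Stated as an existence result and not as a function on expressions, because the boundary of the
image of a generator is equal to the image of its boundary by `hs` and `ht` only, not by definition.
-/
theorem exists_map {x y : C.cell n} (t : Tm G x y) :
    ∃ s : Tm H (F.map x) (F.map y), t.raw.map F f = s.raw := by
  induction t with
  | gen g =>
    rw [← hs, ← ht]
    exact ⟨.gen (f g), rfl⟩
  | ident x => exact ⟨.ident _, rfl⟩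
  | comp t t' ih ih' =>
    obtain ⟨s, h⟩ := ih
    obtain ⟨s', h'⟩ := ih'
    exact ⟨.comp s s', congrArg₂ Raw.comp h h'⟩
  | left a t hx hy ih =>
    obtain ⟨s, h⟩ := ih
    exact ⟨.left (F.map a) s (F.map_isComp hx) (F.map_isComp hy), congrArg _ h⟩
  | right a t hx hy ih =>
    obtain ⟨s, h⟩ := ih
    exact ⟨.right (F.map a) s (F.map_isComp hx) (F.map_isComp hy), congrArg _ h⟩

theorem boundary_of_map_eq {x y : C.cell n} {x' y' : D.cell n} {t : Tm G x y} {s : Tm H x' y'}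
    (h : t.raw.map F f = s.raw) : x' = F.map x ∧ y' = F.map y := by
  obtain ⟨s', h'⟩ := t.exists_map F f hs ht
  obtain ⟨h₁, h₂, -⟩ := raw_injective s s' (h.symm.trans h')
  exact ⟨h₁, h₂⟩

/-- An expression is determined by its source, its generators and its image under a Conduché
prefunctor. -/
theorem eq_of_map_eq (hF : F.IsConduche) {x y y' : C.cell n} (t : Tm G x y) (t' : Tm G x y')
    (h : t.raw.map F f = t'.raw.map F f) (hg : t.raw.gens = t'.raw.gens) :
    y = y' ∧ HEq t t' := by
  -- For raw expressions, the induction can run with unrelated boundaries and the sole assumption `x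
  -- = x'`. In a composite, the middle cells are known to agree only once the first factors do.
  suffices ∀ {x y x' y' : C.cell n} (t : Tm G x y) (t' : Tm G x' y'), x = x' →
      t.raw.map F f = t'.raw.map F f → t.raw.gens = t'.raw.gens → t.raw = t'.raw from
    (raw_injective t t' (this t t' rfl h hg)).2
  clear h hg t t'
  intro x y x' y' t t' e h hg
  induction t generalizing x' y' with
  | gen g =>
    cases t' <;> simp only [raw, Raw.map, reduceCtorEq] at h
    -- The map `f` need not be injective: the generator is recovered from the list, not from its
    -- image.
    simpa [raw, Raw.gens] using hg
  | ident x =>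
    -- An identity contains no generator, so it is the equality of sources that decides.
    obtain ⟨x₀, rfl, rfl, h', -⟩ := exists_of_map_eq_ident h.symm
    obtain rfl := eq_of_heq h'
    rw [e]
  | comp t₁ t₂ ih₁ ih₂ =>
    obtain ⟨y', t₁', t₂', rfl, h₁, h₂⟩ := exists_of_map_eq_comp h.symm
    simp only [raw, Raw.gens] at hg
    -- Equal images have equally many generators, so both concatenated lists are cut at the same
    -- place.
    have hl : t₁.raw.gens.length = t₁'.raw.gens.length := by
      have := congrArg (fun r => r.gens.length) h₁
      simpa [Raw.gens_map] using this.symm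
    obtain ⟨hg₁, hg₂⟩ := List.append_inj hg hl
    have e₁ := ih₁ t₁' e h₁.symm hg₁
    have e₂ := ih₂ t₂' (raw_injective _ _ e₁).2.1 h₂.symm hg₂
    rw [raw, raw, e₁, e₂]
  | left a t hx hy ih =>
    obtain ⟨x', y', a', t', hx', hy', rfl, ha, h'⟩ := exists_of_map_eq_left h.symm
    subst e
    obtain ⟨s, hs'⟩ := t.exists_map F f hs ht
    -- The common source splits as a whiskering in two ways over the same pair of cells of `D`.
    -- Uniqueness identifies the whiskering cells and also the inner sources, as the induction
    -- hypothesis requires.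
    obtain ⟨rfl, e⟩ := hF.isComp_unique hx hx' ha.symm
      (t'.boundary_of_map_eq F f hs ht (h'.trans hs')).1
    rw [raw, raw, ih t' e h'.symm hg]
  | right a t hx hy ih =>
    obtain ⟨x', y', a', t', hx', hy', rfl, ha, h'⟩ := exists_of_map_eq_right h.symm
    subst e
    obtain ⟨s, hs'⟩ := t.exists_map F f hs ht
    obtain ⟨e, rfl⟩ := hF.isComp_unique hx hx'
      (t'.boundary_of_map_eq F f hs ht (h'.trans hs')).1 ha.symm
    rw [raw, raw, ih t' e h'.symm hg]

end Tm

/-! ### Lifting the relations along a Conduché prefunctor. -/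

section liftRel

variable {F : NPrefunctor C D} {f : G.gen → H.gen}

/-- Both directions of a relation `s ∼ s'` can be lifted to expressions that are mapped to `s` or
to `s'`. -/
def LiftsRel (F : NPrefunctor C D) (f : G.gen → H.gen) (R : ∀ {x y}, Tm G x y → Tm G x y → Prop)
    (r r' : Raw H) : Prop :=
  (∀ {x y : C.cell n} (t : Tm G x y), t.raw.map F f = r →
      ∃ t' : Tm G x y, t'.raw.map F f = r' ∧ R t t') ∧
    ∀ {x y : C.cell n} (t' : Tm G x y), t'.raw.map F f = r' →
      ∃ t : Tm G x y, t.raw.map F f = r ∧ R t t'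

-- Each relation is lifted by reading the shape of the given expression and performing the same
-- rewriting in `C`. Beyond this, three facts on `F` are needed: existence, where a cell has to be
-- split; uniqueness, where two cells of `C` over the same cell have to be merged; and
-- `exists_ident`, where a cell over an identity has to be an identity. Since the lift must have the
-- boundary of the given expression, every split or merge is made on the source and on the target
-- with the same whiskering cells.
open Tm in
theorem Rel.lifts (hF : F.IsConduche) (hs : ∀ g, H.src (f g) = F.map (G.src g))
    (ht : ∀ g, H.tgt (f g) = F.map (G.tgt g)) {x' y' : D.cell n} {s s' : Tm H x' y'}
    (h : Rel s s') : LiftsRel F f Rel s.raw s'.raw := by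
  have B := @Tm.boundary_of_map_eq n C D G H F f hs ht
  induction h with
  | comp_congr_left t' _ ih =>
    constructor
    all_goals
      intro x y u hu
      obtain ⟨z, u₁, u₂, rfl, h₁, h₂⟩ := exists_of_map_eq_comp hu
    · obtain ⟨u₁', h₁', h⟩ := ih.1 u₁ h₁
      exact ⟨.comp u₁' u₂, congrArg₂ Raw.comp h₁' h₂, .comp_congr_left _ h⟩
    · obtain ⟨u₁', h₁', h⟩ := ih.2 u₁ h₁
      exact ⟨.comp u₁' u₂, congrArg₂ Raw.comp h₁' h₂, .comp_congr_left _ h⟩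
  | comp_congr_right t _ ih =>
    constructor
    all_goals
      intro x y u hu
      obtain ⟨z, u₁, u₂, rfl, h₁, h₂⟩ := exists_of_map_eq_comp hu
    · obtain ⟨u₂', h₂', h⟩ := ih.1 u₂ h₂
      exact ⟨.comp u₁ u₂', congrArg₂ Raw.comp h₁ h₂', .comp_congr_right _ h⟩
    · obtain ⟨u₂', h₂', h⟩ := ih.2 u₂ h₂
      exact ⟨.comp u₁ u₂', congrArg₂ Raw.comp h₁ h₂', .comp_congr_right _ h⟩
  | left_congr a hx hy _ ih =>
    constructor
    all_goals
      intro x y u hu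
      obtain ⟨x₀, y₀, a₀, u₀, hx₀, hy₀, rfl, rfl, h⟩ := exists_of_map_eq_left hu
    · obtain ⟨u', h', r⟩ := ih.1 u₀ h
      exact ⟨.left a₀ u' hx₀ hy₀, congrArg _ h', .left_congr _ _ _ r⟩
    · obtain ⟨u', h', r⟩ := ih.2 u₀ h
      exact ⟨.left a₀ u' hx₀ hy₀, congrArg _ h', .left_congr _ _ _ r⟩
  | right_congr a hx hy _ ih =>
    constructor
    all_goals
      intro x y u hu
      obtain ⟨x₀, y₀, a₀, u₀, hx₀, hy₀, rfl, rfl, h⟩ := exists_of_map_eq_right hu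
    · obtain ⟨u', h', r⟩ := ih.1 u₀ h
      exact ⟨.right a₀ u' hx₀ hy₀, congrArg _ h', .right_congr _ _ _ r⟩
    · obtain ⟨u', h', r⟩ := ih.2 u₀ h
      exact ⟨.right a₀ u' hx₀ hy₀, congrArg _ h', .right_congr _ _ _ r⟩
  | ident_comp t =>
    constructor
    · intro x y u hu
      obtain ⟨z, u₁, u₂, rfl, h₁, h₂⟩ := exists_of_map_eq_comp hu
      obtain ⟨_, rfl, rfl, h, -⟩ := exists_of_map_eq_ident h₁
      obtain rfl := eq_of_heq h
      exact ⟨u₂, h₂, .ident_comp _⟩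
    · intro x y u hu
      obtain ⟨rfl, rfl⟩ := B hu
      exact ⟨.comp (.ident x) u, congrArg _ hu, .ident_comp _⟩
  | comp_ident t =>
    constructor
    · intro x y u hu
      obtain ⟨z, u₁, u₂, rfl, h₁, h₂⟩ := exists_of_map_eq_comp hu
      obtain ⟨_, rfl, rfl, h, -⟩ := exists_of_map_eq_ident h₂
      obtain rfl := eq_of_heq h
      exact ⟨u₁, h₁, .comp_ident _⟩
    · intro x y u hu
      obtain ⟨rfl, rfl⟩ := B hu
      exact ⟨.comp u (.ident y), congrArg (Raw.comp · _) hu, .comp_ident _⟩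
  | left_ident a hx hy =>
    constructor
    · intro x y u hu
      obtain ⟨x₀, y₀, a₀, u₀, hx₀, hy₀, rfl, rfl, h⟩ := exists_of_map_eq_left hu
      obtain ⟨_, rfl, rfl, h', rfl⟩ := exists_of_map_eq_ident h
      obtain rfl := eq_of_heq h'
      obtain rfl := hx₀.unique hy₀
      exact ⟨.ident _, congrArg _ ((F.map_isComp hx₀).unique hx), .left_ident _ _ _⟩
    · intro x y u hu
      obtain ⟨_, rfl, rfl, h, rfl⟩ := exists_of_map_eq_ident hu
      obtain rfl := eq_of_heq h
      -- The right-hand side, an identity, contains no whiskering cell: one has to be produced by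
      -- splitting the cell on which the identity is taken.
      obtain ⟨a₀, x₀, rfl, rfl, hx₀⟩ := hF.exists_isComp hx rfl
      exact ⟨.left a₀ (.ident x₀) hx₀ hx₀, rfl, .left_ident _ _ _⟩
  | right_ident a hx hy =>
    constructor
    · intro x y u hu
      obtain ⟨x₀, y₀, a₀, u₀, hx₀, hy₀, rfl, rfl, h⟩ := exists_of_map_eq_right hu
      obtain ⟨_, rfl, rfl, h', rfl⟩ := exists_of_map_eq_ident h
      obtain rfl := eq_of_heq h'
      obtain rfl := hx₀.unique hy₀
      exact ⟨.ident _, congrArg _ ((F.map_isComp hx₀).unique hx), .right_ident _ _ _⟩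
    · intro x y u hu
      obtain ⟨_, rfl, rfl, h, rfl⟩ := exists_of_map_eq_ident hu
      obtain rfl := eq_of_heq h
      obtain ⟨x₀, a₀, rfl, rfl, hx₀⟩ := hF.exists_isComp hx rfl
      exact ⟨.right a₀ (.ident x₀) hx₀ hx₀, rfl, .right_ident _ _ _⟩
  | ident_left hk a t hx hy =>
    constructor
    · intro x y u hu
      obtain ⟨x₀, y₀, a₀, u₀, hx₀, hy₀, rfl, ha, h⟩ := exists_of_map_eq_left hu
      obtain ⟨b, rfl, rfl⟩ := hF.exists_ident hk ha
      obtain rfl := NPrecategory.ident_isComp_le hk hx₀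
      obtain rfl := NPrecategory.ident_isComp_le hk hy₀
      exact ⟨u₀, h, .ident_left hk b u₀ _ _⟩
    · intro x y u hu
      obtain ⟨rfl, rfl⟩ := B hu
      -- The whiskering by an identity has to be created in `C`. Splitting the source `x` gives a
      -- factor over an identity, which is then an identity itself; it also composes with `y`, which
      -- is parallel to `x`.
      obtain ⟨a₀, x₀, ha, -, hx₀⟩ := hF.exists_isComp hx rfl
      obtain ⟨b, rfl, rfl⟩ := hF.exists_ident hk ha
      obtain rfl := NPrecategory.ident_isComp_le hk hx₀
      obtain ⟨y', hy₀⟩ := NPrecategory.exists_isComp_of_parallel_left hx₀ u.parallel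
      obtain rfl := NPrecategory.ident_isComp_le hk hy₀
      exact ⟨.left _ u hx₀ hy₀, congrArg₂ Raw.left ha hu, .ident_left hk b u _ _⟩
  | ident_right hk a t hx hy =>
    constructor
    · intro x y u hu
      obtain ⟨x₀, y₀, a₀, u₀, hx₀, hy₀, rfl, ha, h⟩ := exists_of_map_eq_right hu
      obtain ⟨b, rfl, rfl⟩ := hF.exists_ident hk ha
      obtain rfl := NPrecategory.isComp_ident_le hk hx₀
      obtain rfl := NPrecategory.isComp_ident_le hk hy₀
      exact ⟨u₀, h, .ident_right hk b u₀ _ _⟩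
    · intro x y u hu
      obtain ⟨rfl, rfl⟩ := B hu
      obtain ⟨x₀, a₀, -, ha, hx₀⟩ := hF.exists_isComp hx rfl
      obtain ⟨b, rfl, rfl⟩ := hF.exists_ident hk ha
      obtain rfl := NPrecategory.isComp_ident_le hk hx₀
      obtain ⟨y', hy₀⟩ := NPrecategory.exists_isComp_of_parallel_right hx₀ u.parallel
      obtain rfl := NPrecategory.isComp_ident_le hk hy₀
      exact ⟨.right _ u hx₀ hy₀, congrArg₂ Raw.right ha hu, .ident_right hk b u _ _⟩
  | assoc t t' t'' =>
    constructor
    · intro x y u hu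
      obtain ⟨z, u₁, u₂, rfl, h₁, h₂⟩ := exists_of_map_eq_comp hu
      obtain ⟨w, u₃, u₄, rfl, h₃, h₄⟩ := exists_of_map_eq_comp h₁
      exact ⟨.comp u₃ (.comp u₄ u₂), congrArg₂ Raw.comp h₃ (congrArg₂ Raw.comp h₄ h₂),
        .assoc _ _ _⟩
    · intro x y u hu
      obtain ⟨z, u₁, u₂, rfl, h₁, h₂⟩ := exists_of_map_eq_comp hu
      obtain ⟨w, u₃, u₄, rfl, h₃, h₄⟩ := exists_of_map_eq_comp h₂
      exact ⟨.comp (.comp u₁ u₃) u₄, congrArg₂ Raw.comp (congrArg₂ Raw.comp h₁ h₃) h₄,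
        .assoc _ _ _⟩
  | @left_left k a b ab hab x y x₁ y₁ x₂ y₂ t hx₁ hy₁ hx₂ hy₂ hx hy =>
    have := dim_le a
    constructor
    · intro x' y' u hu
      obtain ⟨x₀, y₀, c₀, u₀, hx₀, hy₀, rfl, rfl, h⟩ := exists_of_map_eq_left hu
      -- Existence splits the whiskering cell over `ab`. The converse direction only multiplies two
      -- cells and uses nothing on `F`.
      obtain ⟨a₀, b₀, rfl, rfl, hc⟩ := hF.exists_isComp hab rfl
      obtain ⟨x₁, hx₁, hx₂⟩ := hc.assoc_right hx₀
        (q := n) (by omega) (by omega) (by omega) (by omega)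
      obtain ⟨y₁, hy₁, hy₂⟩ := hc.assoc_right hy₀
        (q := n) (by omega) (by omega) (by omega) (by omega)
      exact ⟨.left a₀ (.left b₀ u₀ hx₁ hy₁) hx₂ hy₂, congrArg _ (congrArg _ h),
        .left_left hc _ _ _ _ _ _ _⟩
    · intro x' y' u hu
      obtain ⟨x₀, y₀, a₀, u₀, hx₀, hy₀, rfl, rfl, h⟩ := exists_of_map_eq_left hu
      obtain ⟨x₃, y₃, b₀, u₁, hx₃, hy₃, rfl, rfl, h'⟩ := exists_of_map_eq_left h
      obtain ⟨c, hc, hx⟩ := hx₃.assoc_left hx₀ (p := k) (by omega) (by omega) (by omega) (by omega)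
      obtain ⟨c', hc', hy⟩ := hy₃.assoc_left hy₀
        (p := k) (by omega) (by omega) (by omega) (by omega)
      obtain rfl := hc.unique hc'
      exact ⟨.left c u₁ hx hy, congrArg₂ Raw.left ((F.map_isComp hc).unique hab) h',
        .left_left hc _ _ _ _ _ _ _⟩
  | @right_right k a b ab hab x y x₁ y₁ x₂ y₂ t hx₁ hy₁ hx₂ hy₂ hx hy =>
    have := dim_le a
    constructor
    · intro x' y' u hu
      obtain ⟨x₀, y₀, b₀, u₀, hx₀, hy₀, rfl, rfl, h⟩ := exists_of_map_eq_right hu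
      obtain ⟨x₃, y₃, a₀, u₁, hx₃, hy₃, rfl, rfl, h'⟩ := exists_of_map_eq_right h
      obtain ⟨c, hc, hx⟩ := hx₃.assoc_right hx₀ (q := k) (by omega) (by omega) (by omega) (by omega)
      obtain ⟨c', hc', hy⟩ := hy₃.assoc_right hy₀
        (q := k) (by omega) (by omega) (by omega) (by omega)
      obtain rfl := hc.unique hc'
      exact ⟨.right c u₁ hx hy, congrArg₂ Raw.right ((F.map_isComp hc).unique hab) h',
        .right_right hc _ _ _ _ _ _ _⟩
    · intro x' y' u hu
      obtain ⟨x₀, y₀, c₀, u₀, hx₀, hy₀, rfl, rfl, h⟩ := exists_of_map_eq_right hu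
      obtain ⟨a₀, b₀, rfl, rfl, hc⟩ := hF.exists_isComp hab rfl
      obtain ⟨x₁, hx₁, hx₂⟩ := hc.assoc_left hx₀
        (p := n) (by omega) (by omega) (by omega) (by omega)
      obtain ⟨y₁, hy₁, hy₂⟩ := hc.assoc_left hy₀
        (p := n) (by omega) (by omega) (by omega) (by omega)
      exact ⟨.right b₀ (.right a₀ u₀ hx₁ hy₁) hx₂ hy₂, congrArg _ (congrArg _ h),
        .right_right hc _ _ _ _ _ _ _⟩
  -- Pure rebracketing: neither direction uses that `F` is Conduché.
  | @left_right k a b x y x₁ y₁ x₂ y₂ x₃ y₃ t hx₁ hy₁ hx₂ hy₂ hx₁' hy₁' hx₂' hy₂' =>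
    have := dim_le a
    constructor
    · intro x' y' u hu
      obtain ⟨x₀, y₀, b₀, u₀, hx₀, hy₀, rfl, rfl, h⟩ := exists_of_map_eq_right hu
      obtain ⟨x₃, y₃, a₀, u₁, hx₃, hy₃, rfl, rfl, h'⟩ := exists_of_map_eq_left h
      obtain ⟨x₁, hx₁, hx₂⟩ := hx₃.assoc_right hx₀
        (q := n) (by omega) (by omega) (by omega) (by omega)
      obtain ⟨y₁, hy₁, hy₂⟩ := hy₃.assoc_right hy₀
        (q := n) (by omega) (by omega) (by omega) (by omega)
      exact ⟨.left a₀ (.right b₀ u₁ hx₁ hy₁) hx₂ hy₂, congrArg _ (congrArg _ h'),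
        .left_right _ _ _ _ _ _ _ _ _⟩
    · intro x' y' u hu
      obtain ⟨x₀, y₀, a₀, u₀, hx₀, hy₀, rfl, rfl, h⟩ := exists_of_map_eq_left hu
      obtain ⟨x₃, y₃, b₀, u₁, hx₃, hy₃, rfl, rfl, h'⟩ := exists_of_map_eq_right h
      obtain ⟨x₁, hx₁, hx₂⟩ := hx₃.assoc_left hx₀
        (p := n) (by omega) (by omega) (by omega) (by omega)
      obtain ⟨y₁, hy₁, hy₂⟩ := hy₃.assoc_left hy₀
        (p := n) (by omega) (by omega) (by omega) (by omega)
      exact ⟨.right b₀ (.left a₀ u₁ hx₁ hy₁) hx₂ hy₂, congrArg _ (congrArg _ h'),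
        .left_right _ _ _ _ _ _ _ _ _⟩
  | left_comp a t t' hx hy hz =>
    constructor
    · intro x' z' u hu
      obtain ⟨x₀, z₀, a₀, u₀, hx₀, hz₀, rfl, rfl, h⟩ := exists_of_map_eq_left hu
      obtain ⟨y₀, u₁, u₂, rfl, h₁, h₂⟩ := exists_of_map_eq_comp h
      -- The middle cell is parallel to the source of `u₁`, hence composable with `a₀`.
      obtain ⟨y', hy₀⟩ := NPrecategory.exists_isComp_of_parallel_left hx₀ u₁.parallel
      exact ⟨.comp (.left a₀ u₁ hx₀ hy₀) (.left a₀ u₂ hy₀ hz₀),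
        congrArg₂ Raw.comp (congrArg _ h₁) (congrArg _ h₂), .left_comp _ _ _ _ _ _⟩
    · intro x' z' u hu
      obtain ⟨y', u₁, u₂, rfl, h₁, h₂⟩ := exists_of_map_eq_comp hu
      obtain ⟨x₀, y₀, a₀, u₁, hx₀, hy₀, rfl, rfl, h₃⟩ := exists_of_map_eq_left h₁
      obtain ⟨y₁, z₀, a₁, u₂, hy₁, hz₀, rfl, ha, h₄⟩ := exists_of_map_eq_left h₂
      -- The two whiskering cells may differ a priori. The middle cell `y'` decomposes through both
      -- of them, over the same pair of cells of `D`, so uniqueness identifies them together with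
      -- the inner middle cells.
      obtain ⟨rfl, rfl⟩ := hF.isComp_unique hy₀ hy₁ ha.symm ((B h₃).2.symm.trans (B h₄).1)
      exact ⟨.left a₀ (.comp u₁ u₂) hx₀ hz₀, congrArg _ (congrArg₂ Raw.comp h₃ h₄),
        .left_comp _ _ _ _ _ _⟩
  | right_comp a t t' hx hy hz =>
    constructor
    · intro x' z' u hu
      obtain ⟨x₀, z₀, a₀, u₀, hx₀, hz₀, rfl, rfl, h⟩ := exists_of_map_eq_right hu
      obtain ⟨y₀, u₁, u₂, rfl, h₁, h₂⟩ := exists_of_map_eq_comp h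
      obtain ⟨y', hy₀⟩ := NPrecategory.exists_isComp_of_parallel_right hx₀ u₁.parallel
      exact ⟨.comp (.right a₀ u₁ hx₀ hy₀) (.right a₀ u₂ hy₀ hz₀),
        congrArg₂ Raw.comp (congrArg _ h₁) (congrArg _ h₂), .right_comp _ _ _ _ _ _⟩
    · intro x' z' u hu
      obtain ⟨y', u₁, u₂, rfl, h₁, h₂⟩ := exists_of_map_eq_comp hu
      obtain ⟨x₀, y₀, a₀, u₁, hx₀, hy₀, rfl, rfl, h₃⟩ := exists_of_map_eq_right h₁
      obtain ⟨y₁, z₀, a₁, u₂, hy₁, hz₀, rfl, ha, h₄⟩ := exists_of_map_eq_right h₂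
      obtain ⟨rfl, rfl⟩ := hF.isComp_unique hy₀ hy₁ ((B h₃).2.symm.trans (B h₄).1) ha.symm
      exact ⟨.right a₀ (.comp u₁ u₂) hx₀ hz₀, congrArg _ (congrArg₂ Raw.comp h₃ h₄),
        .right_comp _ _ _ _ _ _⟩
  | @left_distrib_left k l hkl a b ab hab x y x₁ y₁ x₂ y₂ x₃ y₃ t hx₁ hy₁ =>
    have := dim_le b
    constructor
    · intro x' y' u hu
      obtain ⟨x₀, y₀, a₀, u₀, hx₀, hy₀, rfl, rfl, h⟩ := exists_of_map_eq_left hu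
      obtain ⟨x₃, y₃, b₀, u₁, hx₃, hy₃, rfl, rfl, h'⟩ := exists_of_map_eq_left h
      obtain ⟨c, x₄, hc, hx₄, hx₅⟩ := hx₃.comp_distrib hx₀ hkl (by omega)
      obtain ⟨c', y₄, hc', hy₄, hy₅⟩ := hy₃.comp_distrib hy₀ hkl (by omega)
      obtain rfl := hc.unique hc'
      exact ⟨.left c (.left a₀ u₁ hx₄ hy₄) hx₅ hy₅,
        congrArg₂ Raw.left ((F.map_isComp hc).unique hab) (congrArg _ h'),
        .left_distrib_left hkl hc _ _ _ _ _ _ _ _ _⟩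
    · intro x' y' u hu
      obtain ⟨x₀, y₀, c, u₀, hx₀, hy₀, rfl, rfl, h⟩ := exists_of_map_eq_left hu
      obtain ⟨x₃, y₃, a₀, u₁, hx₃, hy₃, rfl, ha, h'⟩ := exists_of_map_eq_left h
      obtain ⟨a₁, b₀, rfl, rfl, hc⟩ := hF.exists_isComp hab rfl
      obtain ⟨rfl, rfl⟩ := B h'
      -- Two cells of `C` now lie over `a`: the factor `a₁` of the split cell `c` and the inner
      -- whiskering cell `a₀`. The source of the expression forces them to be equal, after which
      -- distributivity can be undone on source and target alike. The reverse directions of the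
      -- three other distributivity relations go the same way.
      obtain ⟨rfl, x₄, hx₄, hx₅⟩ := hF.comp_distrib hc hx₃ hx₀ ha.symm hx₁ hkl (by omega)
      obtain ⟨-, y₄, hy₄, hy₅⟩ := hF.comp_distrib hc hy₃ hy₀ ha.symm hy₁ hkl (by omega)
      exact ⟨.left a₁ (.left b₀ u₁ hx₄ hy₄) hx₅ hy₅, congrArg _ (congrArg _ h'),
        .left_distrib_left hkl hc _ _ _ _ _ _ _ _ _⟩
  | @left_distrib_right k l hkl a b ab hab x y x₁ y₁ x₂ y₂ x₃ y₃ t hx₁ hy₁ =>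
    have := dim_le b
    constructor
    · intro x' y' u hu
      obtain ⟨x₀, y₀, a₀, u₀, hx₀, hy₀, rfl, rfl, h⟩ := exists_of_map_eq_left hu
      obtain ⟨x₃, y₃, b₀, u₁, hx₃, hy₃, rfl, rfl, h'⟩ := exists_of_map_eq_right h
      obtain ⟨x₄, c, hx₄, hc, hx₅⟩ := hx₃.comp_distrib hx₀ (by omega) hkl
      obtain ⟨y₄, c', hy₄, hc', hy₅⟩ := hy₃.comp_distrib hy₀ (by omega) hkl
      obtain rfl := hc.unique hc'
      exact ⟨.right c (.left a₀ u₁ hx₄ hy₄) hx₅ hy₅,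
        congrArg₂ Raw.right ((F.map_isComp hc).unique hab) (congrArg _ h'),
        .left_distrib_right hkl hc _ _ _ _ _ _ _ _ _⟩
    · intro x' y' u hu
      obtain ⟨x₀, y₀, c, u₀, hx₀, hy₀, rfl, rfl, h⟩ := exists_of_map_eq_right hu
      obtain ⟨x₃, y₃, a₀, u₁, hx₃, hy₃, rfl, ha, h'⟩ := exists_of_map_eq_left h
      obtain ⟨a₁, b₀, rfl, rfl, hc⟩ := hF.exists_isComp hab rfl
      obtain ⟨rfl, rfl⟩ := B h'
      obtain ⟨rfl, x₄, hx₄, hx₅⟩ := hF.comp_distrib hx₃ hc hx₀ ha hx₁ (by omega) hkl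
      obtain ⟨-, y₄, hy₄, hy₅⟩ := hF.comp_distrib hy₃ hc hy₀ ha hy₁ (by omega) hkl
      exact ⟨.left a₀ (.right b₀ u₁ hx₄ hy₄) hx₅ hy₅, congrArg _ (congrArg _ h'),
        .left_distrib_right hkl hc _ _ _ _ _ _ _ _ _⟩
  | @right_distrib_left k l hkl a b ba hba x y x₁ y₁ x₂ y₂ x₃ y₃ t hx₁ hy₁ =>
    have := dim_le b
    constructor
    · intro x' y' u hu
      obtain ⟨x₀, y₀, a₀, u₀, hx₀, hy₀, rfl, rfl, h⟩ := exists_of_map_eq_right hu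
      obtain ⟨x₃, y₃, b₀, u₁, hx₃, hy₃, rfl, rfl, h'⟩ := exists_of_map_eq_left h
      obtain ⟨c, x₄, hc, hx₄, hx₅⟩ := hx₃.distrib_comp hx₀ hkl (by omega)
      obtain ⟨c', y₄, hc', hy₄, hy₅⟩ := hy₃.distrib_comp hy₀ hkl (by omega)
      obtain rfl := hc.unique hc'
      exact ⟨.left c (.right a₀ u₁ hx₄ hy₄) hx₅ hy₅,
        congrArg₂ Raw.left ((F.map_isComp hc).unique hba) (congrArg _ h'),
        .right_distrib_left hkl hc _ _ _ _ _ _ _ _ _⟩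
    · intro x' y' u hu
      obtain ⟨x₀, y₀, c, u₀, hx₀, hy₀, rfl, rfl, h⟩ := exists_of_map_eq_left hu
      obtain ⟨x₃, y₃, a₀, u₁, hx₃, hy₃, rfl, ha, h'⟩ := exists_of_map_eq_right h
      obtain ⟨b₀, a₁, rfl, rfl, hc⟩ := hF.exists_isComp hba rfl
      obtain ⟨rfl, rfl⟩ := B h'
      obtain ⟨rfl, x₄, hx₄, hx₅⟩ := hF.distrib_comp hc hx₃ hx₀ ha.symm hx₁ hkl (by omega)
      obtain ⟨-, y₄, hy₄, hy₅⟩ := hF.distrib_comp hc hy₃ hy₀ ha.symm hy₁ hkl (by omega)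
      exact ⟨.right a₁ (.left b₀ u₁ hx₄ hy₄) hx₅ hy₅, congrArg _ (congrArg _ h'),
        .right_distrib_left hkl hc _ _ _ _ _ _ _ _ _⟩
  | @right_distrib_right k l hkl a b ba hba x y x₁ y₁ x₂ y₂ x₃ y₃ t hx₁ hy₁ =>
    have := dim_le b
    constructor
    · intro x' y' u hu
      obtain ⟨x₀, y₀, a₀, u₀, hx₀, hy₀, rfl, rfl, h⟩ := exists_of_map_eq_right hu
      obtain ⟨x₃, y₃, b₀, u₁, hx₃, hy₃, rfl, rfl, h'⟩ := exists_of_map_eq_right h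
      obtain ⟨x₄, c, hx₄, hc, hx₅⟩ := hx₃.distrib_comp hx₀ (by omega) hkl
      obtain ⟨y₄, c', hy₄, hc', hy₅⟩ := hy₃.distrib_comp hy₀ (by omega) hkl
      obtain rfl := hc.unique hc'
      exact ⟨.right c (.right a₀ u₁ hx₄ hy₄) hx₅ hy₅,
        congrArg₂ Raw.right ((F.map_isComp hc).unique hba) (congrArg _ h'),
        .right_distrib_right hkl hc _ _ _ _ _ _ _ _ _⟩
    · intro x' y' u hu
      obtain ⟨x₀, y₀, c, u₀, hx₀, hy₀, rfl, rfl, h⟩ := exists_of_map_eq_right hu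
      obtain ⟨x₃, y₃, a₀, u₁, hx₃, hy₃, rfl, ha, h'⟩ := exists_of_map_eq_right h
      obtain ⟨b₀, a₁, rfl, rfl, hc⟩ := hF.exists_isComp hba rfl
      obtain ⟨rfl, rfl⟩ := B h'
      obtain ⟨rfl, x₄, hx₄, hx₅⟩ := hF.distrib_comp hx₃ hc hx₀ ha hx₁ (by omega) hkl
      obtain ⟨-, y₄, hy₄, hy₅⟩ := hF.distrib_comp hy₃ hc hy₀ ha hy₁ (by omega) hkl
      exact ⟨.right a₀ (.right b₀ u₁ hx₄ hy₄) hx₅ hy₅, congrArg _ (congrArg _ h'),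
        .right_distrib_right hkl hc _ _ _ _ _ _ _ _ _⟩

/-- Symmetry exchanges the two halves of `LiftsRel`, which is the reason for having both. -/
theorem Rel.eqvGen_lifts (hF : F.IsConduche) (hs : ∀ g, H.src (f g) = F.map (G.src g))
    (ht : ∀ g, H.tgt (f g) = F.map (G.tgt g)) {x' y' : D.cell n} {s s' : Tm H x' y'}
    (h : Relation.EqvGen Rel s s') : LiftsRel F f (Relation.EqvGen Rel) s.raw s'.raw := by
  induction h with
  | rel _ _ h =>
    obtain ⟨h₁, h₂⟩ := h.lifts hF hs ht
    refine ⟨fun t e => ?_, fun t e => ?_⟩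
    · obtain ⟨t', e', r⟩ := h₁ t e
      exact ⟨t', e', .rel _ _ r⟩
    · obtain ⟨t', e', r⟩ := h₂ t e
      exact ⟨t', e', .rel _ _ r⟩
  | refl => exact ⟨fun t e => ⟨t, e, .refl _⟩, fun t e => ⟨t, e, .refl _⟩⟩
  | symm _ _ _ ih =>
    refine ⟨fun t e => ?_, fun t e => ?_⟩
    · obtain ⟨t', e', r⟩ := ih.2 t e
      exact ⟨t', e', .symm _ _ r⟩
    · obtain ⟨t', e', r⟩ := ih.1 t e
      exact ⟨t', e', .symm _ _ r⟩
  | trans _ _ _ _ _ ih ih' =>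
    refine ⟨fun t e => ?_, fun t e => ?_⟩
    · obtain ⟨t', e', r⟩ := ih.1 t e
      obtain ⟨t'', e'', r'⟩ := ih'.1 t' e'
      exact ⟨t'', e'', .trans _ _ _ r r'⟩
    · obtain ⟨t', e', r⟩ := ih'.2 t e
      obtain ⟨t'', e'', r'⟩ := ih.2 t' e'
      exact ⟨t'', e'', .trans _ _ _ r' r⟩

end liftRel

end CellExtension

/-! ### Cells of the free extension, represented by expressions. -/

namespace CellExtension

variable {n : ℕ} {C D : NPrecategory.{u} n} {G : CellExtension C} {H : CellExtension D}

namespace Tm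

/-- The cell of the free extension denoted by an expression. -/
def cell {x y : C.cell n} (t : Tm G x y) : FreeCell G (n + 1) := .top (Quot.mk _ t)

theorem exists_cell_eq {x y : C.cell n} (q : FreeHom G x y) :
    ∃ t : Tm G x y, FreeCell.top q = t.cell := by
  obtain ⟨t⟩ := q
  exact ⟨t, rfl⟩

theorem cell_eq {x y : C.cell n} {t t' : Tm G x y} (h : Relation.EqvGen Rel t t') :
    t.cell = t'.cell :=
  congrArg FreeCell.top (Quot.eqvGen_sound h)

theorem boundary_of_cell_eq {x y x' y' : C.cell n} {t : Tm G x y} {t' : Tm G x' y'}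
    (h : t.cell = t'.cell) : x = x' ∧ y = y' :=
  ⟨low_inj.1 (congrArg FreeCell.src h), low_inj.1 (congrArg FreeCell.tgt h)⟩

/-- `FreeHom` is the quotient by `Rel`, which is not itself an equivalence relation, so equal
classes are joined by a zigzag. -/
theorem eqvGen_of_cell_eq {x y : C.cell n} {t t' : Tm G x y} (h : t.cell = t'.cell) :
    Relation.EqvGen Rel t t' := by
  obtain ⟨-, -, h⟩ := FreeCell.top.inj h
  exact Quot.eqvGen_exact (eq_of_heq h)

theorem gens_eq_of_cell_eq {x y x' y' : C.cell n} {t : Tm G x y} {t' : Tm G x' y'}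
    (h : t.cell = t'.cell) : t.raw.gens = t'.raw.gens := by
  obtain ⟨rfl, rfl⟩ := boundary_of_cell_eq h
  exact Rel.gens_eq_of_eqvGen (eqvGen_of_cell_eq h)

theorem isComp_cell {x y z : C.cell n} (t : Tm G x y) (t' : Tm G y z) :
    G.free.IsComp t.cell t'.cell (t.comp t').cell :=
  have h : n + 1 = min (n + 1) (n + 1) := by omega
  ⟨n, h, by omega, (composable_top_top h).2 rfl, rfl⟩

theorem isComp_left_cell {k : ℕ} {a : C.cell k} {x y x' y' : C.cell n} (t : Tm G x y)
    (hx : C.IsComp a x x') (hy : C.IsComp a y y') :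
    G.free.IsComp (FreeCell.low a) t.cell (t.left a hx hy).cell := by
  have := dim_le a
  have d := hx.dim
  obtain ⟨i, rfl⟩ : ∃ i, k = i + 1 := ⟨k - 1, by omega⟩
  have hi : i + 1 = min (i + 1) (n + 1) := by omega
  have hi' : i + 1 = min (i + 1) n := by omega
  have h := (composable_low_top (q := Quot.mk _ t) hi hi').2 (hx.eq hi' d.2.2).choose
  exact ⟨i, hi, by omega, h, comp_low_top hi (by omega) a (Quot.mk _ t) h hx hy⟩

theorem isComp_right_cell {k : ℕ} {a : C.cell k} {x y x' y' : C.cell n} (t : Tm G x y)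
    (hx : C.IsComp x a x') (hy : C.IsComp y a y') :
    G.free.IsComp t.cell (FreeCell.low a) (t.right a hx hy).cell := by
  have := dim_le a
  have d := hx.dim
  obtain ⟨i, rfl⟩ : ∃ i, k = i + 1 := ⟨k - 1, by omega⟩
  have hi : i + 1 = min (n + 1) (i + 1) := by omega
  have hi' : i + 1 = min n (i + 1) := by omega
  have h := (composable_top_low (q := Quot.mk _ t) hi hi').2 (hy.eq hi' d.2.2).choose
  exact ⟨i, hi, by omega, h, comp_top_low hi (by omega) a (Quot.mk _ t) h hx hy⟩

/-- Turns a composite in the free extension into a formal composite: in the target, this is the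
expression towards which a zigzag is lifted; in the source, it exhibits the boundary and the
generators of the composite. -/
theorem exists_of_isComp_left {k : ℕ} {a : C.cell k} {x y : C.cell n} {t : Tm G x y}
    {w : FreeCell G (n + 1)} (h : G.free.IsComp (FreeCell.low a) t.cell w) :
    ∃ (x' y' : C.cell n) (hx : C.IsComp a x x') (hy : C.IsComp a y y'),
      w = (t.left a hx hy).cell := by
  obtain ⟨i, hi, hm, hc, h'⟩ := id h
  obtain ⟨x', y', hx, hy⟩ := exists_left hi hc
  exact ⟨x', y', hx, hy, h.unique (t.isComp_left_cell hx hy)⟩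

theorem exists_of_isComp_right {k : ℕ} {a : C.cell k} {x y : C.cell n} {t : Tm G x y}
    {w : FreeCell G (n + 1)} (h : G.free.IsComp t.cell (FreeCell.low a) w) :
    ∃ (x' y' : C.cell n) (hx : C.IsComp x a x') (hy : C.IsComp y a y'),
      w = (t.right a hx hy).cell := by
  obtain ⟨i, hi, hm, hc, h'⟩ := id h
  obtain ⟨x', y', hx, hy⟩ := exists_right hi hc
  exact ⟨x', y', hx, hy, h.unique (t.isComp_right_cell hx hy)⟩

theorem eq_of_isComp_cell {x y z w : C.cell n} {t : Tm G x y} {t' : Tm G z w}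
    {c : FreeCell G (n + 1)} (h : G.free.IsComp t.cell t'.cell c) : y = z := by
  obtain ⟨i, hi, hm, hc, -⟩ := h
  exact (composable_top_top hi).1 hc

end Tm

theorem isComp_low {k l m : ℕ} {a : C.cell k} {b : C.cell l} {c : C.cell m} :
    G.free.IsComp (FreeCell.low a) (FreeCell.low b) (FreeCell.low c) ↔ C.IsComp a b c := by
  refine ⟨fun ⟨i, hi, hm, h, e⟩ => ⟨i, hi, hm, (composable_low_low hi).1 h, low_inj.1 e⟩,
    fun h => G.incl.map_isComp h⟩

/-! ### The free extension of a Conduché prefunctor is Conduché. -/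

variable {F : NPrefunctor C D} {f : G.gen → H.gen} {hs : ∀ g, H.src (f g) = F.map (G.src g)}
  {ht : ∀ g, H.tgt (f g) = F.map (G.tgt g)}

/-- Links the prefunctor given by the universal property with the syntactic `Raw.map`: both respect
every operation, and composites are unique. -/
theorem freeMap_cell {x y : C.cell n} {x' y' : D.cell n} {t : Tm G x y} {s : Tm H x' y'}
    (h : t.raw.map F f = s.raw) : (freeMap F f hs ht).map t.cell = s.cell := by
  induction t generalizing x' y' with
  | gen g =>
    cases s <;> simp only [Tm.raw, Raw.map, Raw.gen.injEq, reduceCtorEq] at h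
    subst h
    rfl
  | ident x =>
    cases s <;> simp only [Tm.raw, Raw.map, Raw.ident.injEq, reduceCtorEq] at h
    subst h
    exact ident_top (G := H) le_rfl (F.map x)
  | comp t t' ih ih' =>
    cases s <;> simp only [Tm.raw, Raw.map, Raw.comp.injEq, reduceCtorEq] at h
    have e := (freeMap F f hs ht).map_isComp (t.isComp_cell t')
    rw [ih h.1, ih' h.2] at e
    exact e.unique (Tm.isComp_cell _ _)
  | left a t hx hy ih =>
    cases s <;> simp only [Tm.raw, Raw.map, Raw.left.injEq, reduceCtorEq] at h
    obtain ⟨rfl, h₁, h₂⟩ := h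
    obtain rfl := eq_of_heq h₁
    have e := (freeMap F f hs ht).map_isComp (t.isComp_left_cell hx hy)
    rw [ih h₂] at e
    exact e.unique (Tm.isComp_left_cell _ _ _)
  | right a t hx hy ih =>
    cases s <;> simp only [Tm.raw, Raw.map, Raw.right.injEq, reduceCtorEq] at h
    obtain ⟨rfl, h₁, h₂⟩ := h
    obtain rfl := eq_of_heq h₁
    have e := (freeMap F f hs ht).map_isComp (t.isComp_right_cell hx hy)
    rw [ih h₂] at e
    exact e.unique (Tm.isComp_right_cell _ _ _)

theorem exists_freeMap_cell_eq {x y : C.cell n} (t : Tm G x y) :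
    ∃ s : Tm H (F.map x) (F.map y), t.raw.map F f = s.raw ∧
      (freeMap F f hs ht).map t.cell = s.cell := by
  obtain ⟨s, h⟩ := t.exists_map F f hs ht
  exact ⟨s, h, freeMap_cell h⟩

/-- A decomposition in the target of the free extension of a Conduché prefunctor lifts along
expressions. -/
theorem exists_cell_eq_of_freeMap_eq (hF : F.IsConduche) {x y : C.cell n} {x' y' : D.cell n}
    {t : Tm G x y} {s : Tm H x' y'} (h : (freeMap F f hs ht).map t.cell = s.cell) :
    ∃ t' : Tm G x y, t.cell = t'.cell ∧ t'.raw.map F f = s.raw := by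
  obtain ⟨s', e, h'⟩ := exists_freeMap_cell_eq (F := F) (f := f) (hs := hs) (ht := ht) t
  have h := h'.symm.trans h
  obtain ⟨rfl, rfl⟩ := Tm.boundary_of_cell_eq h
  -- The zigzag from the syntactic image of `t` to `s` is lifted, starting at `t`.
  obtain ⟨t', h₁, h₂⟩ := (Rel.eqvGen_lifts hF hs ht (Tm.eqvGen_of_cell_eq h)).1 t e
  exact ⟨t', Tm.cell_eq h₂, h₁⟩

theorem map_boundary_of_freeMap_eq {x y x' y' : C.cell n} {t : Tm G x y} {t' : Tm G x' y'}
    (h : (freeMap F f hs ht).map t.cell = (freeMap F f hs ht).map t'.cell) :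
    F.map x = F.map x' ∧ F.map y = F.map y' := by
  obtain ⟨s, -, e⟩ := exists_freeMap_cell_eq (F := F) (f := f) (hs := hs) (ht := ht) t
  obtain ⟨s', -, e'⟩ := exists_freeMap_cell_eq (F := F) (f := f) (hs := hs) (ht := ht) t'
  exact Tm.boundary_of_cell_eq (e.symm.trans (h.trans e'))

/-- Only the lengths can be compared, as `f` may identify generators. The length is all that is
needed to cut a concatenated list. -/
theorem length_gens_of_freeMap_eq {x y x' y' : C.cell n} {t : Tm G x y} {t' : Tm G x' y'}
    (h : (freeMap F f hs ht).map t.cell = (freeMap F f hs ht).map t'.cell) :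
    t.raw.gens.length = t'.raw.gens.length := by
  obtain ⟨s, e₁, e⟩ := exists_freeMap_cell_eq (F := F) (f := f) (hs := hs) (ht := ht) t
  obtain ⟨s', e₁', e'⟩ := exists_freeMap_cell_eq (F := F) (f := f) (hs := hs) (ht := ht) t'
  have := Tm.gens_eq_of_cell_eq (e.symm.trans (h.trans e'))
  rw [← e₁, ← e₁', Raw.gens_map, Raw.gens_map] at this
  simpa using congrArg List.length this

/-- A freely generated cell is determined by its source, its generators and its image. -/
theorem cell_eq_of_freeMap_eq (hF : F.IsConduche) {x y y' : C.cell n} {t : Tm G x y}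
    {t' : Tm G x y'} (h : (freeMap F f hs ht).map t.cell = (freeMap F f hs ht).map t'.cell)
    (hg : t.raw.gens = t'.raw.gens) : t.cell = t'.cell := by
  obtain ⟨s, e, e'⟩ := exists_freeMap_cell_eq (F := F) (f := f) (hs := hs) (ht := ht) t'
  -- The images agree only as cells. Passing to an equivalent `t''`, which has the generators of
  -- `t`, makes them agree as expressions.
  obtain ⟨t'', h₁, h₂⟩ := exists_cell_eq_of_freeMap_eq hF (h.trans e')
  obtain ⟨rfl, h₃⟩ := t''.eq_of_map_eq F f hs ht hF t' (h₂.trans e.symm)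
    ((Tm.gens_eq_of_cell_eq h₁).symm.trans hg)
  rw [h₁, eq_of_heq h₃]

/-- A low cell decomposes into low cells, which is the case of `F`. For an `(n+1)`-cell some factor
is freely generated, and the composite is denoted by a formal left whiskering, right whiskering or
`n`-composite. -/
theorem exists_isComp_of_freeMap (hF : F.IsConduche) {k l m : ℕ} {u : FreeCell G m}
    {v₁ : FreeCell H k} {v₂ : FreeCell H l}
    (h : H.free.IsComp v₁ v₂ ((freeMap F f hs ht).map u)) :
    ∃ u₁ u₂, (freeMap F f hs ht).map u₁ = v₁ ∧ (freeMap F f hs ht).map u₂ = v₂ ∧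
      G.free.IsComp u₁ u₂ u := by
  have d := h.dim
  cases u with
  | low c =>
    have := dim_le c
    cases v₁ with
    | top q => omega
    | low a =>
      cases v₂ with
      | top q => omega
      | low b =>
        obtain ⟨a₀, b₀, rfl, rfl, h₀⟩ := hF.exists_isComp (isComp_low.1 h) rfl
        exact ⟨.low a₀, .low b₀, rfl, rfl, isComp_low.2 h₀⟩
  | top q =>
    obtain ⟨t, hq⟩ := Tm.exists_cell_eq q
    rw [hq] at h ⊢
    cases v₁ with
    | low a =>
      have := dim_le a
      cases v₂ with
      | low b =>
        have := dim_le b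
        omega
      | top q₂ =>
        obtain ⟨s, hs'⟩ := Tm.exists_cell_eq q₂
        rw [hs'] at h ⊢
        obtain ⟨x', y', hx, hy, e⟩ := Tm.exists_of_isComp_left h
        obtain ⟨t', e', h'⟩ := exists_cell_eq_of_freeMap_eq hF e
        -- The image of `t'` is now literally a whiskering, so `t'` is one too, and its parts are
        -- the required factors.
        obtain ⟨x₀, y₀, a₀, t₀, hx₀, hy₀, rfl, rfl, h₀⟩ := Tm.exists_of_map_eq_left h'
        exact ⟨.low a₀, t₀.cell, rfl, freeMap_cell h₀, e' ▸ t₀.isComp_left_cell hx₀ hy₀⟩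
    | top q₁ =>
      obtain ⟨s, hs'⟩ := Tm.exists_cell_eq q₁
      rw [hs'] at h ⊢
      cases v₂ with
      | low a =>
        obtain ⟨x', y', hx, hy, e⟩ := Tm.exists_of_isComp_right h
        obtain ⟨t', e', h'⟩ := exists_cell_eq_of_freeMap_eq hF e
        obtain ⟨x₀, y₀, a₀, t₀, hx₀, hy₀, rfl, rfl, h₀⟩ := Tm.exists_of_map_eq_right h'
        exact ⟨t₀.cell, .low a₀, freeMap_cell h₀, rfl, e' ▸ t₀.isComp_right_cell hx₀ hy₀⟩
      | top q₂ =>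
        obtain ⟨s', hs''⟩ := Tm.exists_cell_eq q₂
        rw [hs''] at h ⊢
        obtain rfl := Tm.eq_of_isComp_cell h
        obtain ⟨t', e', h'⟩ := exists_cell_eq_of_freeMap_eq hF (h.unique (s.isComp_cell s'))
        obtain ⟨y₀, t₁, t₂, rfl, h₁, h₂⟩ := Tm.exists_of_map_eq_comp h'
        exact ⟨t₁.cell, t₂.cell, freeMap_cell h₁, freeMap_cell h₂, e' ▸ t₁.isComp_cell t₂⟩

/-- By `cell_eq_of_freeMap_eq`, it suffices that corresponding freely generated factors have the
same source and the same generators; both are recovered from `u`. -/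
theorem isComp_unique_of_freeMap (hF : F.IsConduche) {k l m : ℕ} {u : FreeCell G m}
    {u₁ u₁' : FreeCell G k} {u₂ u₂' : FreeCell G l} (h : G.free.IsComp u₁ u₂ u)
    (h' : G.free.IsComp u₁' u₂' u)
    (e₁ : (freeMap F f hs ht).map u₁ = (freeMap F f hs ht).map u₁')
    (e₂ : (freeMap F f hs ht).map u₂ = (freeMap F f hs ht).map u₂') : u₁ = u₁' ∧ u₂ = u₂' := by
  have d := h.dim
  cases u with
  | low c =>
    have := dim_le c
    cases u₁ with
    | top q => omega
    | low a =>
    cases u₁' with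
    | top q => omega
    | low a' =>
    cases u₂ with
    | top q => omega
    | low b =>
    cases u₂' with
    | top q => omega
    | low b' =>
    obtain ⟨rfl, rfl⟩ := hF.isComp_unique (isComp_low.1 h) (isComp_low.1 h') (low_inj.1 e₁)
      (low_inj.1 e₂)
    exact ⟨rfl, rfl⟩
  | top q =>
    cases u₁ with
    | low a =>
      have := dim_le a
      cases u₁' with
      | top q => omega
      | low a' =>
      cases u₂ with
      | low b =>
        have := dim_le b
        omega
      | top p =>
      cases u₂' with
      | low b =>
        have := dim_le b
        omega
      | top p' =>
      obtain ⟨t, hp⟩ := Tm.exists_cell_eq p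
      obtain ⟨t', hp'⟩ := Tm.exists_cell_eq p'
      rw [hp] at h e₂ ⊢
      rw [hp'] at h' e₂ ⊢
      obtain ⟨x₁, y₁, hx, hy, e⟩ := Tm.exists_of_isComp_left h
      obtain ⟨x₁', y₁', hx', hy', e'⟩ := Tm.exists_of_isComp_left h'
      have e := e.symm.trans e'
      obtain ⟨rfl, rfl⟩ := Tm.boundary_of_cell_eq e
      -- The source of `u` splits in two ways over the same pair of cells of `D`.
      obtain ⟨rfl, rfl⟩ := hF.isComp_unique hx hx' (low_inj.1 e₁)
        (map_boundary_of_freeMap_eq e₂).1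
      -- Whiskering does not change the list of generators, so `t` and `t'` both have that of `u`.
      exact ⟨rfl, cell_eq_of_freeMap_eq hF e₂
        (Tm.gens_eq_of_cell_eq e : (t.left a hx hy).raw.gens = (t'.left a hx' hy').raw.gens)⟩
    | top p₁ =>
    cases u₁' with
    | low a =>
      have := dim_le a
      omega
    | top p₁' =>
    obtain ⟨t₁, hp₁⟩ := Tm.exists_cell_eq p₁
    obtain ⟨t₁', hp₁'⟩ := Tm.exists_cell_eq p₁'
    rw [hp₁] at h e₁ ⊢
    rw [hp₁'] at h' e₁ ⊢
    cases u₂ with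
    | low a =>
      have := dim_le a
      cases u₂' with
      | top q => omega
      | low a' =>
      obtain ⟨x₁, y₁, hx, hy, e⟩ := Tm.exists_of_isComp_right h
      obtain ⟨x₁', y₁', hx', hy', e'⟩ := Tm.exists_of_isComp_right h'
      have e := e.symm.trans e'
      obtain ⟨rfl, rfl⟩ := Tm.boundary_of_cell_eq e
      obtain ⟨rfl, rfl⟩ := hF.isComp_unique hx hx' (map_boundary_of_freeMap_eq e₁).1
        (low_inj.1 e₂)
      exact ⟨cell_eq_of_freeMap_eq hF e₁
        (Tm.gens_eq_of_cell_eq e : (t₁.right a hx hy).raw.gens = (t₁'.right a hx' hy').raw.gens),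
        rfl⟩
    | top p₂ =>
      cases u₂' with
      | low a =>
        have := dim_le a
        omega
      | top p₂' =>
      obtain ⟨t₂, hp₂⟩ := Tm.exists_cell_eq p₂
      obtain ⟨t₂', hp₂'⟩ := Tm.exists_cell_eq p₂'
      rw [hp₂] at h e₂ ⊢
      rw [hp₂'] at h' e₂ ⊢
      obtain rfl := Tm.eq_of_isComp_cell h
      obtain rfl := Tm.eq_of_isComp_cell h'
      have e := (h.unique (t₁.isComp_cell t₂)).symm.trans (h'.unique (t₁'.isComp_cell t₂'))
      obtain ⟨rfl, rfl⟩ := Tm.boundary_of_cell_eq e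
      obtain ⟨hg₁, hg₂⟩ := List.append_inj (Tm.gens_eq_of_cell_eq e)
        (length_gens_of_freeMap_eq e₁)
      have c₁ := cell_eq_of_freeMap_eq hF e₁ hg₁
      -- The equality of the first factors provides the common source of the second ones.
      obtain ⟨-, rfl⟩ := Tm.boundary_of_cell_eq c₁
      exact ⟨c₁, cell_eq_of_freeMap_eq hF e₂ hg₂⟩

theorem isConduche_freeMap (hF : F.IsConduche) : (freeMap F f hs ht).IsConduche :=
  NPrefunctor.IsConduche.of_isComp (exists_isComp_of_freeMap hF) (isComp_unique_of_freeMap hF)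

end CellExtension

/-! ### Passage to the limit of a tower. -/

namespace PrecategoryTower

variable {T T' : PrecategoryTower.{u}}

/-- With `up_injective`, this brings the factors found in stage `m` back to the stage of their own
dimension, where the limit keeps its cells. -/
theorem up_surjective (T : PrecategoryTower.{u}) {k m : ℕ} (h : k ≤ m) :
    Function.Surjective ((T.up h).map (k := k)) := by
  induction m, h using Nat.le_induction with
  | base => rw [up_self]; exact fun x => ⟨x, rfl⟩
  | succ m h ih =>
    rw [T.up_succ h]
    exact ((T.isTruncation m k (by exact_mod_cast h)).2).comp ih

/-- By construction, the limit computes an `m`-dimensional composite in stage `m`, where `z` already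
lives and only the factors have to be transported. -/
theorem isComp_limit_iff {k l m : ℕ} {x : (T.obj k).cell k} {y : (T.obj l).cell l}
    {z : (T.obj m).cell m} (hk : k ≤ m) (hl : l ≤ m) :
    T.limit.IsComp x y z ↔ (T.obj m).IsComp ((T.up hk).map x) ((T.up hl).map y) z := by
  constructor
  · rintro ⟨i, hi, hm, h, rfl⟩
    exact T.isComp_self hi hm x y h
  · rintro ⟨i, hi, hm, h, e⟩
    exact ⟨i, hi, hm, (T.composable_up hi hk hl).2 h, e⟩

theorem map_up (F : ∀ n, NPrefunctor (T.obj n) (T'.obj n))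
    (hF : ∀ n {k : ℕ} (x : (T.obj n).cell k),
      (F (n + 1)).map ((T.incl n).map x) = (T'.incl n).map ((F n).map x))
    {k m : ℕ} (h : k ≤ m) {j : ℕ} (x : (T.obj k).cell j) :
    (F m).map ((T.up h).map x) = (T'.up h).map ((F k).map x) := by
  induction m, h using Nat.le_induction with
  | base => rw [up_self, up_self]; rfl
  | succ m h ih =>
    rw [T.up_succ h, T'.up_succ h]
    exact (hF m _).trans (congrArg _ ih)

/-- Decomposing an `m`-cell of the limit is the same problem as decomposing it in stage `m`, so the
Conduché property of `F m` suffices and nothing has to be glued across stages. -/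
theorem isConduche_limitMap (F : ∀ n, NPrefunctor (T.obj n) (T'.obj n))
    (hF : ∀ n {k : ℕ} (x : (T.obj n).cell k),
      (F (n + 1)).map ((T.incl n).map x) = (T'.incl n).map ((F n).map x))
    (h : ∀ n, (F n).IsConduche) : (limitMap F hF).IsConduche := by
  refine NPrefunctor.IsConduche.of_isComp ?_ ?_
  · intro k l m u v₁ v₂ hv
    have d := hv.dim
    have hk : k ≤ m := by omega
    have hl : l ≤ m := by omega
    obtain ⟨w₁, w₂, h₁, h₂, hw⟩ := NPrefunctor.IsConduche.exists_isComp (h m)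
      ((isComp_limit_iff hk hl).1 hv) rfl
    obtain ⟨u₁, rfl⟩ := T.up_surjective hk w₁
    obtain ⟨u₂, rfl⟩ := T.up_surjective hl w₂
    rw [map_up F hF] at h₁ h₂
    exact ⟨u₁, u₂, T'.up_injective hk le_rfl h₁, T'.up_injective hl le_rfl h₂,
      (isComp_limit_iff hk hl).2 hw⟩
  · intro k l m u u₁ u₁' u₂ u₂' hu hu' e₁ e₂
    have d := hu.dim
    have hk : k ≤ m := by omega
    have hl : l ≤ m := by omega
    obtain ⟨h₁, h₂⟩ := NPrefunctor.IsConduche.isComp_unique (h m)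
      ((isComp_limit_iff hk hl).1 hu)
      ((isComp_limit_iff hk hl).1 hu')
      (by rw [map_up F hF, map_up F hF]; exact congrArg _ e₁)
      (by rw [map_up F hF, map_up F hF]; exact congrArg _ e₂)
    exact ⟨T.up_injective hk le_rfl h₁, T.up_injective hl le_rfl h₂⟩

end PrecategoryTower

/-! ### Conclusion for polygraphs. -/

theorem NPrefunctor.isConduche_discrete {X Y : Type u} (f : X → Y) :
    (NPrefunctor.discrete f).IsConduche := by
  intro i k₁ k₂ k hi hk u
  -- Composition requires factors of positive dimension, so `k` is positive and there is no such
  -- cell `u`.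
  exact (DiscreteCell.false (by omega) u).elim

/-- The prefunctor induced in dimension `n + 1` is by definition `freeMap` of the one induced by the
truncation, so the recursion is on the truncated morphism. -/
theorem FinPolygraph.Hom.isConduche_free :
    ∀ {n : ℕ} {P Q : FinPolygraph.{u} n} (F : Hom P Q), F.free.IsConduche
  | 0, _, _, F => NPrefunctor.isConduche_discrete F
  | _ + 1, _, _, F => CellExtension.isConduche_freeMap (hs := F.src_onGen) (ht := F.tgt_onGen)
    (isConduche_free F.trunc)

theorem OmegaPolygraph.Hom.isConduche_free {P Q : OmegaPolygraph.{u}} (F : Hom P Q) :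
    F.free.IsConduche :=
  PrecategoryTower.isConduche_limitMap (T := P.tower) (T' := Q.tower) _ _
    fun n => (F.stage n).isConduche_free

theorem mainTheorem2 (n : ℕ∞) (P Q : Polygraph.{u} n) (F : Polygraph.Hom P Q) :
    F.free.IsConduche := by
  match n, P, Q, F with
  | some _, _, _, F => exact fun {_ _ _ _} => FinPolygraph.Hom.isConduche_free F
  | none, _, _, F => exact fun {_ _ _ _} => OmegaPolygraph.Hom.isConduche_free F
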